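/- **Conventions.** All algebras are associative algebras over $\mathbb{C}$, not necessarily unital. $V\cdot W$ is the span of the products $vw$. $M(A)$ is the algebra of pairs $m=(\lambda,\rho)\in \mathrm{End}(A)\oplus\mathrm{End}(A)^{\mathrm{op}}$ with $a(mb)=(am)b$, where $ma=\lambda(a)$, $am=\rho(a)$; infinite sums in $M(A)$ converge strictly (for each $a\in A$ the left and right actions of the finite partial sums on $a$ are eventually constant). $A$ is non-degenerate if $aA=0$ implies $a=0$ and $Aa=0$ implies $a=0$, and idempotent if $A\cdot A=A$. $\sigma$ is the flip of $A\otimes A$. **Partial algebras.** For a set $J$, a $J$-partial algebra is an algebra with a vector space grading $A=\bigoplus_{i,j\in J}A(i,j)$ such that $A(i,j)A(j',k)=0$ for $j\ne j'$ and $A(i,j)A(j,k)\subseteq A(i,k)$. Put $A_j=\bigoplus_i A(i,j)$ and ${}_iA=\bigoplus_j A(i,j)$. It is non-degenerate (as a partial algebra) if $aA_j=0$, $a\in A_j$ imply $a=0$, and ${}_iA\,a=0$, $a\in{}_iA$ imply $a=0$, for all $i,j$; it is idempotent (as a partial algebra) if $A_j\cdot A_j=A_j$ and ${}_iA\cdot{}_iA={}_iA$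 for all $i,j$. The base units $\mathbf 1(j)\in M(A)$ satisfy $\mathbf 1(j)a=\delta_{j,i}a$, $a\mathbf 1(j)=\delta_{j,k}a$ for $a\in A(i,k)$. For $J=I^2=I\times I$ put $\mathbf 1^r=\sum_t\mathbf 1(r,t)$, $\mathbf 1_t=\sum_r\mathbf 1(r,t)$, and let $A^r=A\mathbf 1^r$, $A_t=A\mathbf 1_t$, ${}^rA=\mathbf 1^rA$, ${}_tA=\mathbf 1_tA$ for $r,t\in I$. Let $E_0=\sum_t\mathbf 1_t\otimes\mathbf 1^t\in M(A\otimes A)$ and $A\otimes^IA=E_0(A\otimes A)E_0$, an $I^2$-partial algebra with components $(A\otimes^I A)((r,v),(s,w))=\bigoplus_{t,u}A((r,t),(s,u))\otimes A((t,v),(u,w))$. Multipliers of $A\otimes^IA$ are identified with elements of $E_0M(A\otimes A)E_0$. **Weak multiplier Hopf algebras (Van Daele–Wang).** Let $A$ be a non-degenerate idempotent algebra and $\Delta:A\to M(A\otimes A)$ a homomorphism such that $T_1(a\otimes b)=\Delta(a)(1\otimes b)$ and $T_2(a\otimes b)=(a\otimes1)\Delta(b)$ lie in $A\otimes A$, with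 $(a\otimes1\otimes1)(\Delta\otimes\mathrm{id})(\Delta(b)(1\otimes c))=(\mathrm{id}\otimes\Delta)((a\otimes1)\Delta(b))(1\otimes1\otimes c)$. $(A,\Delta)$ is a weak multiplier Hopf algebra with $\Delta(1)=E$ if: $\Delta$ is full (if $T_1(A\otimes A)\subseteq V\otimes A$ then $V=A$; if $T_2(A\otimes A)\subseteq A\otimes W$ then $W=A$); there is a functional $\varepsilon$ with $(\varepsilon\otimes\mathrm{id})(\Delta(a)(1\otimes b))=ab=(\mathrm{id}\otimes\varepsilon)((a\otimes1)\Delta(b))$; $E\in M(A\otimes A)$ is an idempotent with $T_1(A\otimes A)=E(A\otimes A)$ and $T_2(A\otimes A)=(A\otimes A)E$; $(\Delta\otimes\mathrm{id})(E)=(\mathrm{id}\otimes\Delta)(E)=(E\otimes1)(1\otimes E)=(1\otimes E)(E\otimes1)$, where $\Delta\otimes\mathrm{id}$ and $\mathrm{id}\otimes\Delta$ are extended to $M(A\otimes A)$ with $1\mapsto E\otimes1$ and $1\mapsto1\otimes E$; and $\ker T_i=(1-G_i)(A\otimes A)$ for $i=1,2$, where $G_1,G_2$ are the linear maps on $A\otimes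 A$ determined by $(G_1\otimes\mathrm{id})(\Delta_{13}(a)(1\otimes b\otimes c))=\Delta_{13}(a)(1\otimes E(b\otimes c))$ and $(\mathrm{id}\otimes G_2)((a\otimes b\otimes1)\Delta_{13}(c))=((a\otimes b)E\otimes1)\Delta_{13}(c)$. It is regular if also $(A,\sigma\Delta)$ is a weak multiplier Hopf algebra (then with $\sigma\Delta(1)=\sigma(E)$). **Regular $I$-partial multiplier Hopf algebras.** Let $A$ be an $I^2$-partial algebra that is non-degenerate and idempotent as a partial algebra, and let $\Delta:A\to M(A\otimes A)$ be a homomorphism. $(A,\Delta)$ is a regular $I$-partial multiplier Hopf algebra if: 1. $\Delta$ is a regular comultiplication: $\Delta(A)\subseteq M(A\otimes^IA)$; with $B=A\otimes^IA$, $B_j\cdot\Delta(A_j)=B_j$ and $\Delta({}_jA)\cdot{}_jB={}_jB$ for all $j\in I^2$; $\Delta(a)(1\otimes b)$, $\Delta(a)(b\otimes1)$, $(1\otimes b)\Delta(a)$, $(b\otimes1)\Delta(a)$ lie in $A\otimes A$ for all $a,b$; and $(\Delta\otimes\mathrm{id})\Delta=(\mathrm{id}\otimes\Delta)\Delta$.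 2. There is a counit, i.e. a functional $\varepsilon$ on $A$ with: $\varepsilon(A((r,t),(s,u)))=0$ if $r\ne t$ or $s\neq u$; $\varepsilon(A_r)\neq0\neq\varepsilon({}_rA)$ for all $r\in I$; $\varepsilon(ab)=\varepsilon(a)\varepsilon(b)$ for $a\in A\mathbf 1(s,t)$, $b\in\mathbf 1(s,t)A$; and $(\mathrm{id}\otimes\varepsilon)\Delta(a)=a=(\varepsilon\otimes\mathrm{id})\Delta(a)$ in $M(A)$ for all $a\in A$. 3. The following maps are bijective, where $\Delta^{\mathrm{op}}=\sigma\Delta$: - $\bigoplus_rA_r\otimes{}_rA\to\bigoplus_r{}_rA\otimes{}^rA$, $a\otimes b\mapsto\Delta(a)(1\otimes b)$; - $\bigoplus_rA^r\otimes{}^rA\to\bigoplus_rA_r\otimes A^r$, $a\otimes b\mapsto(a\otimes1)\Delta(b)$; - $\bigoplus_rA^r\otimes{}^rA\to\bigoplus_r{}^rA\otimes{}_rA$, $a\otimes b\mapsto\Delta^{\mathrm{op}}(a)(1\otimes b)$; - $\bigoplus_rA_r\otimes{}_rA\to\bigoplus_rA^r\otimes A_r$, $a\otimes b\mapsto(a\otimes1)\Delta^{\mathrm{op}}(b)$.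 **Proposition.** Let $I$ be a set and $A$ an $I^2$-partial algebra whose total algebra (the grading forgotten) is non-degenerate and idempotent, with $\mathbf 1_k\neq0\neq\mathbf 1^k$ for all $k\in I$. Assume that $(A,\Delta)$ is a regular weak multiplier Hopf algebra with $\Delta(1)=\sum_s\mathbf 1_s\otimes\mathbf 1^s$. Then $A$ is non-degenerate and idempotent as an $I^2$-partial algebra, and $(A,\Delta)$ is a regular $I$-partial multiplier Hopf algebra. -/

import Mathlib

open scoped TensorProduct

noncomputable section

namespace PartialQG

/-! ### Non-unital algebras and their multipliers -/

section Multipliers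

variable (A : Type*) [NonUnitalRing A] [Module ℂ A] [IsScalarTower ℂ A A] [SMulCommClass ℂ A A]

/-- The multiplier algebra `M(A)`: the subalgebra of pairs `(λ, ρ)` in `End(A) ⊕ End(A)ᵒᵖ` such
that, writing `m a = λ a` and `a m = ρ a`, one has `a (m b) = (a m) b`. -/
def multiplierSubalgebra :
    Subalgebra ℂ (Module.End ℂ A × (Module.End ℂ A)ᵐᵒᵖ) where
  carrier := {m | ∀ a b : A, a * m.1 b = m.2.unop a * b}
  mul_mem' {m n} hm hn a b := by
    have h1 := hm a (n.1 b)
    have h2 := hn (m.2.unop a) b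
    simpa using h1.trans h2
  add_mem' {m n} hm hn a b := by
    have h1 := hm a b
    have h2 := hn a b
    simp [mul_add, add_mul, h1, h2]
  algebraMap_mem' c a b := by
    simp [Module.algebraMap_end_apply, mul_smul_comm, smul_mul_assoc]

/-- The multiplier algebra `M(A)` as a type (a unital `ℂ`-algebra). -/
abbrev Multiplier : Type _ := multiplierSubalgebra A

/-- `A · A = A`, where `V · W` is the set of finite sums of products. -/
def IsIdempotentAlgebra : Prop :=
  Submodule.map₂ (LinearMap.mul ℂ A) ⊤ ⊤ = ⊤

/-- `A` is left and right non-degenerate. -/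
def IsNondegenerateAlgebra : Prop :=
  (∀ a : A, (∀ b : A, a * b = 0) → a = 0) ∧ (∀ a : A, (∀ b : A, b * a = 0) → a = 0)

variable {A}

/-- The action `a ↦ m a` of a multiplier. -/
def Multiplier.left (m : Multiplier A) : A →ₗ[ℂ] A := m.1.1

/-- The action `a ↦ a m` of a multiplier. -/
def Multiplier.right (m : Multiplier A) : A →ₗ[ℂ] A := m.1.2.unop

/-- A multiplier from its two actions. -/
def Multiplier.mk (l r : A →ₗ[ℂ] A) (h : ∀ a b, a * l b = r a * b) : Multiplier A :=
  ⟨(l, MulOpposite.op r), h⟩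

theorem Multiplier.central (m : Multiplier A) (a b : A) : a * m.left b = m.right a * b :=
  m.2 a b

/-- The canonical map `A → M(A)`. -/
def toMultiplier : A →ₗ[ℂ] Multiplier A where
  toFun a := Multiplier.mk (LinearMap.mulLeft ℂ a) (LinearMap.mulRight ℂ a)
    (fun x y => by simp [mul_assoc])
  map_add' a b := by
    apply Subtype.ext
    refine Prod.ext ?_ (MulOpposite.unop_injective ?_) <;>
      ext x <;> simp [Multiplier.mk, add_mul, mul_add]
  map_smul' c a := by
    apply Subtype.ext
    refine Prod.ext ?_ (MulOpposite.unop_injective ?_) <;>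
      ext x <;> simp [Multiplier.mk, smul_mul_assoc, mul_smul_comm]

/-- `m = ∑ i, f i` in the strict topology: for each `a`, the nets of the finite partial sums
applied to `a` from the left and from the right are eventually equal to `m a` and `a m`. -/
def IsStrictSum {ι : Type*} (f : ι → Multiplier A) (m : Multiplier A) : Prop :=
  ∀ a : A, ∀ᶠ S : Finset ι in Filter.atTop,
    (∑ i ∈ S, f i).left a = m.left a ∧ (∑ i ∈ S, f i).right a = m.right a

variable {B : Type*} [NonUnitalRing B] [Module ℂ B] [IsScalarTower ℂ B B] [SMulCommClass ℂ B B]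
variable {C : Type*} [NonUnitalRing C] [Module ℂ C] [IsScalarTower ℂ C C] [SMulCommClass ℂ C C]

/-- Transport of multipliers along an isomorphism of algebras. -/
def Multiplier.congr (e : B ≃ₗ[ℂ] C) (he : ∀ x y, e (x * y) = e x * e y) :
    Multiplier B →ₗ[ℂ] Multiplier C where
  toFun m := Multiplier.mk (e.toLinearMap ∘ₗ m.left ∘ₗ e.symm.toLinearMap)
    (e.toLinearMap ∘ₗ m.right ∘ₗ e.symm.toLinearMap) (fun x y => by
      have h := congrArg e (m.central (e.symm x) (e.symm y))
      simpa [he] using h)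
  map_add' m n := by
    apply Subtype.ext
    refine Prod.ext ?_ (MulOpposite.unop_injective ?_) <;>
      ext x <;> simp [Multiplier.mk, Multiplier.left, Multiplier.right]
  map_smul' c m := by
    apply Subtype.ext
    refine Prod.ext ?_ (MulOpposite.unop_injective ?_) <;>
      ext x <;> simp [Multiplier.mk, Multiplier.left, Multiplier.right]

theorem tensor_central (m : Multiplier B) (n : Multiplier C) (x y : B ⊗[ℂ] C) :
    x * TensorProduct.map m.left n.left y = TensorProduct.map m.right n.right x * y := by
  induction x using TensorProduct.induction_on with
  | zero => simp
  | add x₁ x₂ h₁ h₂ => simp [add_mul, h₁, h₂]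
  | tmul a b =>
    induction y using TensorProduct.induction_on with
    | zero => simp
    | add y₁ y₂ h₁ h₂ => simp [mul_add, h₁, h₂]
    | tmul c d => simp [m.central, n.central]

/-- The multiplier `m ⊗ n` of `B ⊗ C`. -/
def Multiplier.tensor (m : Multiplier B) (n : Multiplier C) : Multiplier (B ⊗[ℂ] C) :=
  Multiplier.mk (TensorProduct.map m.left n.left) (TensorProduct.map m.right n.right)
    (tensor_central m n)

/-- The linear map `M(B) ⊗ M(C) → M(B ⊗ C)`. -/
def multiplierTensor : Multiplier B ⊗[ℂ] Multiplier C →ₗ[ℂ] Multiplier (B ⊗[ℂ] C) :=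
  TensorProduct.lift <| LinearMap.mk₂ ℂ Multiplier.tensor
    (fun m₁ m₂ n => by
      apply Subtype.ext
      refine Prod.ext ?_ (MulOpposite.unop_injective ?_)
      · exact TensorProduct.map_add_left m₁.left m₂.left n.left
      · exact TensorProduct.map_add_left m₁.right m₂.right n.right)
    (fun c m n => by
      apply Subtype.ext
      refine Prod.ext ?_ (MulOpposite.unop_injective ?_)
      · exact TensorProduct.map_smul_left c m.left n.left
      · exact TensorProduct.map_smul_left c m.right n.right)
    (fun m n₁ n₂ => by
      apply Subtype.ext
      refine Prod.ext ?_ (MulOpposite.unop_injective ?_)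
      · exact TensorProduct.map_add_right m.left n₁.left n₂.left
      · exact TensorProduct.map_add_right m.right n₁.right n₂.right)
    (fun c m n => by
      apply Subtype.ext
      refine Prod.ext ?_ (MulOpposite.unop_injective ?_)
      · exact TensorProduct.map_smul_right c m.left n.left
      · exact TensorProduct.map_smul_right c m.right n.right)

/-- `M` is the image of the multiplier `m` of `B` under the extension of `f : B → M(C)` to `M(B)`
that sends `1` to the idempotent `p`, where `f(B) C = p C` and `C f(B) = C p`. (These equations
determine `M`.) -/
def IsExtension (f : B → Multiplier C) (p : Multiplier C) (m : Multiplier B)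
    (M : Multiplier C) : Prop :=
  (∀ x, M * f x = f (m.left x)) ∧ (∀ x, f x * M = f (m.right x)) ∧ p * M = M ∧ M * p = M

theorem comm_mul (x y : A ⊗[ℂ] A) :
    TensorProduct.comm ℂ A A (x * y) = TensorProduct.comm ℂ A A x * TensorProduct.comm ℂ A A y := by
  induction x using TensorProduct.induction_on with
  | zero => simp
  | add x₁ x₂ h₁ h₂ => simp [add_mul, h₁, h₂]
  | tmul a b =>
    induction y using TensorProduct.induction_on with
    | zero => simp
    | add y₁ y₂ h₁ h₂ => simp [mul_add, h₁, h₂]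
    | tmul c d => simp

theorem assoc_mul (x y : (A ⊗[ℂ] A) ⊗[ℂ] A) :
    TensorProduct.assoc ℂ A A A (x * y) =
      TensorProduct.assoc ℂ A A A x * TensorProduct.assoc ℂ A A A y := by
  induction x using TensorProduct.induction_on with
  | zero => simp
  | add x₁ x₂ h₁ h₂ => simp [add_mul, h₁, h₂]
  | tmul u c =>
    induction y using TensorProduct.induction_on with
    | zero => simp
    | add y₁ y₂ h₁ h₂ => simp [mul_add, h₁, h₂]
    | tmul v d =>
      induction u using TensorProduct.induction_on with
      | zero => simp
      | add u₁ u₂ h₁ h₂ =>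
        simp only [Algebra.TensorProduct.tmul_mul_tmul,
          add_mul, TensorProduct.add_tmul, map_add] at h₁ h₂ ⊢
        rw [h₁, h₂]
      | tmul a b =>
        induction v using TensorProduct.induction_on with
        | zero => simp
        | add v₁ v₂ h₁ h₂ =>
          simp only [Algebra.TensorProduct.tmul_mul_tmul, TensorProduct.assoc_tmul,
            mul_add, TensorProduct.add_tmul, map_add] at h₁ h₂ ⊢
          rw [h₁, h₂]
        | tmul a' b' => simp

/-- The flip `M(A ⊗ A) → M(A ⊗ A)`. -/
def flipMultiplier : Multiplier (A ⊗[ℂ] A) →ₗ[ℂ] Multiplier (A ⊗[ℂ] A) :=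
  Multiplier.congr (TensorProduct.comm ℂ A A) comm_mul

/-- The identification `M((A ⊗ A) ⊗ A) = M(A ⊗ (A ⊗ A))`. -/
def assocMultiplier :
    Multiplier ((A ⊗[ℂ] A) ⊗[ℂ] A) →ₗ[ℂ] Multiplier (A ⊗[ℂ] (A ⊗[ℂ] A)) :=
  Multiplier.congr (TensorProduct.assoc ℂ A A A) assoc_mul

/-- The multiplier `m ⊗ 1` of `A ⊗ A ⊗ A`, for `m` a multiplier of `A ⊗ A`. -/
def leg12 (m : Multiplier (A ⊗[ℂ] A)) : Multiplier (A ⊗[ℂ] (A ⊗[ℂ] A)) :=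
  assocMultiplier (m.tensor 1)

/-- The multiplier `1 ⊗ m` of `A ⊗ A ⊗ A`, for `m` a multiplier of `A ⊗ A`. -/
def leg23 (m : Multiplier (A ⊗[ℂ] A)) : Multiplier (A ⊗[ℂ] (A ⊗[ℂ] A)) :=
  Multiplier.tensor 1 m

end Multipliers

/-! ### Comultiplications and weak multiplier Hopf algebras -/

section WeakMultiplierHopf

variable {A : Type*} [NonUnitalRing A] [Module ℂ A] [IsScalarTower ℂ A A] [SMulCommClass ℂ A A]

/-- `Δ ⊗ id : A ⊗ A → M(A ⊗ A ⊗ A)`. -/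
def deltaTensorId (Δ : A →ₙₐ[ℂ] Multiplier (A ⊗[ℂ] A)) :
    A ⊗[ℂ] A →ₗ[ℂ] Multiplier (A ⊗[ℂ] (A ⊗[ℂ] A)) :=
  assocMultiplier ∘ₗ multiplierTensor ∘ₗ
    TensorProduct.map (Δ : A →ₗ[ℂ] Multiplier (A ⊗[ℂ] A)) toMultiplier

/-- `id ⊗ Δ : A ⊗ A → M(A ⊗ A ⊗ A)`. -/
def idTensorDelta (Δ : A →ₙₐ[ℂ] Multiplier (A ⊗[ℂ] A)) :
    A ⊗[ℂ] A →ₗ[ℂ] Multiplier (A ⊗[ℂ] (A ⊗[ℂ] A)) :=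
  multiplierTensor ∘ₗ TensorProduct.map toMultiplier (Δ : A →ₗ[ℂ] Multiplier (A ⊗[ℂ] A))

/-- The multiplier `a ⊗ 1` of `A ⊗ A`. -/
def inl (a : A) : Multiplier (A ⊗[ℂ] A) := (toMultiplier a).tensor 1

/-- The multiplier `1 ⊗ a` of `A ⊗ A`. -/
def inr (a : A) : Multiplier (A ⊗[ℂ] A) := Multiplier.tensor 1 (toMultiplier a)

/-- `Δ(a)(1 ⊗ b)` lies in `A ⊗ A` and equals `T(a ⊗ b)`, for all `a`, `b`. -/
def IsT₁ (Δ : A →ₙₐ[ℂ] Multiplier (A ⊗[ℂ] A)) (T : A ⊗[ℂ] A →ₗ[ℂ] A ⊗[ℂ] A) : Prop :=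
  ∀ a b, toMultiplier (T (a ⊗ₜ b)) = Δ a * inr b

/-- `(a ⊗ 1)Δ(b)` lies in `A ⊗ A` and equals `T(a ⊗ b)`, for all `a`, `b`. -/
def IsT₂ (Δ : A →ₙₐ[ℂ] Multiplier (A ⊗[ℂ] A)) (T : A ⊗[ℂ] A →ₗ[ℂ] A ⊗[ℂ] A) : Prop :=
  ∀ a b, toMultiplier (T (a ⊗ₜ b)) = inl a * Δ b

/-- `Δ(a)(b ⊗ 1)` lies in `A ⊗ A` and equals `T(a ⊗ b)`, for all `a`, `b`. -/
def IsT₃ (Δ : A →ₙₐ[ℂ] Multiplier (A ⊗[ℂ] A)) (T : A ⊗[ℂ] A →ₗ[ℂ] A ⊗[ℂ] A) : Prop :=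
  ∀ a b, toMultiplier (T (a ⊗ₜ b)) = Δ a * inl b

/-- `(1 ⊗ a)Δ(b)` lies in `A ⊗ A` and equals `T(a ⊗ b)`, for all `a`, `b`. -/
def IsT₄ (Δ : A →ₙₐ[ℂ] Multiplier (A ⊗[ℂ] A)) (T : A ⊗[ℂ] A →ₗ[ℂ] A ⊗[ℂ] A) : Prop :=
  ∀ a b, toMultiplier (T (a ⊗ₜ b)) = inr a * Δ b

/-- The slice map `id ⊗ ω : A ⊗ A → A`. -/
def sliceRight (ω : A →ₗ[ℂ] ℂ) : A ⊗[ℂ] A →ₗ[ℂ] A :=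
  (TensorProduct.rid ℂ A).toLinearMap ∘ₗ LinearMap.lTensor A ω

/-- The slice map `ω ⊗ id : A ⊗ A → A`. -/
def sliceLeft (ω : A →ₗ[ℂ] ℂ) : A ⊗[ℂ] A →ₗ[ℂ] A :=
  (TensorProduct.lid ℂ A).toLinearMap ∘ₗ LinearMap.rTensor A ω

/-- The subspace `V ⊗ W` of `A ⊗ A`. -/
def tens (V W : Submodule ℂ A) : Submodule ℂ (A ⊗[ℂ] A) :=
  Submodule.map₂ (TensorProduct.mk ℂ A A) V W

/-- `a ⊗ b ⊗ c ↦ T(a ⊗ c)₁₃ (1 ⊗ b ⊗ 1)`: the map `T` on the outer legs. For `T(a ⊗ c) = Δ(a)(1 ⊗ c)`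
this is `Δ₁₃(a)(1 ⊗ b ⊗ c)`; for `T(a ⊗ c) = (a ⊗ 1)Δ(c)` it is `(a ⊗ b ⊗ 1)Δ₁₃(c)`. -/
def onOuter (T : A ⊗[ℂ] A →ₗ[ℂ] A ⊗[ℂ] A) :
    A ⊗[ℂ] (A ⊗[ℂ] A) →ₗ[ℂ] A ⊗[ℂ] (A ⊗[ℂ] A) :=
  (TensorProduct.leftComm ℂ A A A).toLinearMap ∘ₗ LinearMap.lTensor A T ∘ₗ
    (TensorProduct.leftComm ℂ A A A).toLinearMap

/-- `T ⊗ id` on `A ⊗ A ⊗ A`. -/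
def onFirstTwo (T : A ⊗[ℂ] A →ₗ[ℂ] A ⊗[ℂ] A) :
    A ⊗[ℂ] (A ⊗[ℂ] A) →ₗ[ℂ] A ⊗[ℂ] (A ⊗[ℂ] A) :=
  (TensorProduct.assoc ℂ A A A).toLinearMap ∘ₗ LinearMap.rTensor A T ∘ₗ
    (TensorProduct.assoc ℂ A A A).symm.toLinearMap

/-- `id ⊗ T` on `A ⊗ A ⊗ A`. -/
def onLastTwo (T : A ⊗[ℂ] A →ₗ[ℂ] A ⊗[ℂ] A) :
    A ⊗[ℂ] (A ⊗[ℂ] A) →ₗ[ℂ] A ⊗[ℂ] (A ⊗[ℂ] A) :=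
  LinearMap.lTensor A T

/-- The axioms of a weak multiplier Hopf algebra `(A, Δ)` (Van Daele--Wang) with canonical
idempotent `E = Δ(1)` and canonical maps `T₁(a ⊗ b) = Δ(a)(1 ⊗ b)`, `T₂(a ⊗ b) = (a ⊗ 1)Δ(b)`. -/
structure WeakMultiplierHopfAxioms (Δ : A →ₙₐ[ℂ] Multiplier (A ⊗[ℂ] A))
    (E : Multiplier (A ⊗[ℂ] A)) (T₁ T₂ : A ⊗[ℂ] A →ₗ[ℂ] A ⊗[ℂ] A) : Prop where
  nondegenerate : IsNondegenerateAlgebra A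
  idempotent : IsIdempotentAlgebra A
  isT₁ : IsT₁ Δ T₁
  isT₂ : IsT₂ Δ T₂
  /-- `(a ⊗ 1 ⊗ 1)(Δ ⊗ id)(Δ(b)(1 ⊗ c)) = (id ⊗ Δ)((a ⊗ 1)Δ(b))(1 ⊗ 1 ⊗ c)`. -/
  coassoc : ∀ a b c : A,
    Multiplier.tensor (toMultiplier a) 1 * deltaTensorId Δ (T₁ (b ⊗ₜ c)) =
      idTensorDelta Δ (T₂ (a ⊗ₜ b)) * Multiplier.tensor 1 (inr c)
  /-- `Δ` is full. -/
  full_left : ∀ V : Submodule ℂ A, LinearMap.range T₁ ≤ tens V ⊤ → V = ⊤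
  full_right : ∀ W : Submodule ℂ A, LinearMap.range T₂ ≤ tens ⊤ W → W = ⊤
  /-- There is a counit. -/
  exists_counit : ∃ ε : A →ₗ[ℂ] ℂ,
    (∀ a b, sliceLeft ε (T₁ (a ⊗ₜ b)) = a * b) ∧ (∀ a b, sliceRight ε (T₂ (a ⊗ₜ b)) = a * b)
  /-- `E` is an idempotent with `Δ(A)(1 ⊗ A) = E(A ⊗ A)` and `(A ⊗ 1)Δ(A) = (A ⊗ A)E`. -/
  idem : E * E = E
  range_T₁ : LinearMap.range T₁ = LinearMap.range E.left
  range_T₂ : LinearMap.range T₂ = LinearMap.range E.right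
  /-- `(Δ ⊗ id)(E) = (id ⊗ Δ)(E) = (E ⊗ 1)(1 ⊗ E) = (1 ⊗ E)(E ⊗ 1)`, with the extensions of
  `Δ ⊗ id` and `id ⊗ Δ` to `M(A ⊗ A)` that send `1` to `E ⊗ 1` and `1 ⊗ E`. -/
  legs_commute : leg12 E * leg23 E = leg23 E * leg12 E
  delta_id_E : IsExtension (deltaTensorId Δ) (leg12 E) E (leg12 E * leg23 E)
  id_delta_E : IsExtension (idTensorDelta Δ) (leg23 E) E (leg12 E * leg23 E)
  /-- `Ker T₁ = (1 - G₁)(A ⊗ A)`, where `G₁` is the linear map determined by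
  `(G₁ ⊗ id)(Δ₁₃(a)(1 ⊗ b ⊗ c)) = Δ₁₃(a)(1 ⊗ E(b ⊗ c))`. -/
  ker_T₁ : ∃ G₁ : A ⊗[ℂ] A →ₗ[ℂ] A ⊗[ℂ] A,
    onFirstTwo G₁ ∘ₗ onOuter T₁ = onOuter T₁ ∘ₗ onLastTwo E.left ∧
      LinearMap.ker T₁ = LinearMap.range (LinearMap.id - G₁)
  /-- `Ker T₂ = (1 - G₂)(A ⊗ A)`, where `G₂` is the linear map determined by
  `(id ⊗ G₂)((a ⊗ b ⊗ 1)Δ₁₃(c)) = ((a ⊗ b)E ⊗ 1)Δ₁₃(c)`. -/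
  ker_T₂ : ∃ G₂ : A ⊗[ℂ] A →ₗ[ℂ] A ⊗[ℂ] A,
    onLastTwo G₂ ∘ₗ onOuter T₂ = onOuter T₂ ∘ₗ onFirstTwo E.right ∧
      LinearMap.ker T₂ = LinearMap.range (LinearMap.id - G₂)

/-- `(A, Δ)` is a weak multiplier Hopf algebra with canonical idempotent `Δ(1) = E`. -/
def IsWeakMultiplierHopf (Δ : A →ₙₐ[ℂ] Multiplier (A ⊗[ℂ] A))
    (E : Multiplier (A ⊗[ℂ] A)) : Prop :=
  ∃ T₁ T₂, WeakMultiplierHopfAxioms Δ E T₁ T₂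

theorem flip_mul (m n : Multiplier (A ⊗[ℂ] A)) :
    flipMultiplier (m * n) = flipMultiplier m * flipMultiplier n := by
  apply Subtype.ext
  refine Prod.ext ?_ (MulOpposite.unop_injective ?_) <;>
    apply LinearMap.ext <;> intro x <;>
    simp [flipMultiplier, Multiplier.congr, Multiplier.mk, Multiplier.left, Multiplier.right]

/-- The opposite comultiplication. -/
def coop (Δ : A →ₙₐ[ℂ] Multiplier (A ⊗[ℂ] A)) : A →ₙₐ[ℂ] Multiplier (A ⊗[ℂ] A) where
  toFun a := flipMultiplier (Δ a)
  map_smul' c a := by simp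
  map_zero' := by simp
  map_add' a b := by simp
  map_mul' a b := by rw [map_mul, flip_mul]

/-- `(A, Δ)` is a regular weak multiplier Hopf algebra with canonical idempotent `Δ(1) = E`: both
`(A, Δ)` and `(A, Δᵒᵖ)` are weak multiplier Hopf algebras (the canonical idempotent of the latter
is necessarily the flip of `E`). -/
def IsRegularWeakMultiplierHopf (Δ : A →ₙₐ[ℂ] Multiplier (A ⊗[ℂ] A))
    (E : Multiplier (A ⊗[ℂ] A)) : Prop :=
  IsWeakMultiplierHopf Δ E ∧ IsWeakMultiplierHopf (coop Δ) (flipMultiplier E)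

end WeakMultiplierHopf

/-! ### Partial algebras -/

open Classical in
/-- A `J`-partial algebra structure on `A`: a grading `A = ⨁ r s, comp r s` by `J × J` such that
`comp r s * comp s' t = 0` for `s ≠ s'` and `comp r s * comp s t ⊆ comp r t`. -/
structure PartialAlgebra (J : Type*) (A : Type*) [NonUnitalRing A] [Module ℂ A] where
  comp : J → J → Submodule ℂ A
  isInternal : DirectSum.IsInternal (fun p : J × J => comp p.1 p.2)
  mul_mem : ∀ {r s t : J} {a b : A}, a ∈ comp r s → b ∈ comp s t → a * b ∈ comp r t
  mul_eq_zero : ∀ {r s s' t : J} {a b : A}, s ≠ s' → a ∈ comp r s → b ∈ comp s' t → a * b = 0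

namespace PartialAlgebra

section Units

variable {J : Type*} {A : Type*} [NonUnitalRing A] [Module ℂ A]

open Classical in
/-- The identification of the direct sum of the components with `A`. -/
def decomp (G : PartialAlgebra J A) :
    (DirectSum (J × J) fun p : J × J => G.comp p.1 p.2) ≃ₗ[ℂ] A :=
  LinearEquiv.ofBijective (DirectSum.coeLinearMap fun p : J × J => G.comp p.1 p.2)
    (show Function.Bijective (DirectSum.coeLinearMap fun p : J × J => G.comp p.1 p.2) from
      G.isInternal)

open Classical in
/-- The projection of `A` onto the sum of the components `comp r s` with `P (r, s)`, along the sum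
of the other components. -/
def proj (G : PartialAlgebra J A) (P : J × J → Prop) : A →ₗ[ℂ] A :=
  G.decomp.toLinearMap ∘ₗ
    DFinsupp.filterLinearMap ℂ (fun p : J × J => G.comp p.1 p.2) P ∘ₗ
    G.decomp.symm.toLinearMap

open Classical in
theorem decomp_single (G : PartialAlgebra J A) {r s : J} {a : A} (ha : a ∈ G.comp r s) :
    G.decomp (DFinsupp.single (β := fun p : J × J => G.comp p.1 p.2) (r, s) ⟨a, ha⟩) = a :=
  DirectSum.coeLinearMap_lof (fun p : J × J => G.comp p.1 p.2) (r, s) ⟨a, ha⟩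

open Classical in
theorem proj_of_mem (G : PartialAlgebra J A) (P : J × J → Prop) {r s : J} {a : A}
    (ha : a ∈ G.comp r s) : G.proj P a = if P (r, s) then a else 0 := by
  have h : G.decomp.symm a =
      DFinsupp.single (β := fun p : J × J => G.comp p.1 p.2) (r, s) ⟨a, ha⟩ := by
    rw [LinearEquiv.symm_apply_eq]
    exact (G.decomp_single ha).symm
  have h2 : G.proj P a = G.decomp (DFinsupp.filter P
      (DFinsupp.single (β := fun p : J × J => G.comp p.1 p.2) (r, s) ⟨a, ha⟩)) := by
    rw [← h]; rfl
  rw [h2]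
  by_cases hP : P (r, s)
  · rw [DFinsupp.filter_single_pos (p := P) (r, s) _ hP, if_pos hP]
    exact G.decomp_single ha
  · rw [DFinsupp.filter_single_neg (p := P) (r, s) _ hP, if_neg hP]
    exact map_zero G.decomp

theorem induction (G : PartialAlgebra J A) {motive : A → Prop}
    (mem : ∀ r s a, a ∈ G.comp r s → motive a) (zero : motive 0)
    (add : ∀ a b, motive a → motive b → motive (a + b)) (a : A) : motive a := by
  classical
  have h := G.isInternal.submodule_iSup_eq_top
  have ha : a ∈ ⨆ p : J × J, G.comp p.1 p.2 := by rw [h]; trivial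
  exact Submodule.iSup_induction (fun p : J × J => G.comp p.1 p.2) (motive := motive) ha
    (fun p x hx => mem p.1 p.2 x hx) zero add

variable [IsScalarTower ℂ A A] [SMulCommClass ℂ A A]

/-- The strict sum `∑ r with P r, 𝟏(r) ∈ M(A)` of the base units `𝟏(r)` with `P r`: it acts from
the left as the projection onto the `comp r s` with `P r` and from the right as the projection onto
the `comp r s` with `P s`. -/
def unit (G : PartialAlgebra J A) (P : J → Prop) : Multiplier A :=
  Multiplier.mk (G.proj fun p => P p.1) (G.proj fun p => P p.2) (by
    classical
    intro a b
    induction a using G.induction with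
    | zero => simp
    | add a₁ a₂ h₁ h₂ => simp [add_mul, h₁, h₂]
    | mem r s a ha =>
      induction b using G.induction with
      | zero => simp
      | add b₁ b₂ h₁ h₂ => simp [mul_add, h₁, h₂]
      | mem s' t b hb =>
        rw [G.proj_of_mem _ ha, G.proj_of_mem _ hb]
        by_cases hs : s = s'
        · subst hs
          by_cases hP : P s <;> simp [hP]
        · by_cases h1 : P s <;> by_cases h2 : P s' <;> simp [h1, h2, G.mul_eq_zero hs ha hb])

/-- `A_s = ⨁ r, comp r s`. -/
def col (G : PartialAlgebra J A) (s : J) : Submodule ℂ A := ⨆ r, G.comp r s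

/-- `ᵣA = ⨁ s, comp r s`. -/
def row (G : PartialAlgebra J A) (r : J) : Submodule ℂ A := ⨆ s, G.comp r s

/-- Non-degeneracy as a partial algebra: each algebra `A_r` is left non-degenerate and each algebra
`ᵣA` is right non-degenerate. -/
def IsNondegenerate (G : PartialAlgebra J A) : Prop :=
  (∀ r, ∀ a ∈ G.col r, (∀ b ∈ G.col r, a * b = 0) → a = 0) ∧
    (∀ r, ∀ a ∈ G.row r, (∀ b ∈ G.row r, b * a = 0) → a = 0)

/-- Idempotency as a partial algebra: each algebra `A_r` and each algebra `ᵣA` is idempotent. -/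
def IsIdempotent (G : PartialAlgebra J A) : Prop :=
  (∀ r, Submodule.map₂ (LinearMap.mul ℂ A) (G.col r) (G.col r) = G.col r) ∧
    (∀ r, Submodule.map₂ (LinearMap.mul ℂ A) (G.row r) (G.row r) = G.row r)

end Units

/-! ### Regular `I`-partial multiplier Hopf algebras

For an `I × I`-partial algebra, an index `(r, t) : I × I` is thought of as a column with upper entry
`r` and lower entry `t`. -/

section Square

variable {I : Type*} {A : Type*} [NonUnitalRing A] [Module ℂ A]
  [IsScalarTower ℂ A A] [SMulCommClass ℂ A A]

/-- `𝟏ʳ = ∑ t, 𝟏(r, t)`. -/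
def upperUnit (G : PartialAlgebra (I × I) A) (r : I) : Multiplier A := G.unit fun j => j.1 = r

/-- `𝟏ₜ = ∑ r, 𝟏(r, t)`. -/
def lowerUnit (G : PartialAlgebra (I × I) A) (t : I) : Multiplier A := G.unit fun j => j.2 = t

/-- `Aʳ = A 𝟏ʳ`. -/
def upperCol (G : PartialAlgebra (I × I) A) (r : I) : Submodule ℂ A := ⨆ t, G.col (r, t)

/-- `Aₜ = A 𝟏ₜ`. -/
def lowerCol (G : PartialAlgebra (I × I) A) (t : I) : Submodule ℂ A := ⨆ r, G.col (r, t)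

/-- `ʳA = 𝟏ʳ A`. -/
def upperRow (G : PartialAlgebra (I × I) A) (r : I) : Submodule ℂ A := ⨆ t, G.row (r, t)

/-- `ₜA = 𝟏ₜ A`. -/
def lowerRow (G : PartialAlgebra (I × I) A) (t : I) : Submodule ℂ A := ⨆ r, G.row (r, t)

/-- `E = ∑ t, 𝟏ₜ ⊗ 𝟏ᵗ` in `M(A ⊗ A)`, with strict convergence. -/
def IsBaseIdempotent (G : PartialAlgebra (I × I) A) (E : Multiplier (A ⊗[ℂ] A)) : Prop :=
  IsStrictSum (fun t : I => (G.lowerUnit t).tensor (G.upperUnit t)) E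

/-- The graded component of index `((r, v), (s, w))` of the `I × I`-partial algebra
`A ⊗ᴵ A = E (A ⊗ A) E`, as a subspace of `A ⊗ A`:
`⨁ t u, comp (r, t) (s, u) ⊗ comp (t, v) (u, w)`. -/
def tensorComp (G : PartialAlgebra (I × I) A) (i j : I × I) : Submodule ℂ (A ⊗[ℂ] A) :=
  ⨆ t : I, ⨆ u : I, tens (G.comp (i.1, t) (j.1, u)) (G.comp (t, i.2) (u, j.2))

/-- `(A ⊗ᴵ A)_j`. -/
def tensorCol (G : PartialAlgebra (I × I) A) (j : I × I) : Submodule ℂ (A ⊗[ℂ] A) :=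
  ⨆ i, G.tensorComp i j

/-- `ᵢ(A ⊗ᴵ A)`. -/
def tensorRow (G : PartialAlgebra (I × I) A) (i : I × I) : Submodule ℂ (A ⊗[ℂ] A) :=
  ⨆ j, G.tensorComp i j

/-- `Δ` is a regular comultiplication on the `I × I`-partial algebra `A`, with `E = ∑ t, 𝟏ₜ ⊗ 𝟏ᵗ`.
Multipliers of `A ⊗ᴵ A` are identified with the elements of `E M(A ⊗ A) E`. -/
structure IsRegularComultiplication (G : PartialAlgebra (I × I) A)
    (Δ : A →ₙₐ[ℂ] Multiplier (A ⊗[ℂ] A)) (E : Multiplier (A ⊗[ℂ] A))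
    (T₁ T₂ T₃ T₄ : A ⊗[ℂ] A →ₗ[ℂ] A ⊗[ℂ] A) : Prop where
  /-- `Δ` takes values in `E M(A ⊗ A) E`. -/
  corner : ∀ a, E * Δ a = Δ a ∧ Δ a * E = Δ a
  /-- `Δ` is a morphism of partial algebras: `B_j Δ(A_j) = B_j` and `Δ(ᵢA) ᵢB = ᵢB` for
  `B = A ⊗ᴵ A`. -/
  morphism_col : ∀ j : I × I,
    Submodule.span ℂ {z | ∃ y ∈ G.tensorCol j, ∃ a ∈ G.col j, z = (Δ a).right y} = G.tensorCol j
  morphism_row : ∀ i : I × I,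
    Submodule.span ℂ {z | ∃ a ∈ G.row i, ∃ y ∈ G.tensorRow i, z = (Δ a).left y} = G.tensorRow i
  /-- `Δ(a)(1 ⊗ b)`, `(b ⊗ 1)Δ(a)`, `Δ(a)(b ⊗ 1)`, `(1 ⊗ b)Δ(a)` lie in `A ⊗ A`. -/
  isT₁ : IsT₁ Δ T₁
  isT₂ : IsT₂ Δ T₂
  isT₃ : IsT₃ Δ T₃
  isT₄ : IsT₄ Δ T₄
  /-- `(Δ ⊗ id)(Δ(a)) = (id ⊗ Δ)(Δ(a))`. -/
  coassoc : ∀ a, ∃ M, IsExtension (deltaTensorId Δ) (leg12 E) (Δ a) M ∧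
    IsExtension (idTensorDelta Δ) (leg23 E) (Δ a) M

/-- `ε` is a counit for the regular comultiplication with `T₁(a ⊗ b) = Δ(a)(1 ⊗ b)`,
`T₂(a ⊗ b) = (a ⊗ 1)Δ(b)`, `T₃(a ⊗ b) = Δ(a)(b ⊗ 1)`, `T₄(a ⊗ b) = (1 ⊗ a)Δ(b)`. -/
structure IsCounit (G : PartialAlgebra (I × I) A) (T₁ T₂ T₃ T₄ : A ⊗[ℂ] A →ₗ[ℂ] A ⊗[ℂ] A)
    (ε : A →ₗ[ℂ] ℂ) : Prop where
  eq_zero : ∀ r s t u : I, (r ≠ t ∨ s ≠ u) → ∀ a ∈ G.comp (r, t) (s, u), ε a = 0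
  ne_zero : ∀ r : I, (∃ a ∈ G.lowerCol r, ε a ≠ 0) ∧ (∃ a ∈ G.lowerRow r, ε a ≠ 0)
  map_mul : ∀ s t : I, ∀ a ∈ G.col (s, t), ∀ b ∈ G.row (s, t), ε (a * b) = ε a * ε b
  /-- `(id ⊗ ε)(Δ(a)) = a` in `M(A)`. -/
  slice_right : ∀ a b, sliceRight ε (T₃ (a ⊗ₜ b)) = a * b ∧ sliceRight ε (T₂ (b ⊗ₜ a)) = b * a
  /-- `(ε ⊗ id)(Δ(a)) = a` in `M(A)`. -/
  slice_left : ∀ a b, sliceLeft ε (T₁ (a ⊗ₜ b)) = a * b ∧ sliceLeft ε (T₄ (b ⊗ₜ a)) = b * a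

/-- `(A, Δ)` is a regular `I`-partial multiplier Hopf algebra. The four canonical maps are
`a ⊗ b ↦ Δ(a)(1 ⊗ b)`, `a ⊗ b ↦ (a ⊗ 1)Δ(b)`, `a ⊗ b ↦ Δᵒᵖ(a)(1 ⊗ b)` (the flip of
`Δ(a)(b ⊗ 1)`) and `a ⊗ b ↦ (a ⊗ 1)Δᵒᵖ(b)` (the flip of `(1 ⊗ a)Δ(b)`). -/
def IsRegularPartialMultiplierHopf (G : PartialAlgebra (I × I) A)
    (Δ : A →ₙₐ[ℂ] Multiplier (A ⊗[ℂ] A)) : Prop :=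
  G.IsNondegenerate ∧ G.IsIdempotent ∧
  ∃ (E : Multiplier (A ⊗[ℂ] A)) (T₁ T₂ T₃ T₄ : A ⊗[ℂ] A →ₗ[ℂ] A ⊗[ℂ] A) (ε : A →ₗ[ℂ] ℂ),
    G.IsBaseIdempotent E ∧
    G.IsRegularComultiplication Δ E T₁ T₂ T₃ T₄ ∧
    G.IsCounit T₁ T₂ T₃ T₄ ε ∧
    Set.BijOn T₁
      (⨆ r, tens (G.lowerCol r) (G.lowerRow r) : Submodule ℂ (A ⊗[ℂ] A))
      (⨆ r, tens (G.lowerRow r) (G.upperRow r) : Submodule ℂ (A ⊗[ℂ] A)) ∧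
    Set.BijOn T₂
      (⨆ r, tens (G.upperCol r) (G.upperRow r) : Submodule ℂ (A ⊗[ℂ] A))
      (⨆ r, tens (G.lowerCol r) (G.upperCol r) : Submodule ℂ (A ⊗[ℂ] A)) ∧
    Set.BijOn (fun x => TensorProduct.comm ℂ A A (T₃ x))
      (⨆ r, tens (G.upperCol r) (G.upperRow r) : Submodule ℂ (A ⊗[ℂ] A))
      (⨆ r, tens (G.upperRow r) (G.lowerRow r) : Submodule ℂ (A ⊗[ℂ] A)) ∧
    Set.BijOn (fun x => TensorProduct.comm ℂ A A (T₄ x))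
      (⨆ r, tens (G.lowerCol r) (G.lowerRow r) : Submodule ℂ (A ⊗[ℂ] A))
      (⨆ r, tens (G.upperCol r) (G.lowerCol r) : Submodule ℂ (A ⊗[ℂ] A))

end Square

end PartialAlgebra

end PartialQG

end

noncomputable section

namespace PartialQG

/-! ### Slices of tensors over a field -/

section Slices

variable {V W V' W' : Type*} [AddCommGroup V] [Module ℂ V] [AddCommGroup W] [Module ℂ W]
  [AddCommGroup V'] [Module ℂ V'] [AddCommGroup W'] [Module ℂ W']

/-! Write `p t` for the lower and `q t` for the upper base units, so that `E = ∑ p t ⊗ q t`. Each of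
the two families is orthogonal, so multiplying `E` by `p t ⊗ 1` or by `1 ⊗ q t` on either side
leaves only `p t ⊗ q t`. Everything else follows by inserting this into the axioms, and both
families having non-zero members allows auxiliary legs to be cancelled.

Since `Δ(a) = E Δ(a) = Δ(a) E`, next to `Δ(a)` one may trade `p t ⊗ 1` for `1 ⊗ q t` (`delta_mul_p`,
`p_mul_delta`). The formulas for `(Δ ⊗ id)(E)` and `(id ⊗ Δ)(E)` say that `Δ` carries multiplication
by `p t` to multiplication by `1 ⊗ p t` and multiplication by `q t` to multiplication by `q t ⊗ 1`
(`delta_p_left` and its three companions). Hence `Δ` respects the grading.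

The equations for `G₁` and `G₂`, combined with fullness, force `G₁` to be the projection `x ⊗ b ↦ x
p_s ⊗ b` for `b = p_s b`, and `G₂` to be its analogue for `q` (`exists_G₁`, `exists_G₂`). As `ker T
= range (1 - G)` and `range T` is the range of the action of `E`, each canonical map is a bijection
from `range G` onto an explicit sum of tensor products (`bijOn_T₁`, `bijOn_T₂`). The same
injectivity produces local units: `e a = a` if `a = p_s a`, and `a e = a` if `a = a q_s`
(`exists_left_unit`, `exists_right_unit`). Truncated by base units, they give non-degeneracy and
idempotency in the graded sense, and also the conditions `B_j Δ(A_j) = B_j` and `Δ(ᵢA) ᵢB = ᵢB`.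

The counit properties are identities of functionals; by fullness it suffices to compare slices of
`T₁` or `T₂` (`counit_left`, `counit_right`, `counit_mul`). Coassociativity in multiplier form
follows from the weak axiom once `(Δ ⊗ id)Δ(a)` has been constructed, which uses `(1 ⊗ w)Δ(a) ∈ A ⊗
A` (`exists_coassoc`).

All statements are proved for a pair of families `p`, `q` in `IsBasedHopf`. Applied to `(A, Δᵒᵖ)`
with `p` and `q` interchanged, they yield the two remaining canonical maps. -/

theorem tensor_eq_zero_of_slices_left (X : V ⊗[ℂ] W)
    (h : ∀ f : V →ₗ[ℂ] ℂ, TensorProduct.lid ℂ W (LinearMap.rTensor W f X) = 0) : X = 0 := by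
  classical
  let b := Module.Basis.ofVectorSpace ℂ V
  apply (TensorProduct.equivFinsuppOfBasisLeft (N := W) b).injective
  ext i
  rw [TensorProduct.equivFinsuppOfBasisLeft_apply, h]
  simp

theorem tensor_eq_zero_of_slices_right (X : V ⊗[ℂ] W)
    (h : ∀ f : W →ₗ[ℂ] ℂ, TensorProduct.rid ℂ V (LinearMap.lTensor V f X) = 0) : X = 0 := by
  classical
  let b := Module.Basis.ofVectorSpace ℂ W
  apply (TensorProduct.equivFinsuppOfBasisRight (M := V) b).injective
  ext i
  rw [TensorProduct.equivFinsuppOfBasisRight_apply, h]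
  simp

/-- In the expansion of `X` along a basis of `V`, the coefficients are the slices by the coordinate
functionals. -/
theorem mem_map₂_of_slices_left (N : Submodule ℂ W) (X : V ⊗[ℂ] W)
    (h : ∀ f : V →ₗ[ℂ] ℂ, TensorProduct.lid ℂ W (LinearMap.rTensor W f X) ∈ N) :
    X ∈ Submodule.map₂ (TensorProduct.mk ℂ V W) ⊤ N := by
  classical
  let b := Module.Basis.ofVectorSpace ℂ V
  rw [← (TensorProduct.equivFinsuppOfBasisLeft (N := W) b).symm_apply_apply X,
    TensorProduct.equivFinsuppOfBasisLeft_symm_apply]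
  refine Submodule.sum_mem _ fun i _ => Submodule.apply_mem_map₂ _ trivial ?_
  rw [TensorProduct.equivFinsuppOfBasisLeft_apply]
  exact h _

theorem mem_map₂_of_slices_right (N : Submodule ℂ V) (X : V ⊗[ℂ] W)
    (h : ∀ f : W →ₗ[ℂ] ℂ, TensorProduct.rid ℂ V (LinearMap.lTensor V f X) ∈ N) :
    X ∈ Submodule.map₂ (TensorProduct.mk ℂ V W) N ⊤ := by
  classical
  let b := Module.Basis.ofVectorSpace ℂ W
  rw [← (TensorProduct.equivFinsuppOfBasisRight (M := V) b).symm_apply_apply X,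
    TensorProduct.equivFinsuppOfBasisRight_symm_apply]
  refine Submodule.sum_mem _ fun i _ => Submodule.apply_mem_map₂ _ ?_ trivial
  rw [TensorProduct.equivFinsuppOfBasisRight_apply]
  exact h _

theorem lid_rTensor_lTensor (f : V →ₗ[ℂ] ℂ) (φ : W →ₗ[ℂ] W') (X : V ⊗[ℂ] W) :
    TensorProduct.lid ℂ W' (LinearMap.rTensor W' f (LinearMap.lTensor V φ X)) =
      φ (TensorProduct.lid ℂ W (LinearMap.rTensor W f X)) := by
  induction X using TensorProduct.induction_on with
  | zero => simp
  | add x y hx hy => simp only [map_add, hx, hy]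
  | tmul v w => simp

theorem rid_lTensor_rTensor (f : W →ₗ[ℂ] ℂ) (φ : V →ₗ[ℂ] V') (X : V ⊗[ℂ] W) :
    TensorProduct.rid ℂ V' (LinearMap.lTensor V' f (LinearMap.rTensor W φ X)) =
      φ (TensorProduct.rid ℂ V (LinearMap.lTensor V f X)) := by
  induction X using TensorProduct.induction_on with
  | zero => simp
  | add x y hx hy => simp only [map_add, hx, hy]
  | tmul v w => simp

/-- Both sides are `(f ⊗ g)(X)`. This turns a question about one leg of `X`, tested by functionals,
into a question about the other leg. -/
theorem slice_swap (f : V →ₗ[ℂ] ℂ) (g : W →ₗ[ℂ] ℂ) (X : V ⊗[ℂ] W) :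
    f (TensorProduct.rid ℂ V (LinearMap.lTensor V g X)) =
      g (TensorProduct.lid ℂ W (LinearMap.rTensor W f X)) := by
  induction X using TensorProduct.induction_on with
  | zero => simp
  | add x y hx hy => simp only [map_add, hx, hy]
  | tmul v w => simp [mul_comm]

/-- Joint injectivity of a family of maps survives tensoring over a field, because slices commute
with maps on the other leg. -/
theorem eq_zero_of_forall_lTensor {ι : Sort*} (φ : ι → W →ₗ[ℂ] W')
    (h : ∀ w, (∀ i, φ i w = 0) → w = 0) (X : V ⊗[ℂ] W)
    (hX : ∀ i, LinearMap.lTensor V (φ i) X = 0) : X = 0 := by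
  refine tensor_eq_zero_of_slices_left X fun f => h _ fun i => ?_
  rw [← lid_rTensor_lTensor, hX]
  simp

theorem eq_zero_of_forall_rTensor {ι : Sort*} (φ : ι → V →ₗ[ℂ] V')
    (h : ∀ w, (∀ i, φ i w = 0) → w = 0) (X : V ⊗[ℂ] W)
    (hX : ∀ i, LinearMap.rTensor W (φ i) X = 0) : X = 0 := by
  refine tensor_eq_zero_of_slices_right X fun f => h _ fun i => ?_
  rw [← rid_lTensor_rTensor, hX]
  simp

theorem mem_of_dual_vanish (N : Submodule ℂ V) (v : V)
    (h : ∀ f : V →ₗ[ℂ] ℂ, (∀ x ∈ N, f x = 0) → f v = 0) : v ∈ N := by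
  by_contra hv
  obtain ⟨f, hf, hN⟩ := Submodule.exists_le_ker_of_notMem hv
  exact hf (h f fun x hx => hN hx)

theorem exists_dual_eq_one {v : V} (hv : v ≠ 0) : ∃ f : V →ₗ[ℂ] ℂ, f v = 1 := by
  by_contra! h
  refine hv ((Submodule.mem_bot ℂ).1 (mem_of_dual_vanish ⊥ v fun f _ => ?_))
  by_contra hf
  exact h ((f v)⁻¹ • f) (by simp [hf])

theorem map₂_top_range (φ : W →ₗ[ℂ] W') (X : V ⊗[ℂ] W')
    (h : X ∈ Submodule.map₂ (TensorProduct.mk ℂ V W') ⊤ (LinearMap.range φ)) :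
    ∃ Y, LinearMap.lTensor V φ Y = X := by
  have : Submodule.map₂ (TensorProduct.mk ℂ V W') ⊤ (LinearMap.range φ) ≤
      LinearMap.range (LinearMap.lTensor V φ) := by
    rw [Submodule.map₂_le]
    rintro m - _ ⟨n, rfl⟩
    exact ⟨m ⊗ₜ n, by simp⟩
  exact this h

theorem map₂_range_top (φ : V →ₗ[ℂ] V') (X : V' ⊗[ℂ] W)
    (h : X ∈ Submodule.map₂ (TensorProduct.mk ℂ V' W) (LinearMap.range φ) ⊤) :
    ∃ Y, LinearMap.rTensor W φ Y = X := by
  have : Submodule.map₂ (TensorProduct.mk ℂ V' W) (LinearMap.range φ) ⊤ ≤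
      LinearMap.range (LinearMap.rTensor W φ) := by
    rw [Submodule.map₂_le]
    rintro _ ⟨n, rfl⟩ m -
    exact ⟨n ⊗ₜ m, by simp⟩
  exact this h

end Slices

/-! ### Calculus of multipliers -/

section MultiplierCalculus

variable {A : Type*} [NonUnitalRing A] [Module ℂ A] [IsScalarTower ℂ A A] [SMulCommClass ℂ A A]
variable {B : Type*} [NonUnitalRing B] [Module ℂ B] [IsScalarTower ℂ B B] [SMulCommClass ℂ B B]
variable {C : Type*} [NonUnitalRing C] [Module ℂ C] [IsScalarTower ℂ C C] [SMulCommClass ℂ C C]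

namespace Multiplier

theorem ext {m n : Multiplier A} (hl : ∀ x, m.left x = n.left x)
    (hr : ∀ x, m.right x = n.right x) : m = n :=
  Subtype.ext (Prod.ext (LinearMap.ext hl) (MulOpposite.unop_injective (LinearMap.ext hr)))

@[simp] theorem mul_left (m n : Multiplier A) (x : A) : (m * n).left x = m.left (n.left x) := rfl
@[simp] theorem mul_right (m n : Multiplier A) (x : A) : (m * n).right x = n.right (m.right x) := rfl
@[simp] theorem one_left (x : A) : (1 : Multiplier A).left x = x := rfl
@[simp] theorem one_right (x : A) : (1 : Multiplier A).right x = x := rfl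
@[simp] theorem zero_left (x : A) : (0 : Multiplier A).left x = 0 := rfl
@[simp] theorem zero_right (x : A) : (0 : Multiplier A).right x = 0 := rfl
@[simp] theorem add_left (m n : Multiplier A) (x : A) :
    (m + n).left x = m.left x + n.left x := rfl
@[simp] theorem mk_left (l r : A →ₗ[ℂ] A) (h : ∀ a b, a * l b = r a * b) :
    (Multiplier.mk l r h).left = l := rfl
@[simp] theorem mk_right (l r : A →ₗ[ℂ] A) (h : ∀ a b, a * l b = r a * b) :
    (Multiplier.mk l r h).right = r := rfl

/-- The action on a fixed element from the left, as a linear map of the multiplier. -/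
def leftAt (x : A) : Multiplier A →ₗ[ℂ] A where
  toFun m := m.left x
  map_add' _ _ := rfl
  map_smul' _ _ := rfl

/-- The action on a fixed element from the right, as a linear map of the multiplier. -/
def rightAt (x : A) : Multiplier A →ₗ[ℂ] A where
  toFun m := m.right x
  map_add' _ _ := rfl
  map_smul' _ _ := rfl

@[simp] theorem leftAt_apply (x : A) (m : Multiplier A) : leftAt x m = m.left x := rfl
@[simp] theorem rightAt_apply (x : A) (m : Multiplier A) : rightAt x m = m.right x := rfl

@[simp] theorem sum_left {ι : Type*} (S : Finset ι) (f : ι → Multiplier A) (x : A) :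
    (∑ i ∈ S, f i).left x = ∑ i ∈ S, (f i).left x := map_sum (leftAt x) f S

@[simp] theorem sum_right {ι : Type*} (S : Finset ι) (f : ι → Multiplier A) (x : A) :
    (∑ i ∈ S, f i).right x = ∑ i ∈ S, (f i).right x := map_sum (rightAt x) f S

theorem tensor_left (m : Multiplier B) (n : Multiplier C) :
    (m.tensor n).left = TensorProduct.map m.left n.left := rfl
theorem tensor_right (m : Multiplier B) (n : Multiplier C) :
    (m.tensor n).right = TensorProduct.map m.right n.right := rfl
@[simp] theorem tensor_left_tmul (m : Multiplier B) (n : Multiplier C) (b : B) (c : C) :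
    (m.tensor n).left (b ⊗ₜ c) = m.left b ⊗ₜ n.left c := rfl
@[simp] theorem tensor_right_tmul (m : Multiplier B) (n : Multiplier C) (b : B) (c : C) :
    (m.tensor n).right (b ⊗ₜ c) = m.right b ⊗ₜ n.right c := rfl

theorem tensor_ext {m n : Multiplier (B ⊗[ℂ] C)}
    (hl : ∀ b c, m.left (b ⊗ₜ c) = n.left (b ⊗ₜ c))
    (hr : ∀ b c, m.right (b ⊗ₜ c) = n.right (b ⊗ₜ c)) : m = n :=
  ext (fun x => LinearMap.congr_fun (TensorProduct.ext' hl) x)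
    (fun x => LinearMap.congr_fun (TensorProduct.ext' hr) x)

theorem tensor_mul (m m' : Multiplier B) (n n' : Multiplier C) :
    m.tensor n * m'.tensor n' = (m * m').tensor (n * n') :=
  tensor_ext (fun _ _ => rfl) (fun _ _ => rfl)

@[simp] theorem tensor_one_one : (1 : Multiplier B).tensor (1 : Multiplier C) = 1 :=
  tensor_ext (fun _ _ => rfl) (fun _ _ => rfl)

@[simp] theorem zero_tensor (n : Multiplier C) : (0 : Multiplier B).tensor n = 0 :=
  tensor_ext (fun _ _ => by simp) (fun _ _ => by simp)

@[simp] theorem tensor_zero (m : Multiplier B) : m.tensor (0 : Multiplier C) = 0 :=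
  tensor_ext (fun _ _ => by simp) (fun _ _ => by simp)

end Multiplier

@[simp] theorem toMultiplier_left (a b : A) : (toMultiplier a).left b = a * b := rfl
@[simp] theorem toMultiplier_right (a b : A) : (toMultiplier a).right b = b * a := rfl

@[simp] theorem toMultiplier_mul (a b : A) :
    toMultiplier (a * b) = toMultiplier a * toMultiplier b :=
  Multiplier.ext (fun x => by simp [mul_assoc]) (fun x => by simp [mul_assoc])

theorem toMultiplier_tmul (b : B) (c : C) :
    toMultiplier (b ⊗ₜ[ℂ] c) = (toMultiplier b).tensor (toMultiplier c) :=
  Multiplier.tensor_ext (fun _ _ => by simp) (fun _ _ => by simp)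

@[simp] theorem multiplierTensor_tmul (m : Multiplier B) (n : Multiplier C) :
    multiplierTensor (m ⊗ₜ[ℂ] n) = m.tensor n := rfl

theorem Multiplier.left_mul_assoc (hA : IsNondegenerateAlgebra A) (m : Multiplier A) (x y : A) :
    m.left (x * y) = m.left x * y := by
  refine sub_eq_zero.1 (hA.2 _ fun z => ?_)
  rw [mul_sub, m.central, ← mul_assoc, ← mul_assoc, m.central, sub_self]

theorem Multiplier.right_mul_assoc (hA : IsNondegenerateAlgebra A) (m : Multiplier A) (x y : A) :
    m.right (x * y) = x * m.right y := by
  refine sub_eq_zero.1 (hA.1 _ fun z => ?_)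
  rw [sub_mul, ← m.central, mul_assoc, mul_assoc, ← m.central, sub_self]

/-- In `(x m) z = x (m z)` the left action fixes the right one up to elements annihilated by all
`z`. -/
theorem Multiplier.ext_left (hA : IsNondegenerateAlgebra A) {m n : Multiplier A}
    (h : ∀ x, m.left x = n.left x) : m = n := by
  refine Multiplier.ext h fun x => sub_eq_zero.1 (hA.1 _ fun z => ?_)
  rw [sub_mul, ← m.central, ← n.central, h, sub_self]

theorem Multiplier.ext_right (hA : IsNondegenerateAlgebra A) {m n : Multiplier A}
    (h : ∀ x, m.right x = n.right x) : m = n := by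
  refine Multiplier.ext (fun x => sub_eq_zero.1 (hA.2 _ fun z => ?_)) h
  rw [mul_sub, m.central, n.central, h, sub_self]

theorem toMultiplier_injective (hA : IsNondegenerateAlgebra A) :
    Function.Injective (toMultiplier : A →ₗ[ℂ] Multiplier A) := by
  refine (injective_iff_map_eq_zero _).2 fun a ha => hA.1 a fun b => ?_
  rw [← toMultiplier_left, ha, Multiplier.zero_left]

theorem toMultiplier_left_apply (hA : IsNondegenerateAlgebra A) (m : Multiplier A) (x : A) :
    toMultiplier (m.left x) = m * toMultiplier x :=
  Multiplier.ext (fun y => by simp [m.left_mul_assoc hA]) (fun y => by simp [m.central])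

theorem toMultiplier_right_apply (hA : IsNondegenerateAlgebra A) (m : Multiplier A) (x : A) :
    toMultiplier (m.right x) = toMultiplier x * m :=
  Multiplier.ext (fun y => by simp [m.central]) (fun y => by simp [m.right_mul_assoc hA])

/-- This is associativity of `m x n` in `M(A)`, into which a non-degenerate `A` embeds. -/
theorem Multiplier.left_right_comm (hA : IsNondegenerateAlgebra A) (m n : Multiplier A) (x : A) :
    m.left (n.right x) = n.right (m.left x) := by
  apply toMultiplier_injective hA
  simp only [toMultiplier_left_apply hA, toMultiplier_right_apply hA, mul_assoc]

theorem mul_tmul_eq (X : B ⊗[ℂ] C) (b : B) (c : C) :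
    X * (b ⊗ₜ c) =
      LinearMap.rTensor C (LinearMap.mulRight ℂ b)
        (LinearMap.lTensor B (LinearMap.mulRight ℂ c) X) := by
  induction X using TensorProduct.induction_on with
  | zero => simp
  | tmul x y => simp
  | add x y hx hy => simp only [add_mul, map_add, hx, hy]

theorem tmul_mul_eq (X : B ⊗[ℂ] C) (b : B) (c : C) :
    (b ⊗ₜ c) * X =
      LinearMap.rTensor C (LinearMap.mulLeft ℂ b)
        (LinearMap.lTensor B (LinearMap.mulLeft ℂ c) X) := by
  induction X using TensorProduct.induction_on with
  | zero => simp
  | tmul x y => simp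
  | add x y hx hy => simp only [mul_add, map_add, hx, hy]

/-- Multiplication by `b ⊗ c` acts leg by leg, and on each leg the multiplications are jointly
injective. -/
theorem IsNondegenerateAlgebra.tensor (hB : IsNondegenerateAlgebra B)
    (hC : IsNondegenerateAlgebra C) : IsNondegenerateAlgebra (B ⊗[ℂ] C) := by
  constructor
  · intro X hX
    refine eq_zero_of_forall_lTensor (fun c => LinearMap.mulRight ℂ c) (fun w h => hC.1 w h) X
      fun c => eq_zero_of_forall_rTensor (fun b => LinearMap.mulRight ℂ b)
        (fun w h => hB.1 w h) _ fun b => ?_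
    rw [← hX (b ⊗ₜ c), mul_tmul_eq]
  · intro X hX
    refine eq_zero_of_forall_lTensor (fun c => LinearMap.mulLeft ℂ c) (fun w h => hC.2 w h) X
      fun c => eq_zero_of_forall_rTensor (fun b => LinearMap.mulLeft ℂ b)
        (fun w h => hB.2 w h) _ fun b => ?_
    rw [← hX (b ⊗ₜ c), tmul_mul_eq]

theorem Multiplier.exists_left_ne_zero (hA : IsNondegenerateAlgebra A) {m : Multiplier A}
    (hm : m ≠ 0) : ∃ x, m.left x ≠ 0 := by
  by_contra! h
  exact hm (Multiplier.ext_left hA h)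

theorem Multiplier.exists_right_ne_zero (hA : IsNondegenerateAlgebra A) {m : Multiplier A}
    (hm : m ≠ 0) : ∃ x, m.right x ≠ 0 := by
  by_contra! h
  exact hm (Multiplier.ext_right hA h)

/-- Slice by a functional that takes the value `1` at a non-zero vector `n c`. This removes the
auxiliary leg after the axioms on `E` have been evaluated. -/
theorem Multiplier.tensor_right_cancel (hB : IsNondegenerateAlgebra B)
    (hC : IsNondegenerateAlgebra C) {m m' : Multiplier B} {n : Multiplier C} (hn : n ≠ 0)
    (h : m.tensor n = m'.tensor n) : m = m' := by
  obtain ⟨c, hc⟩ := n.exists_left_ne_zero hC hn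
  obtain ⟨f, hf⟩ := exists_dual_eq_one hc
  refine Multiplier.ext_left hB fun x => ?_
  have := congrArg (fun k : Multiplier (B ⊗[ℂ] C) =>
    TensorProduct.rid ℂ B (LinearMap.lTensor B f (k.left (x ⊗ₜ c)))) h
  simpa [hf] using this

theorem Multiplier.tensor_left_cancel (hB : IsNondegenerateAlgebra B)
    (hC : IsNondegenerateAlgebra C) {m m' : Multiplier C} {n : Multiplier B} (hn : n ≠ 0)
    (h : n.tensor m = n.tensor m') : m = m' := by
  obtain ⟨c, hc⟩ := n.exists_left_ne_zero hB hn
  obtain ⟨f, hf⟩ := exists_dual_eq_one hc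
  refine Multiplier.ext_left hC fun x => ?_
  have := congrArg (fun k : Multiplier (B ⊗[ℂ] C) =>
    TensorProduct.lid ℂ C (LinearMap.rTensor C f (k.left (c ⊗ₜ x)))) h
  simpa [hf] using this

/-- A multiplier annihilated by all `1 ⊗ c` from the right vanishes. -/
theorem Multiplier.eq_of_mul_right_leg (hid : IsIdempotentAlgebra C)
    (hB : IsNondegenerateAlgebra B) (hC : IsNondegenerateAlgebra C)
    {m n : Multiplier (B ⊗[ℂ] C)}
    (h : ∀ c, m * (1 : Multiplier B).tensor (toMultiplier c) =
      n * (1 : Multiplier B).tensor (toMultiplier c)) : m = n := by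
  refine Multiplier.ext_left (hB.tensor hC) fun X => ?_
  suffices (m.left - n.left) X = 0 from sub_eq_zero.1 this
  induction X using TensorProduct.induction_on with
  | zero => simp
  | add x y hx hy => rw [map_add, hx, hy, add_zero]
  | tmul b c =>
    have hc : c ∈ Submodule.map₂ (LinearMap.mul ℂ C) ⊤ ⊤ := by rw [hid]; trivial
    -- By idempotency it suffices to treat products `c c'`, where `b ⊗ c c' = (1 ⊗ c)(b ⊗ c')`.
    suffices H : Submodule.map₂ (LinearMap.mul ℂ C) ⊤ ⊤ ≤
        LinearMap.ker ((m.left - n.left) ∘ₗ TensorProduct.mk ℂ B C b) from H hc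
    rw [Submodule.map₂_le]
    intro c _ c' _
    have := congrArg (fun k : Multiplier (B ⊗[ℂ] C) => k.left (b ⊗ₜ c')) (h c)
    simpa [sub_eq_zero] using this

/-- A multiplier annihilated by all `b ⊗ 1` from the left vanishes. -/
theorem Multiplier.eq_of_left_leg_mul (hid : IsIdempotentAlgebra B)
    (hB : IsNondegenerateAlgebra B) (hC : IsNondegenerateAlgebra C)
    {m n : Multiplier (B ⊗[ℂ] C)}
    (h : ∀ b, (toMultiplier b).tensor (1 : Multiplier C) * m =
      (toMultiplier b).tensor (1 : Multiplier C) * n) : m = n := by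
  refine Multiplier.ext_right (hB.tensor hC) fun X => ?_
  suffices (m.right - n.right) X = 0 from sub_eq_zero.1 this
  induction X using TensorProduct.induction_on with
  | zero => simp
  | add x y hx hy => rw [map_add, hx, hy, add_zero]
  | tmul b c =>
    have hb : b ∈ Submodule.map₂ (LinearMap.mul ℂ B) ⊤ ⊤ := by rw [hid]; trivial
    suffices H : Submodule.map₂ (LinearMap.mul ℂ B) ⊤ ⊤ ≤
        LinearMap.ker ((m.right - n.right) ∘ₗ (TensorProduct.mk ℂ B C).flip c) from H hb
    rw [Submodule.map₂_le]
    intro b _ b' _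
    have := congrArg (fun k : Multiplier (B ⊗[ℂ] C) => k.right (b ⊗ₜ c)) (h b')
    simpa [sub_eq_zero] using this

end MultiplierCalculus

section SliceMaps

variable {A : Type*} [NonUnitalRing A] [Module ℂ A]

theorem sliceLeft_tmul (f : A →ₗ[ℂ] ℂ) (a b : A) : sliceLeft f (a ⊗ₜ b) = f a • b := by
  simp [sliceLeft]

theorem sliceRight_tmul (f : A →ₗ[ℂ] ℂ) (a b : A) : sliceRight f (a ⊗ₜ b) = f b • a := by
  simp [sliceRight]

theorem sliceLeft_map (f : A →ₗ[ℂ] ℂ) (φ ψ : A →ₗ[ℂ] A) (X : A ⊗[ℂ] A) :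
    sliceLeft f (TensorProduct.map φ ψ X) = ψ (sliceLeft (f ∘ₗ φ) X) := by
  induction X using TensorProduct.induction_on with
  | zero => simp
  | add x y hx hy => simp only [map_add, hx, hy]
  | tmul v w => simp [sliceLeft]

theorem sliceRight_map (f : A →ₗ[ℂ] ℂ) (φ ψ : A →ₗ[ℂ] A) (X : A ⊗[ℂ] A) :
    sliceRight f (TensorProduct.map φ ψ X) = φ (sliceRight (f ∘ₗ ψ) X) := by
  induction X using TensorProduct.induction_on with
  | zero => simp
  | add x y hx hy => simp only [map_add, hx, hy]
  | tmul v w => simp [sliceRight]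

end SliceMaps

/-! ### Legs and the maps `Δ ⊗ id`, `id ⊗ Δ` -/

section Legs

variable {A : Type*} [NonUnitalRing A] [Module ℂ A] [IsScalarTower ℂ A A] [SMulCommClass ℂ A A]
variable {B : Type*} [NonUnitalRing B] [Module ℂ B] [IsScalarTower ℂ B B] [SMulCommClass ℂ B B]
variable {C : Type*} [NonUnitalRing C] [Module ℂ C] [IsScalarTower ℂ C C] [SMulCommClass ℂ C C]

theorem Multiplier.congr_mul (e : B ≃ₗ[ℂ] C) (he : ∀ x y, e (x * y) = e x * e y)
    (m n : Multiplier B) :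
    Multiplier.congr e he (m * n) = Multiplier.congr e he m * Multiplier.congr e he n :=
  Multiplier.ext (fun x => by simp [Multiplier.congr]) (fun x => by simp [Multiplier.congr])

theorem Multiplier.congr_injective (e : B ≃ₗ[ℂ] C) (he : ∀ x y, e (x * y) = e x * e y) :
    Function.Injective (Multiplier.congr e he) := by
  intro m n h
  refine Multiplier.ext (fun x => ?_) (fun x => ?_)
  · simpa [Multiplier.congr] using congrArg (fun k : Multiplier C => k.left (e x)) h
  · simpa [Multiplier.congr] using congrArg (fun k : Multiplier C => k.right (e x)) h

theorem assocMultiplier_mul (m n : Multiplier ((A ⊗[ℂ] A) ⊗[ℂ] A)) :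
    assocMultiplier (m * n) = assocMultiplier m * assocMultiplier n :=
  Multiplier.congr_mul _ _ _ _

theorem assocMultiplier_injective :
    Function.Injective (assocMultiplier (A := A)) :=
  Multiplier.congr_injective _ _

theorem assocMultiplier_tensor (l m n : Multiplier A) :
    assocMultiplier ((l.tensor m).tensor n) = l.tensor (m.tensor n) := by
  apply Multiplier.ext <;> intro x <;>
    induction x using TensorProduct.induction_on with
    | zero => simp
    | add x y hx hy => simp only [map_add, hx, hy]
    | tmul a x =>
      induction x using TensorProduct.induction_on with
      | zero => simp
      | add x y hx hy => simp only [map_add, TensorProduct.tmul_add, hx, hy]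
      | tmul b c => simp [assocMultiplier, Multiplier.congr]

theorem flipMultiplier_tensor (m n : Multiplier A) :
    flipMultiplier (m.tensor n) = n.tensor m :=
  Multiplier.tensor_ext (fun x y => by simp [flipMultiplier, Multiplier.congr])
    (fun x y => by simp [flipMultiplier, Multiplier.congr])

theorem flipMultiplier_flip (m : Multiplier (A ⊗[ℂ] A)) :
    flipMultiplier (flipMultiplier m) = m :=
  Multiplier.ext (fun x => by simp [flipMultiplier, Multiplier.congr])
    (fun x => by simp [flipMultiplier, Multiplier.congr])

theorem flipMultiplier_toMultiplier (x : A ⊗[ℂ] A) :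
    flipMultiplier (toMultiplier x) = toMultiplier (TensorProduct.comm ℂ A A x) :=
  Multiplier.ext (fun y => by simp [flipMultiplier, Multiplier.congr, comm_mul])
    (fun y => by simp [flipMultiplier, Multiplier.congr, comm_mul])

theorem inr_mul_inl (a b : A) : inr b * inl a = toMultiplier (a ⊗ₜ[ℂ] b) := by
  simp [inl, inr, Multiplier.tensor_mul, toMultiplier_tmul]

theorem inl_mul_inr (a b : A) : inl a * inr b = toMultiplier (a ⊗ₜ[ℂ] b) := by
  simp [inl, inr, Multiplier.tensor_mul, toMultiplier_tmul]

theorem inl_mul (a b : A) : inl (a * b) = inl a * inl b := by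
  simp [inl, Multiplier.tensor_mul]

theorem inr_mul (a b : A) : inr (a * b) = inr a * inr b := by
  simp [inr, Multiplier.tensor_mul]

theorem flipMultiplier_inl (a : A) : flipMultiplier (inl a) = inr a := flipMultiplier_tensor _ _

theorem flipMultiplier_inr (a : A) : flipMultiplier (inr a) = inl a := flipMultiplier_tensor _ _

variable (Δ : A →ₙₐ[ℂ] Multiplier (A ⊗[ℂ] A))

@[simp] theorem deltaTensorId_tmul (b c : A) :
    deltaTensorId Δ (b ⊗ₜ c) = assocMultiplier ((Δ b).tensor (toMultiplier c)) := rfl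

@[simp] theorem idTensorDelta_tmul (b c : A) :
    idTensorDelta Δ (b ⊗ₜ c) = (toMultiplier b).tensor (Δ c) := rfl

theorem deltaTensorId_mul (x y : A ⊗[ℂ] A) :
    deltaTensorId Δ (x * y) = deltaTensorId Δ x * deltaTensorId Δ y := by
  induction x using TensorProduct.induction_on with
  | zero => simp
  | add x₁ x₂ h₁ h₂ => simp only [add_mul, map_add, h₁, h₂]
  | tmul a b =>
    induction y using TensorProduct.induction_on with
    | zero => simp
    | add y₁ y₂ h₁ h₂ => simp only [mul_add, map_add, h₁, h₂]
    | tmul c d => simp [← assocMultiplier_mul, Multiplier.tensor_mul]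

theorem idTensorDelta_mul (x y : A ⊗[ℂ] A) :
    idTensorDelta Δ (x * y) = idTensorDelta Δ x * idTensorDelta Δ y := by
  induction x using TensorProduct.induction_on with
  | zero => simp
  | add x₁ x₂ h₁ h₂ => simp only [add_mul, map_add, h₁, h₂]
  | tmul a b =>
    induction y using TensorProduct.induction_on with
    | zero => simp
    | add y₁ y₂ h₁ h₂ => simp only [mul_add, map_add, h₁, h₂]
    | tmul c d => simp [Multiplier.tensor_mul]

theorem deltaTensorId_right_leg (x : A ⊗[ℂ] A) (w : A) :
    deltaTensorId Δ ((inr w).right x) = deltaTensorId Δ x * Multiplier.tensor 1 (inr w) := by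
  rw [inr, ← assocMultiplier_tensor, Multiplier.tensor_one_one]
  induction x using TensorProduct.induction_on with
  | zero => simp
  | add x₁ x₂ h₁ h₂ => simp only [add_mul, map_add, h₁, h₂]
  | tmul a b => simp [← assocMultiplier_mul, Multiplier.tensor_mul]

theorem deltaTensorId_left_leg (x : A ⊗[ℂ] A) (b : A) :
    deltaTensorId Δ ((inl b).right x) = deltaTensorId Δ x * leg12 (Δ b) := by
  induction x using TensorProduct.induction_on with
  | zero => simp
  | add x₁ x₂ h₁ h₂ => simp only [add_mul, map_add, h₁, h₂]
  | tmul a c => simp [inl, leg12, ← assocMultiplier_mul, Multiplier.tensor_mul]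

theorem idTensorDelta_left_leg (x : A ⊗[ℂ] A) (c : A) :
    idTensorDelta Δ ((inl c).left x) =
      Multiplier.tensor (toMultiplier c) 1 * idTensorDelta Δ x := by
  induction x using TensorProduct.induction_on with
  | zero => simp
  | add x₁ x₂ h₁ h₂ => simp only [mul_add, map_add, h₁, h₂]
  | tmul a b => simp [inl, Multiplier.tensor_mul]

theorem idTensorDelta_right_leg (x : A ⊗[ℂ] A) (d : A) :
    idTensorDelta Δ ((inr d).left x) = leg23 (Δ d) * idTensorDelta Δ x := by
  induction x using TensorProduct.induction_on with
  | zero => simp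
  | add x₁ x₂ h₁ h₂ => simp only [mul_add, map_add, h₁, h₂]
  | tmul a c => simp [inr, leg23, Multiplier.tensor_mul]

end Legs

/-! ### Consequences of the axioms of a weak multiplier Hopf algebra -/

section Axioms

variable {A : Type*} [NonUnitalRing A] [Module ℂ A] [IsScalarTower ℂ A A] [SMulCommClass ℂ A A]
variable {Δ : A →ₙₐ[ℂ] Multiplier (A ⊗[ℂ] A)} {E : Multiplier (A ⊗[ℂ] A)}
  {T₁ T₂ : A ⊗[ℂ] A →ₗ[ℂ] A ⊗[ℂ] A}

namespace WeakMultiplierHopfAxioms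

theorem nondegenerate₂ (h : WeakMultiplierHopfAxioms Δ E T₁ T₂) :
    IsNondegenerateAlgebra (A ⊗[ℂ] A) :=
  h.nondegenerate.tensor h.nondegenerate

theorem E_T₁ (h : WeakMultiplierHopfAxioms Δ E T₁ T₂) (x : A ⊗[ℂ] A) : E.left (T₁ x) = T₁ x := by
  have : T₁ x ∈ LinearMap.range E.left := h.range_T₁ ▸ ⟨x, rfl⟩
  obtain ⟨y, hy⟩ := this
  rw [← hy, ← Multiplier.mul_left, h.idem]

theorem T₂_E (h : WeakMultiplierHopfAxioms Δ E T₁ T₂) (x : A ⊗[ℂ] A) : E.right (T₂ x) = T₂ x := by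
  have : T₂ x ∈ LinearMap.range E.right := h.range_T₂ ▸ ⟨x, rfl⟩
  obtain ⟨y, hy⟩ := this
  rw [← hy, ← Multiplier.mul_right, h.idem]

/-- The elements `Δ(a)(1 ⊗ c)` lie in the range of the idempotent `E`, and the factors `1 ⊗ c` can
be cancelled. -/
theorem E_mul_delta (h : WeakMultiplierHopfAxioms Δ E T₁ T₂) (a : A) : E * Δ a = Δ a := by
  refine Multiplier.eq_of_mul_right_leg h.idempotent h.nondegenerate h.nondegenerate fun c => ?_
  change E * Δ a * inr c = Δ a * inr c
  rw [mul_assoc, ← h.isT₁, ← toMultiplier_left_apply h.nondegenerate₂, h.E_T₁]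

theorem delta_mul_E (h : WeakMultiplierHopfAxioms Δ E T₁ T₂) (a : A) : Δ a * E = Δ a := by
  refine Multiplier.eq_of_left_leg_mul h.idempotent h.nondegenerate h.nondegenerate fun c => ?_
  change inl c * (Δ a * E) = inl c * Δ a
  rw [← mul_assoc, ← h.isT₂, ← toMultiplier_right_apply h.nondegenerate₂, h.T₂_E]

/-- The left legs of `Δ` span `A`. -/
theorem left_legs (h : WeakMultiplierHopfAxioms Δ E T₁ T₂) (V : Submodule ℂ A)
    (hV : ∀ a b f, sliceRight f (T₁ (a ⊗ₜ b)) ∈ V) (x : A) : x ∈ V := by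
  rw [h.full_left V ?_]
  · trivial
  · rintro _ ⟨z, rfl⟩
    refine mem_map₂_of_slices_right V _ fun f => ?_
    change sliceRight f (T₁ z) ∈ V
    induction z using TensorProduct.induction_on with
    | zero => simp
    | add x y hx hy => rw [map_add, map_add]; exact V.add_mem hx hy
    | tmul a b => exact hV a b f

/-- The right legs of `Δ` span `A`. -/
theorem right_legs (h : WeakMultiplierHopfAxioms Δ E T₁ T₂) (V : Submodule ℂ A)
    (hV : ∀ a b f, sliceLeft f (T₂ (a ⊗ₜ b)) ∈ V) (x : A) : x ∈ V := by
  rw [h.full_right V ?_]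
  · trivial
  · rintro _ ⟨z, rfl⟩
    refine mem_map₂_of_slices_left V _ fun f => ?_
    change sliceLeft f (T₂ z) ∈ V
    induction z using TensorProduct.induction_on with
    | zero => simp
    | add x y hx hy => rw [map_add, map_add]; exact V.add_mem hx hy
    | tmul a b => exact hV a b f

/-- Fullness says that the left legs of `Δ(a)(1 ⊗ b)` span `A`. Every identity of functionals for
the counit is reduced to slices by this lemma or its mirror image. -/
theorem functional_eq_of_T₁ (h : WeakMultiplierHopfAxioms Δ E T₁ T₂) {f g : A →ₗ[ℂ] ℂ}
    (hfg : ∀ a b, sliceLeft f (T₁ (a ⊗ₜ b)) = sliceLeft g (T₁ (a ⊗ₜ b))) : f = g := by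
  ext x
  suffices x ∈ LinearMap.eqLocus f g from this
  refine h.left_legs _ (fun a b k => ?_) x
  exact (slice_swap f k _).trans ((congrArg k (hfg a b)).trans (slice_swap g k _).symm)

theorem functional_eq_of_T₂ (h : WeakMultiplierHopfAxioms Δ E T₁ T₂) {f g : A →ₗ[ℂ] ℂ}
    (hfg : ∀ a b, sliceRight f (T₂ (a ⊗ₜ b)) = sliceRight g (T₂ (a ⊗ₜ b))) : f = g := by
  ext x
  suffices x ∈ LinearMap.eqLocus f g from this
  refine h.right_legs _ (fun a b k => ?_) x
  exact (slice_swap k f _).symm.trans ((congrArg k (hfg a b)).trans (slice_swap k g _))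

end WeakMultiplierHopfAxioms

end Axioms

/-! ### Comultiplications compatible with a strict sum `E = ∑ s, p s ⊗ q s` -/

section BaseFamily

variable {I : Type*} {A : Type*} [NonUnitalRing A] [Module ℂ A] [IsScalarTower ℂ A A]
  [SMulCommClass ℂ A A]

/-- A family of mutually orthogonal idempotent multipliers with strict sum `1`. -/
structure IsOrthogonalDecomposition (p : I → Multiplier A) : Prop where
  idem : ∀ s, p s * p s = p s
  orth : ∀ s t, s ≠ t → p s * p t = 0
  iSup_left : ⨆ s, LinearMap.range (p s).left = ⊤
  iSup_right : ⨆ s, LinearMap.range (p s).right = ⊤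

/-- On a given element the strict sum equals some finite partial sum over a set containing `t`, and
there only the term `t` survives. -/
theorem IsStrictSum.mul_eq {ι B : Type*} [NonUnitalRing B] [Module ℂ B] [IsScalarTower ℂ B B]
    [SMulCommClass ℂ B B] {f : ι → Multiplier B} {m : Multiplier B} (h : IsStrictSum f m)
    (k : Multiplier B) (t : ι) (ht : ∀ i, i ≠ t → f i * k = 0) : m * k = f t * k := by
  classical
  refine Multiplier.ext (fun x => ?_) (fun x => ?_)
  · obtain ⟨S, ⟨hS, -⟩, htS⟩ := ((h (k.left x)).and (Filter.eventually_ge_atTop {t})).exists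
    rw [Multiplier.mul_left, ← hS, Multiplier.sum_left,
      Finset.sum_eq_single_of_mem t (htS (Finset.mem_singleton_self t))
        (fun i _ hi => by rw [← Multiplier.mul_left, ht i hi, Multiplier.zero_left]),
      Multiplier.mul_left]
  · obtain ⟨S, ⟨-, hS⟩, htS⟩ := ((h x).and (Filter.eventually_ge_atTop {t})).exists
    rw [Multiplier.mul_right, ← hS, Multiplier.sum_right, map_sum,
      Finset.sum_eq_single_of_mem t (htS (Finset.mem_singleton_self t))
        (fun i _ hi => by rw [← Multiplier.mul_right, ht i hi, Multiplier.zero_right]),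
      Multiplier.mul_right]

theorem IsStrictSum.mul_eq' {ι B : Type*} [NonUnitalRing B] [Module ℂ B] [IsScalarTower ℂ B B]
    [SMulCommClass ℂ B B] {f : ι → Multiplier B} {m : Multiplier B} (h : IsStrictSum f m)
    (k : Multiplier B) (t : ι) (ht : ∀ i, i ≠ t → k * f i = 0) : k * m = k * f t := by
  classical
  refine Multiplier.ext (fun x => ?_) (fun x => ?_)
  · obtain ⟨S, ⟨hS, -⟩, htS⟩ := ((h x).and (Filter.eventually_ge_atTop {t})).exists
    rw [Multiplier.mul_left, ← hS, Multiplier.sum_left, map_sum,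
      Finset.sum_eq_single_of_mem t (htS (Finset.mem_singleton_self t))
        (fun i _ hi => by rw [← Multiplier.mul_left, ht i hi, Multiplier.zero_left]),
      Multiplier.mul_left]
  · obtain ⟨S, ⟨-, hS⟩, htS⟩ := ((h (k.right x)).and (Filter.eventually_ge_atTop {t})).exists
    rw [Multiplier.mul_right, ← hS, Multiplier.sum_right,
      Finset.sum_eq_single_of_mem t (htS (Finset.mem_singleton_self t))
        (fun i _ hi => by rw [← Multiplier.mul_right, ht i hi, Multiplier.zero_right]),
      Multiplier.mul_right]

variable {p q : I → Multiplier A} {E : Multiplier (A ⊗[ℂ] A)}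

theorem E_mul_p (hp : IsOrthogonalDecomposition p)
    (hE : IsStrictSum (fun s => (p s).tensor (q s)) E) (t : I) :
    E * (p t).tensor 1 = (p t).tensor (q t) := by
  rw [hE.mul_eq _ t fun i hi => by rw [Multiplier.tensor_mul, hp.orth i t hi,
    Multiplier.zero_tensor], Multiplier.tensor_mul, hp.idem, mul_one]

theorem E_mul_q (hq : IsOrthogonalDecomposition q)
    (hE : IsStrictSum (fun s => (p s).tensor (q s)) E) (t : I) :
    E * Multiplier.tensor 1 (q t) = (p t).tensor (q t) := by
  rw [hE.mul_eq _ t fun i hi => by rw [Multiplier.tensor_mul, hq.orth i t hi,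
    Multiplier.tensor_zero], Multiplier.tensor_mul, hq.idem, mul_one]

theorem p_mul_E (hp : IsOrthogonalDecomposition p)
    (hE : IsStrictSum (fun s => (p s).tensor (q s)) E) (t : I) :
    (p t).tensor 1 * E = (p t).tensor (q t) := by
  rw [hE.mul_eq' _ t fun i hi => by rw [Multiplier.tensor_mul, hp.orth t i hi.symm,
    Multiplier.zero_tensor], Multiplier.tensor_mul, hp.idem, one_mul]

theorem q_mul_E (hq : IsOrthogonalDecomposition q)
    (hE : IsStrictSum (fun s => (p s).tensor (q s)) E) (t : I) :
    Multiplier.tensor 1 (q t) * E = (p t).tensor (q t) := by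
  rw [hE.mul_eq' _ t fun i hi => by rw [Multiplier.tensor_mul, hq.orth t i hi.symm,
    Multiplier.tensor_zero], Multiplier.tensor_mul, hq.idem, one_mul]

/-- `(A, Δ)` is a weak multiplier Hopf algebra whose canonical idempotent is the strict sum
`E = ∑ s, p s ⊗ q s`, for two decompositions `p` and `q` of the unit with non-zero terms. -/
structure IsBasedHopf (p q : I → Multiplier A) (Δ : A →ₙₐ[ℂ] Multiplier (A ⊗[ℂ] A))
    (E : Multiplier (A ⊗[ℂ] A)) (T₁ T₂ : A ⊗[ℂ] A →ₗ[ℂ] A ⊗[ℂ] A) : Prop where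
  left : IsOrthogonalDecomposition p
  right : IsOrthogonalDecomposition q
  left_ne_zero : ∀ t, p t ≠ 0
  right_ne_zero : ∀ t, q t ≠ 0
  strictSum : IsStrictSum (fun s => (p s).tensor (q s)) E
  hopf : WeakMultiplierHopfAxioms Δ E T₁ T₂

namespace IsBasedHopf

variable {Δ : A →ₙₐ[ℂ] Multiplier (A ⊗[ℂ] A)} {T₁ T₂ : A ⊗[ℂ] A →ₗ[ℂ] A ⊗[ℂ] A}

/-- After replacing `Δ(a)` by `Δ(a) E`, both sides become `Δ(a)(p t ⊗ q t)`. -/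
theorem delta_mul_p (h : IsBasedHopf p q Δ E T₁ T₂) (t : I) (a : A) :
    Δ a * (p t).tensor 1 = Δ a * Multiplier.tensor 1 (q t) := by
  rw [← h.hopf.delta_mul_E, mul_assoc, mul_assoc, E_mul_p h.left h.strictSum,
    E_mul_q h.right h.strictSum]

theorem p_mul_delta (h : IsBasedHopf p q Δ E T₁ T₂) (t : I) (a : A) :
    (p t).tensor 1 * Δ a = Multiplier.tensor 1 (q t) * Δ a := by
  rw [← h.hopf.E_mul_delta, ← mul_assoc, ← mul_assoc, p_mul_E h.left h.strictSum,
    q_mul_E h.right h.strictSum]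

/-- Evaluate `(Δ ⊗ id)(E) = (1 ⊗ E)(E ⊗ 1)` on `Δ(a) ⊗ q_t x`, with `q_t x ≠ 0`. As `E(a ⊗ q_t x) =
p_t a ⊗ q_t x`, one side is `Δ(p_t a) ⊗ q_t x`. On the other, `E ⊗ 1` is absorbed by `Δ(a)`, and `1
⊗ E` meets `q_t` in the third leg and leaves `p_t` in the second. Cancelling `q_t x` gives the
claim. -/
theorem delta_p_left (h : IsBasedHopf p q Δ E T₁ T₂) (t : I) (a : A) :
    Δ ((p t).left a) = Multiplier.tensor 1 (p t) * Δ a := by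
  have hA := h.hopf.nondegenerate
  obtain ⟨x, hx⟩ := (q t).exists_left_ne_zero hA (h.right_ne_zero t)
  have h0 : toMultiplier ((q t).left x) ≠ 0 := fun h0 =>
    hx (toMultiplier_injective hA (h0.trans (map_zero _).symm))
  refine (Multiplier.tensor_right_cancel h.hopf.nondegenerate₂ hA h0
    (assocMultiplier_injective ?_)).symm
  have h1 := h.hopf.delta_id_E.1 (a ⊗ₜ (q t).left x)
  have h2 : E.left (a ⊗ₜ (q t).left x) = (p t).left a ⊗ₜ (q t).left x :=
    congrArg (fun m : Multiplier (A ⊗[ℂ] A) => m.left (a ⊗ₜ x)) (E_mul_q h.right h.strictSum t)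
  rw [h2, deltaTensorId_tmul, deltaTensorId_tmul, h.hopf.legs_commute, mul_assoc, leg12,
    ← assocMultiplier_mul, Multiplier.tensor_mul, h.hopf.E_mul_delta, one_mul] at h1
  rw [← h1, toMultiplier_left_apply hA]
  have h3 : ∀ m : Multiplier (A ⊗[ℂ] A), m.tensor (q t * toMultiplier x) =
      Multiplier.tensor (Multiplier.tensor 1 1) (q t) * m.tensor (toMultiplier x) := fun m => by
    rw [Multiplier.tensor_mul, Multiplier.tensor_one_one, one_mul]
  rw [h3 (Δ a), assocMultiplier_mul, ← mul_assoc, assocMultiplier_tensor, leg23,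
    Multiplier.tensor_mul, E_mul_q h.right h.strictSum, ← assocMultiplier_tensor,
    ← assocMultiplier_mul, Multiplier.tensor_mul, one_mul]

theorem delta_p_right (h : IsBasedHopf p q Δ E T₁ T₂) (t : I) (a : A) :
    Δ ((p t).right a) = Δ a * Multiplier.tensor 1 (p t) := by
  have hA := h.hopf.nondegenerate
  obtain ⟨x, hx⟩ := (q t).exists_right_ne_zero hA (h.right_ne_zero t)
  have h0 : toMultiplier ((q t).right x) ≠ 0 := fun h0 =>
    hx (toMultiplier_injective hA (h0.trans (map_zero _).symm))
  refine (Multiplier.tensor_right_cancel h.hopf.nondegenerate₂ hA h0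
    (assocMultiplier_injective ?_)).symm
  have h1 := h.hopf.delta_id_E.2.1 (a ⊗ₜ (q t).right x)
  have h2 : E.right (a ⊗ₜ (q t).right x) = (p t).right a ⊗ₜ (q t).right x :=
    congrArg (fun m : Multiplier (A ⊗[ℂ] A) => m.right (a ⊗ₜ x)) (q_mul_E h.right h.strictSum t)
  rw [h2, deltaTensorId_tmul, deltaTensorId_tmul, ← mul_assoc, leg12,
    ← assocMultiplier_mul, Multiplier.tensor_mul, h.hopf.delta_mul_E, mul_one] at h1
  rw [← h1, toMultiplier_right_apply hA]
  have h3 : ∀ m : Multiplier (A ⊗[ℂ] A), m.tensor (toMultiplier x * q t) =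
      m.tensor (toMultiplier x) * Multiplier.tensor (Multiplier.tensor 1 1) (q t) := fun m => by
    rw [Multiplier.tensor_mul, Multiplier.tensor_one_one, mul_one]
  rw [h3 (Δ a), assocMultiplier_mul, mul_assoc, assocMultiplier_tensor, leg23,
    Multiplier.tensor_mul, q_mul_E h.right h.strictSum, ← assocMultiplier_tensor,
    ← assocMultiplier_mul, Multiplier.tensor_mul, one_mul]

/-- The same argument with `(id ⊗ Δ)(E)`: now `p_t x ≠ 0` is the auxiliary vector, in the first leg,
and `E ⊗ 1` leaves `q_t` in the second. -/
theorem delta_q_left (h : IsBasedHopf p q Δ E T₁ T₂) (t : I) (a : A) :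
    Δ ((q t).left a) = (q t).tensor 1 * Δ a := by
  have hA := h.hopf.nondegenerate
  obtain ⟨x, hx⟩ := (p t).exists_left_ne_zero hA (h.left_ne_zero t)
  have h0 : toMultiplier ((p t).left x) ≠ 0 := fun h0 =>
    hx (toMultiplier_injective hA (h0.trans (map_zero _).symm))
  refine (Multiplier.tensor_left_cancel hA h.hopf.nondegenerate₂ h0 ?_).symm
  have h1 := h.hopf.id_delta_E.1 ((p t).left x ⊗ₜ a)
  have h2 : E.left ((p t).left x ⊗ₜ a) = (p t).left x ⊗ₜ (q t).left a :=
    congrArg (fun m : Multiplier (A ⊗[ℂ] A) => m.left (x ⊗ₜ a)) (E_mul_p h.left h.strictSum t)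
  rw [h2, idTensorDelta_tmul, idTensorDelta_tmul, mul_assoc, leg23,
    Multiplier.tensor_mul, h.hopf.E_mul_delta, one_mul] at h1
  rw [← h1, toMultiplier_left_apply hA]
  have h3 : ∀ m : Multiplier (A ⊗[ℂ] A), Multiplier.tensor (p t * toMultiplier x) m =
      (p t).tensor (Multiplier.tensor 1 1) * (toMultiplier x).tensor m := fun m => by
    rw [Multiplier.tensor_mul, Multiplier.tensor_one_one, one_mul]
  rw [h3 (Δ a), ← assocMultiplier_tensor, ← mul_assoc, leg12, ← assocMultiplier_mul,
    Multiplier.tensor_mul, E_mul_p h.left h.strictSum, one_mul, assocMultiplier_tensor,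
    Multiplier.tensor_mul]

theorem delta_q_right (h : IsBasedHopf p q Δ E T₁ T₂) (t : I) (a : A) :
    Δ ((q t).right a) = Δ a * (q t).tensor 1 := by
  have hA := h.hopf.nondegenerate
  obtain ⟨x, hx⟩ := (p t).exists_right_ne_zero hA (h.left_ne_zero t)
  have h0 : toMultiplier ((p t).right x) ≠ 0 := fun h0 =>
    hx (toMultiplier_injective hA (h0.trans (map_zero _).symm))
  refine (Multiplier.tensor_left_cancel hA h.hopf.nondegenerate₂ h0 ?_).symm
  have h1 := h.hopf.id_delta_E.2.1 ((p t).right x ⊗ₜ a)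
  have h2 : E.right ((p t).right x ⊗ₜ a) = (p t).right x ⊗ₜ (q t).right a :=
    congrArg (fun m : Multiplier (A ⊗[ℂ] A) => m.right (x ⊗ₜ a)) (p_mul_E h.left h.strictSum t)
  rw [h2, idTensorDelta_tmul, idTensorDelta_tmul, h.hopf.legs_commute, ← mul_assoc, leg23,
    Multiplier.tensor_mul, h.hopf.delta_mul_E, mul_one] at h1
  rw [← h1, toMultiplier_right_apply hA]
  have h3 : ∀ m : Multiplier (A ⊗[ℂ] A), Multiplier.tensor (toMultiplier x * p t) m =
      (toMultiplier x).tensor m * (p t).tensor (Multiplier.tensor 1 1) := fun m => by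
    rw [Multiplier.tensor_mul, Multiplier.tensor_one_one, mul_one]
  rw [h3 (Δ a), ← assocMultiplier_tensor, mul_assoc, leg12, ← assocMultiplier_mul,
    Multiplier.tensor_mul, p_mul_E h.left h.strictSum, one_mul, assocMultiplier_tensor,
    Multiplier.tensor_mul]

end IsBasedHopf

end BaseFamily

/-! ### The projections `G₁`, `G₂` and bijectivity of the canonical maps -/

section CanonicalMaps

variable {I : Type*} {A : Type*} [NonUnitalRing A] [Module ℂ A]

/-- Here `leftComm` puts `X` on the outer legs and `b` in the middle. Slicing the third leg extracts
values of `G₁` from its defining equation. -/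
theorem slice_onFirstTwo (G : A ⊗[ℂ] A →ₗ[ℂ] A ⊗[ℂ] A) (f : A →ₗ[ℂ] ℂ) (b : A) (X : A ⊗[ℂ] A) :
    LinearMap.lTensor A (sliceRight f)
        (onFirstTwo G (TensorProduct.leftComm ℂ A A A (b ⊗ₜ X))) = G (sliceRight f X ⊗ₜ b) := by
  have key : ∀ (Z : A ⊗[ℂ] A) (y : A),
      LinearMap.lTensor A (sliceRight f) (TensorProduct.assoc ℂ A A A (Z ⊗ₜ y)) = f y • Z := by
    intro Z y
    induction Z using TensorProduct.induction_on with
    | zero => simp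
    | add u v hu hv => simp only [TensorProduct.add_tmul, map_add, hu, hv, smul_add]
    | tmul u v => simp [sliceRight_tmul]
  induction X using TensorProduct.induction_on with
  | zero => simp
  | add u v hu hv => simp only [TensorProduct.tmul_add, TensorProduct.add_tmul, map_add, hu, hv]
  | tmul x y =>
    simp only [onFirstTwo, LinearMap.comp_apply, LinearEquiv.coe_coe, TensorProduct.leftComm_tmul,
      TensorProduct.assoc_symm_tmul, LinearMap.rTensor_tmul, key, sliceRight_tmul]
    rw [← TensorProduct.smul_tmul', map_smul]

theorem slice_leftComm_right (f : A →ₗ[ℂ] ℂ) (b : A) (X : A ⊗[ℂ] A) :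
    LinearMap.lTensor A (sliceRight f) (TensorProduct.leftComm ℂ A A A (b ⊗ₜ X)) =
      sliceRight f X ⊗ₜ b := by
  simpa [onFirstTwo] using slice_onFirstTwo LinearMap.id f b X

theorem slice_onLastTwo (G : A ⊗[ℂ] A →ₗ[ℂ] A ⊗[ℂ] A) (f : A →ₗ[ℂ] ℂ) (b : A) (X : A ⊗[ℂ] A) :
    TensorProduct.lid ℂ (A ⊗[ℂ] A) (LinearMap.rTensor (A ⊗[ℂ] A) f
        (onLastTwo G (TensorProduct.leftComm ℂ A A A (b ⊗ₜ X)))) = G (b ⊗ₜ sliceLeft f X) := by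
  induction X using TensorProduct.induction_on with
  | zero => simp
  | add u v hu hv => simp only [TensorProduct.tmul_add, map_add, hu, hv]
  | tmul x y => simp [onLastTwo, sliceLeft_tmul]

theorem slice_leftComm_left (f : A →ₗ[ℂ] ℂ) (b : A) (X : A ⊗[ℂ] A) :
    TensorProduct.lid ℂ (A ⊗[ℂ] A) (LinearMap.rTensor (A ⊗[ℂ] A) f
        (TensorProduct.leftComm ℂ A A A (b ⊗ₜ X))) = b ⊗ₜ sliceLeft f X := by
  simpa [onLastTwo] using slice_onLastTwo LinearMap.id f b X

/-- The hypotheses make `G` a projection onto `D`. Since `T (G x) = T x`, restricting to `D` does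
not shrink the range; since `ker T = range (1 - G)` is killed by `G`, it meets `D` only in `0`. -/
theorem bijOn_of_ker_eq {V : Type*} [AddCommGroup V] [Module ℂ V] {T G : V →ₗ[ℂ] V}
    (hker : LinearMap.ker T = LinearMap.range (LinearMap.id - G)) {D R : Submodule ℂ V}
    (hG : ∀ x, G x ∈ D) (hD : ∀ x ∈ D, G x = x) (hR : LinearMap.range T = R) :
    Set.BijOn T D R := by
  have hTG : ∀ x, T (G x) = T x := fun x => by
    have : x - G x ∈ LinearMap.ker T := hker ▸ ⟨x, rfl⟩
    rw [LinearMap.mem_ker, map_sub, sub_eq_zero] at this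
    exact this.symm
  refine ⟨fun x _ => hR ▸ LinearMap.mem_range_self T x, fun x hx y hy hxy => ?_, fun z hz => ?_⟩
  · have : x - y ∈ LinearMap.ker T := by
      rw [LinearMap.mem_ker, map_sub, hxy, sub_self]
    rw [hker] at this
    obtain ⟨w, hw⟩ := this
    have h1 : G (x - y) = x - y := hD _ (D.sub_mem hx hy)
    have h2 : G (x - y) = 0 := by
      rw [← hw, LinearMap.sub_apply, LinearMap.id_apply, map_sub, hD _ (hG w), sub_self]
    exact sub_eq_zero.1 (h1.symm.trans h2)
  · rw [SetLike.mem_coe, ← hR] at hz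
    obtain ⟨x, rfl⟩ := hz
    exact ⟨G x, hG x, hTG x⟩

variable [IsScalarTower ℂ A A] [SMulCommClass ℂ A A]

theorem IsOrthogonalDecomposition.left_induction {p : I → Multiplier A}
    (hp : IsOrthogonalDecomposition p) {motive : A → Prop}
    (mem : ∀ s x, (p s).left x = x → motive x) (zero : motive 0)
    (add : ∀ a b, motive a → motive b → motive (a + b)) (a : A) : motive a := by
  have ha : a ∈ ⨆ s, LinearMap.range (p s).left := by rw [hp.iSup_left]; trivial
  refine Submodule.iSup_induction _ (motive := motive) ha ?_ zero add
  rintro s _ ⟨x, rfl⟩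
  exact mem s _ (by rw [← Multiplier.mul_left, hp.idem])

theorem IsOrthogonalDecomposition.right_induction {p : I → Multiplier A}
    (hp : IsOrthogonalDecomposition p) {motive : A → Prop}
    (mem : ∀ s x, (p s).right x = x → motive x) (zero : motive 0)
    (add : ∀ a b, motive a → motive b → motive (a + b)) (a : A) : motive a := by
  have ha : a ∈ ⨆ s, LinearMap.range (p s).right := by rw [hp.iSup_right]; trivial
  refine Submodule.iSup_induction _ (motive := motive) ha ?_ zero add
  rintro s _ ⟨x, rfl⟩
  exact mem s _ (by rw [← Multiplier.mul_right, hp.idem])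

theorem inr_right_eq (a : A) : (inr a).right = LinearMap.lTensor A (LinearMap.mulRight ℂ a) := rfl

theorem inl_left_eq (a : A) : (inl a).left = LinearMap.rTensor A (LinearMap.mulLeft ℂ a) := rfl

namespace IsBasedHopf

variable {p q : I → Multiplier A} {E : Multiplier (A ⊗[ℂ] A)}
  {Δ : A →ₙₐ[ℂ] Multiplier (A ⊗[ℂ] A)} {T₁ T₂ : A ⊗[ℂ] A →ₗ[ℂ] A ⊗[ℂ] A}

theorem E_left_p (h : IsBasedHopf p q Δ E T₁ T₂) {t : I} {x : A} (hx : (p t).left x = x) (y : A) :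
    E.left (x ⊗ₜ y) = x ⊗ₜ (q t).left y := by
  have := congrArg (fun m : Multiplier (A ⊗[ℂ] A) => m.left (x ⊗ₜ y)) (E_mul_p h.left h.strictSum t)
  simpa [hx] using this

theorem E_right_p (h : IsBasedHopf p q Δ E T₁ T₂) {t : I} {x : A} (hx : (p t).right x = x)
    (y : A) : E.right (x ⊗ₜ y) = x ⊗ₜ (q t).right y := by
  have := congrArg (fun m : Multiplier (A ⊗[ℂ] A) => m.right (x ⊗ₜ y))
    (p_mul_E h.left h.strictSum t)
  simpa [hx] using this

theorem E_right_q (h : IsBasedHopf p q Δ E T₁ T₂) {t : I} (x : A) {y : A}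
    (hy : (q t).right y = y) : E.right (x ⊗ₜ y) = (p t).right x ⊗ₜ y := by
  have := congrArg (fun m : Multiplier (A ⊗[ℂ] A) => m.right (x ⊗ₜ y))
    (q_mul_E h.right h.strictSum t)
  simpa [hy] using this

/-- This is `Δ(a)(1 ⊗ q_s c) = Δ(a)(p_s ⊗ c)`. -/
theorem T₁_q (h : IsBasedHopf p q Δ E T₁ T₂) (s : I) (a c : A) :
    T₁ (a ⊗ₜ (q s).left c) = ((p s).tensor 1).right (T₁ (a ⊗ₜ c)) := by
  apply toMultiplier_injective h.hopf.nondegenerate₂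
  rw [toMultiplier_right_apply h.hopf.nondegenerate₂, h.hopf.isT₁, h.hopf.isT₁, inr, inr,
    toMultiplier_left_apply h.hopf.nondegenerate, mul_assoc, Multiplier.tensor_mul, one_mul,
    mul_one]
  have := congrArg (· * (1 : Multiplier A).tensor (toMultiplier c)) (h.delta_mul_p s a)
  simpa [mul_assoc, Multiplier.tensor_mul] using this.symm

theorem T₂_p (h : IsBasedHopf p q Δ E T₁ T₂) (s : I) (a c : A) :
    T₂ ((p s).right a ⊗ₜ c) = (Multiplier.tensor 1 (q s)).left (T₂ (a ⊗ₜ c)) := by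
  apply toMultiplier_injective h.hopf.nondegenerate₂
  rw [toMultiplier_left_apply h.hopf.nondegenerate₂, h.hopf.isT₂, h.hopf.isT₂, inl, inl,
    toMultiplier_right_apply h.hopf.nondegenerate, ← mul_assoc, Multiplier.tensor_mul, one_mul,
    mul_one]
  have := congrArg ((toMultiplier a).tensor (1 : Multiplier A) * ·) (h.p_mul_delta s c)
  simpa [← mul_assoc, Multiplier.tensor_mul] using this

theorem T₁_inr_right (h : IsBasedHopf p q Δ E T₁ T₂) (c : A) (x : A ⊗[ℂ] A) :
    T₁ ((inr c).right x) = (inr c).right (T₁ x) := by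
  induction x using TensorProduct.induction_on with
  | zero => simp
  | add u v hu hv => simp only [map_add, hu, hv]
  | tmul a b =>
    apply toMultiplier_injective h.hopf.nondegenerate₂
    rw [toMultiplier_right_apply h.hopf.nondegenerate₂, h.hopf.isT₁, mul_assoc, ← inr_mul]
    exact h.hopf.isT₁ a (b * c)

theorem T₂_inl_left (h : IsBasedHopf p q Δ E T₁ T₂) (c : A) (x : A ⊗[ℂ] A) :
    T₂ ((inl c).left x) = (inl c).left (T₂ x) := by
  induction x using TensorProduct.induction_on with
  | zero => simp
  | add u v hu hv => simp only [map_add, hu, hv]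
  | tmul a b =>
    apply toMultiplier_injective h.hopf.nondegenerate₂
    rw [toMultiplier_left_apply h.hopf.nondegenerate₂, h.hopf.isT₂, ← mul_assoc, ← inl_mul]
    exact h.hopf.isT₂ (c * a) b

/-- `(c ⊗ 1)Δ(b)(1 ⊗ a)`, computed in two ways. -/
theorem inl_T₁ (h : IsBasedHopf p q Δ E T₁ T₂) (a b c : A) :
    (inl c).left (T₁ (b ⊗ₜ a)) = (inr a).right (T₂ (c ⊗ₜ b)) := by
  apply toMultiplier_injective h.hopf.nondegenerate₂
  rw [toMultiplier_left_apply h.hopf.nondegenerate₂, toMultiplier_right_apply h.hopf.nondegenerate₂,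
    h.hopf.isT₁, h.hopf.isT₂, mul_assoc]

/-- For `b = p_s b` one has `E(b ⊗ c) = b ⊗ q_s c`, so the defining equation reads `(G₁ ⊗
id)(Δ₁₃(a)(1 ⊗ b ⊗ c)) = Δ₁₃(a)(1 ⊗ b ⊗ q_s c)`. By `T₁_q` the factor `q_s` in the third leg becomes
`p_s` on the right of the first. Slicing the third leg yields the formula for `x` a left leg of `Δ`,
and these span. -/
theorem exists_G₁ (h : IsBasedHopf p q Δ E T₁ T₂) : ∃ G : A ⊗[ℂ] A →ₗ[ℂ] A ⊗[ℂ] A,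
    LinearMap.ker T₁ = LinearMap.range (LinearMap.id - G) ∧
      ∀ s x b, (p s).left b = b → G (x ⊗ₜ b) = (p s).right x ⊗ₜ b := by
  obtain ⟨G, hG, hker⟩ := h.hopf.ker_T₁
  refine ⟨G, hker, fun s x b hb => ?_⟩
  suffices x ∈ LinearMap.eqLocus (G ∘ₗ (TensorProduct.mk ℂ A A).flip b)
      ((TensorProduct.mk ℂ A A).flip b ∘ₗ (p s).right) from this
  refine h.hopf.left_legs _ (fun a c f => ?_) x
  have h1 := congrArg (LinearMap.lTensor A (sliceRight f))
    (LinearMap.congr_fun hG (a ⊗ₜ (b ⊗ₜ c)))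
  have h2 : ∀ y, onOuter T₁ (a ⊗ₜ (b ⊗ₜ y)) =
      TensorProduct.leftComm ℂ A A A (b ⊗ₜ T₁ (a ⊗ₜ y)) := fun y => by simp [onOuter]
  rw [LinearMap.comp_apply, LinearMap.comp_apply, h2, slice_onFirstTwo, onLastTwo,
    LinearMap.lTensor_tmul, h.E_left_p hb, h2, slice_leftComm_right, h.T₁_q,
    Multiplier.tensor_right, sliceRight_map] at h1
  exact h1

theorem exists_G₂ (h : IsBasedHopf p q Δ E T₁ T₂) : ∃ G : A ⊗[ℂ] A →ₗ[ℂ] A ⊗[ℂ] A,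
    LinearMap.ker T₂ = LinearMap.range (LinearMap.id - G) ∧
      ∀ s b x, (q s).right b = b → G (b ⊗ₜ x) = b ⊗ₜ (q s).left x := by
  obtain ⟨G, hG, hker⟩ := h.hopf.ker_T₂
  refine ⟨G, hker, fun s b x hb => ?_⟩
  suffices x ∈ LinearMap.eqLocus (G ∘ₗ TensorProduct.mk ℂ A A b)
      (TensorProduct.mk ℂ A A b ∘ₗ (q s).left) from this
  refine h.hopf.right_legs _ (fun a c f => ?_) x
  have h1 := congrArg (fun z => TensorProduct.lid ℂ (A ⊗[ℂ] A)
    (LinearMap.rTensor (A ⊗[ℂ] A) f z)) (LinearMap.congr_fun hG (a ⊗ₜ (b ⊗ₜ c)))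
  have h2 : ∀ y, onOuter T₂ (y ⊗ₜ (b ⊗ₜ c)) =
      TensorProduct.leftComm ℂ A A A (b ⊗ₜ T₂ (y ⊗ₜ c)) := fun y => by simp [onOuter]
  have h3 : onFirstTwo E.right (a ⊗ₜ (b ⊗ₜ c)) = (p s).right a ⊗ₜ (b ⊗ₜ c) := by
    simp [onFirstTwo, h.E_right_q a hb]
  simp only [LinearMap.comp_apply, h2, h3, slice_onLastTwo, slice_leftComm_left, h.T₂_p,
    Multiplier.tensor_left, sliceLeft_map] at h1
  exact h1

theorem range_E_left (h : IsBasedHopf p q Δ E T₁ T₂) :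
    LinearMap.range E.left =
      ⨆ r, tens (LinearMap.range (p r).left) (LinearMap.range (q r).left) := by
  apply le_antisymm
  · rintro _ ⟨z, rfl⟩
    induction z using TensorProduct.induction_on with
    | zero => simp
    | add u v hu hv => rw [map_add]; exact Submodule.add_mem _ hu hv
    | tmul x y =>
      induction x using h.left.left_induction with
      | zero => simp
      | add u v hu hv =>
        rw [TensorProduct.add_tmul, map_add]
        exact Submodule.add_mem _ hu hv
      | mem s x hx =>
        rw [h.E_left_p hx]
        exact Submodule.mem_iSup_of_mem s (Submodule.apply_mem_map₂ _ ⟨x, hx⟩ ⟨y, rfl⟩)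
  · refine iSup_le fun r => Submodule.map₂_le.2 ?_
    rintro _ ⟨x, rfl⟩ _ ⟨y, rfl⟩
    refine ⟨(p r).left x ⊗ₜ (q r).left y, ?_⟩
    rw [h.E_left_p (t := r) (by rw [← Multiplier.mul_left, h.left.idem]),
      ← Multiplier.mul_left (q r), h.right.idem]
    rfl

theorem range_E_right (h : IsBasedHopf p q Δ E T₁ T₂) :
    LinearMap.range E.right =
      ⨆ r, tens (LinearMap.range (p r).right) (LinearMap.range (q r).right) := by
  apply le_antisymm
  · rintro _ ⟨z, rfl⟩
    induction z using TensorProduct.induction_on with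
    | zero => simp
    | add u v hu hv => rw [map_add]; exact Submodule.add_mem _ hu hv
    | tmul x y =>
      induction x using h.left.right_induction with
      | zero => simp
      | add u v hu hv =>
        rw [TensorProduct.add_tmul, map_add]
        exact Submodule.add_mem _ hu hv
      | mem s x hx =>
        rw [h.E_right_p hx]
        exact Submodule.mem_iSup_of_mem s (Submodule.apply_mem_map₂ _ ⟨x, hx⟩ ⟨y, rfl⟩)
  · refine iSup_le fun r => Submodule.map₂_le.2 ?_
    rintro _ ⟨x, rfl⟩ _ ⟨y, rfl⟩
    refine ⟨(p r).right x ⊗ₜ (q r).right y, ?_⟩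
    rw [h.E_right_p (t := r) (by rw [← Multiplier.mul_right, h.left.idem]),
      ← Multiplier.mul_right (q r), h.right.idem]
    rfl

/-- The domain is the range of the projection `G₁`, and the codomain is the range of the left action
of `E`. -/
theorem bijOn_T₁ (h : IsBasedHopf p q Δ E T₁ T₂) :
    Set.BijOn T₁
      (⨆ r, tens (LinearMap.range (p r).right) (LinearMap.range (p r).left) :
        Submodule ℂ (A ⊗[ℂ] A))
      (⨆ r, tens (LinearMap.range (p r).left) (LinearMap.range (q r).left) :
        Submodule ℂ (A ⊗[ℂ] A)) := by
  obtain ⟨G, hker, hG⟩ := h.exists_G₁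
  refine bijOn_of_ker_eq hker (fun z => ?_) (fun z hz => ?_) (h.hopf.range_T₁.trans h.range_E_left)
  · induction z using TensorProduct.induction_on with
    | zero => simp
    | add u v hu hv => rw [map_add]; exact Submodule.add_mem _ hu hv
    | tmul x y =>
      induction y using h.left.left_induction with
      | zero => simp
      | add u v hu hv =>
        rw [TensorProduct.tmul_add, map_add]
        exact Submodule.add_mem _ hu hv
      | mem s y hy =>
        rw [hG s x y hy]
        exact Submodule.mem_iSup_of_mem s (Submodule.apply_mem_map₂ _ ⟨x, rfl⟩ ⟨y, hy⟩)
  · suffices H : (⨆ r, tens (LinearMap.range (p r).right) (LinearMap.range (p r).left)) ≤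
        LinearMap.eqLocus G LinearMap.id from H hz
    refine iSup_le fun r => Submodule.map₂_le.2 ?_
    rintro _ ⟨x, rfl⟩ _ ⟨y, rfl⟩
    change G _ = _
    rw [TensorProduct.mk_apply, hG r _ _ (by rw [← Multiplier.mul_left, h.left.idem]),
      ← Multiplier.mul_right, h.left.idem]
    rfl

theorem bijOn_T₂ (h : IsBasedHopf p q Δ E T₁ T₂) :
    Set.BijOn T₂
      (⨆ r, tens (LinearMap.range (q r).right) (LinearMap.range (q r).left) :
        Submodule ℂ (A ⊗[ℂ] A))
      (⨆ r, tens (LinearMap.range (p r).right) (LinearMap.range (q r).right) :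
        Submodule ℂ (A ⊗[ℂ] A)) := by
  obtain ⟨G, hker, hG⟩ := h.exists_G₂
  refine bijOn_of_ker_eq hker (fun z => ?_) (fun z hz => ?_) (h.hopf.range_T₂.trans h.range_E_right)
  · induction z using TensorProduct.induction_on with
    | zero => simp
    | add u v hu hv => rw [map_add]; exact Submodule.add_mem _ hu hv
    | tmul x y =>
      induction x using h.right.right_induction with
      | zero => simp
      | add u v hu hv =>
        rw [TensorProduct.add_tmul, map_add]
        exact Submodule.add_mem _ hu hv
      | mem s x hx =>
        rw [hG s x y hx]
        exact Submodule.mem_iSup_of_mem s (Submodule.apply_mem_map₂ _ ⟨x, hx⟩ ⟨y, rfl⟩)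
  · suffices H : (⨆ r, tens (LinearMap.range (q r).right) (LinearMap.range (q r).left)) ≤
        LinearMap.eqLocus G LinearMap.id from H hz
    refine iSup_le fun r => Submodule.map₂_le.2 ?_
    rintro _ ⟨x, rfl⟩ _ ⟨y, rfl⟩
    change G _ = _
    rw [TensorProduct.mk_apply, hG r _ _ (by rw [← Multiplier.mul_right, h.right.idem]),
      ← Multiplier.mul_left, h.right.idem]
    rfl

/-! ### Local units -/

/-- Choose `b` with `b p_s ≠ 0`. The element `Δ(b)(1 ⊗ a)` lies in `A ⊗ A a`, and applying `E` shows
it to be `T₁(y)(1 ⊗ a) = T₁(y(1 ⊗ a))` for some `y`. As `T₁` determines its argument up to `ker G₁`,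
this gives `b p_s ⊗ a = G₁(y)(1 ⊗ a)`. A functional with value `1` at `b p_s` then exhibits `a` as
`e a`. -/
theorem exists_left_unit (h : IsBasedHopf p q Δ E T₁ T₂) {s : I} {a : A}
    (ha : (p s).left a = a) : ∃ e, e * a = a := by
  have hA := h.hopf.nondegenerate
  obtain ⟨G, hker, hG⟩ := h.exists_G₁
  obtain ⟨b, hb⟩ := (p s).exists_right_ne_zero hA (h.left_ne_zero s)
  have h1 : T₁ (b ⊗ₜ a) ∈ Submodule.map₂ (TensorProduct.mk ℂ A A) ⊤
      (LinearMap.range (LinearMap.mulRight ℂ a)) := by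
    -- Let `g` vanish on `A a`. Then `c · (id ⊗ g)(Δ(b)(1 ⊗ a)) = (id ⊗ g)(T₂(c ⊗ b)(1 ⊗ a)) = 0`
    -- for every `c`, so non-degeneracy kills the slice by `g`.
    refine mem_map₂_of_slices_left _ _ fun f => mem_of_dual_vanish _ _ fun g hg => ?_
    rw [← slice_swap]
    refine (congrArg f (hA.2 _ fun c => ?_)).trans (map_zero f)
    change (LinearMap.mulLeft ℂ c) _ = 0
    rw [← rid_lTensor_rTensor, ← inl_left_eq, h.inl_T₁, inr_right_eq, ← LinearMap.comp_apply,
      ← LinearMap.lTensor_comp,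
      show g ∘ₗ LinearMap.mulRight ℂ a = 0 from LinearMap.ext fun x => hg _ ⟨x, rfl⟩]
    simp
  obtain ⟨w, hw⟩ := map₂_top_range _ _ h1
  rw [← inr_right_eq] at hw
  obtain ⟨y, hy⟩ : E.left w ∈ LinearMap.range T₁ := h.hopf.range_T₁ ▸ ⟨w, rfl⟩
  -- The vector `w` itself need not lie in the range of `T₁`; `E w` does, and `E` fixes `T₁(b ⊗ a)`.
  have h2 : T₁ (b ⊗ₜ a) = T₁ ((inr a).right y) := by
    rw [h.T₁_inr_right, hy, ← Multiplier.left_right_comm h.hopf.nondegenerate₂, hw, h.hopf.E_T₁]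
  -- On the second leg `G` only reads the component `p_t A`, which right multiplication by `a`
  -- preserves.
  have hGG : ∀ z, (inr a).right (G z) = G ((inr a).right z) := by
    intro z
    induction z using TensorProduct.induction_on with
    | zero => simp
    | add u v hu hv => simp only [map_add, hu, hv]
    | tmul x y =>
      induction y using h.left.left_induction with
      | zero => simp
      | add u v hu hv => simp only [TensorProduct.tmul_add, map_add, hu, hv]
      | mem t y hy =>
        have : (p t).left (y * a) = y * a := by rw [Multiplier.left_mul_assoc hA, hy]
        simp only [inr, Multiplier.tensor_right_tmul, toMultiplier_right, Multiplier.one_right,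
          hG t x y hy, hG t x _ this]
  have hker' : ∀ u v, T₁ u = T₁ v → G u = G v := by
    intro u v huv
    have : u - v ∈ LinearMap.ker T₁ := by rw [LinearMap.mem_ker, map_sub, huv, sub_self]
    rw [hker] at this
    obtain ⟨w, hw⟩ := this
    have hGi : ∀ z, G (G z) = G z := by
      intro z
      induction z using TensorProduct.induction_on with
      | zero => simp
      | add u v hu hv => simp only [map_add, hu, hv]
      | tmul x y =>
        induction y using h.left.left_induction with
        | zero => simp
        | add u v hu hv => simp only [TensorProduct.tmul_add, map_add, hu, hv]
        | mem t y hy =>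
          rw [hG t x y hy, hG t _ y hy, ← Multiplier.mul_right, h.left.idem]
    rw [← sub_eq_zero, ← map_sub, ← hw, LinearMap.sub_apply, LinearMap.id_apply, map_sub, hGi,
      sub_self]
  have h3 := hker' _ _ h2
  rw [hG s b a ha, ← hGG] at h3
  obtain ⟨f, hf⟩ := exists_dual_eq_one hb
  refine ⟨TensorProduct.lid ℂ A (LinearMap.rTensor A f (G y)), ?_⟩
  have h4 := congrArg (fun z => TensorProduct.lid ℂ A (LinearMap.rTensor A f z)) h3
  simp only [inr_right_eq, lid_rTensor_lTensor] at h4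
  simpa [hf] using h4.symm

/-- Mirror image of `exists_left_unit`: use `T₂(a ⊗ b)` with `q_s b ≠ 0`, the projection `G₂`, and a
slice of the second leg. -/
theorem exists_right_unit (h : IsBasedHopf p q Δ E T₁ T₂) {s : I} {a : A}
    (ha : (q s).right a = a) : ∃ e, a * e = a := by
  have hA := h.hopf.nondegenerate
  obtain ⟨G, hker, hG⟩ := h.exists_G₂
  obtain ⟨b, hb⟩ := (q s).exists_left_ne_zero hA (h.right_ne_zero s)
  have h1 : T₂ (a ⊗ₜ b) ∈ Submodule.map₂ (TensorProduct.mk ℂ A A)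
      (LinearMap.range (LinearMap.mulLeft ℂ a)) ⊤ := by
    refine mem_map₂_of_slices_right _ _ fun f => mem_of_dual_vanish _ _ fun g hg => ?_
    rw [slice_swap]
    refine (congrArg f (hA.1 _ fun c => ?_)).trans (map_zero f)
    change (LinearMap.mulRight ℂ c) _ = 0
    rw [← lid_rTensor_lTensor, ← inr_right_eq, ← h.inl_T₁, inl_left_eq, ← LinearMap.comp_apply,
      ← LinearMap.rTensor_comp,
      show g ∘ₗ LinearMap.mulLeft ℂ a = 0 from LinearMap.ext fun x => hg _ ⟨x, rfl⟩]
    simp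
  obtain ⟨w, hw⟩ := map₂_range_top _ _ h1
  rw [← inl_left_eq] at hw
  obtain ⟨y, hy⟩ : E.right w ∈ LinearMap.range T₂ := h.hopf.range_T₂ ▸ ⟨w, rfl⟩
  have h2 : T₂ (a ⊗ₜ b) = T₂ ((inl a).left y) := by
    rw [h.T₂_inl_left, hy, Multiplier.left_right_comm h.hopf.nondegenerate₂, hw, h.hopf.T₂_E]
  have hGG : ∀ z, (inl a).left (G z) = G ((inl a).left z) := by
    intro z
    induction z using TensorProduct.induction_on with
    | zero => simp
    | add u v hu hv => simp only [map_add, hu, hv]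
    | tmul x y =>
      induction x using h.right.right_induction with
      | zero => simp
      | add u v hu hv => simp only [TensorProduct.add_tmul, map_add, hu, hv]
      | mem t x hx =>
        have : (q t).right (a * x) = a * x := by rw [Multiplier.right_mul_assoc hA, hx]
        simp only [inl, Multiplier.tensor_left_tmul, toMultiplier_left, Multiplier.one_left,
          hG t x y hx, hG t _ y this]
  have hker' : ∀ u v, T₂ u = T₂ v → G u = G v := by
    intro u v huv
    have : u - v ∈ LinearMap.ker T₂ := by rw [LinearMap.mem_ker, map_sub, huv, sub_self]
    rw [hker] at this
    obtain ⟨w, hw⟩ := this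
    have hGi : ∀ z, G (G z) = G z := by
      intro z
      induction z using TensorProduct.induction_on with
      | zero => simp
      | add u v hu hv => simp only [map_add, hu, hv]
      | tmul x y =>
        induction x using h.right.right_induction with
        | zero => simp
        | add u v hu hv => simp only [TensorProduct.add_tmul, map_add, hu, hv]
        | mem t x hx =>
          rw [hG t x y hx, hG t x _ hx, ← Multiplier.mul_left, h.right.idem]
    rw [← sub_eq_zero, ← map_sub, ← hw, LinearMap.sub_apply, LinearMap.id_apply, map_sub, hGi,
      sub_self]
  have h3 := hker' _ _ h2
  rw [hG s a b ha, ← hGG] at h3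
  obtain ⟨f, hf⟩ := exists_dual_eq_one hb
  refine ⟨TensorProduct.rid ℂ A (LinearMap.lTensor A f (G y)), ?_⟩
  have h4 := congrArg (fun z => TensorProduct.rid ℂ A (LinearMap.lTensor A f z)) h3
  simp only [inl_left_eq, rid_lTensor_rTensor] at h4
  simpa [hf] using h4.symm

end IsBasedHopf

end CanonicalMaps

/-! ### The counit -/

section Counit

variable {I : Type*} {A : Type*} [NonUnitalRing A] [Module ℂ A] [IsScalarTower ℂ A A]
  [SMulCommClass ℂ A A]
variable {p q : I → Multiplier A} {E : Multiplier (A ⊗[ℂ] A)}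
  {Δ : A →ₙₐ[ℂ] Multiplier (A ⊗[ℂ] A)} {T₁ T₂ T₃ T₄ : A ⊗[ℂ] A →ₗ[ℂ] A ⊗[ℂ] A} {ε : A →ₗ[ℂ] ℂ}

theorem sliceLeft_tensor_left (f : A →ₗ[ℂ] ℂ) (m n : Multiplier A) (X : A ⊗[ℂ] A) :
    sliceLeft f ((m.tensor n).left X) = n.left (sliceLeft (f ∘ₗ m.left) X) :=
  sliceLeft_map _ _ _ _

theorem sliceLeft_tensor_right (f : A →ₗ[ℂ] ℂ) (m n : Multiplier A) (X : A ⊗[ℂ] A) :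
    sliceLeft f ((m.tensor n).right X) = n.right (sliceLeft (f ∘ₗ m.right) X) :=
  sliceLeft_map _ _ _ _

theorem sliceRight_tensor_left (f : A →ₗ[ℂ] ℂ) (m n : Multiplier A) (X : A ⊗[ℂ] A) :
    sliceRight f ((m.tensor n).left X) = m.left (sliceRight (f ∘ₗ n.left) X) :=
  sliceRight_map _ _ _ _

theorem sliceRight_tensor_right (f : A →ₗ[ℂ] ℂ) (m n : Multiplier A) (X : A ⊗[ℂ] A) :
    sliceRight f ((m.tensor n).right X) = m.right (sliceRight (f ∘ₗ n.right) X) :=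
  sliceRight_map _ _ _ _

namespace WeakMultiplierHopfAxioms

/-- `Δ(a)(b ⊗ c) = (Δ(a)(1 ⊗ c))(b ⊗ 1)`. -/
theorem inl_right_T₁ (h : WeakMultiplierHopfAxioms Δ E T₁ T₂) (a b c : A) :
    (inl b).right (T₁ (a ⊗ₜ c)) = (Δ a).left (b ⊗ₜ c) := by
  apply toMultiplier_injective h.nondegenerate₂
  rw [toMultiplier_right_apply h.nondegenerate₂, toMultiplier_left_apply h.nondegenerate₂,
    h.isT₁, mul_assoc, inr_mul_inl]

/-- `(b ⊗ c)Δ(a) = (1 ⊗ c)((b ⊗ 1)Δ(a))`. -/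
theorem inr_left_T₂ (h : WeakMultiplierHopfAxioms Δ E T₁ T₂) (a b c : A) :
    (inr c).left (T₂ (b ⊗ₜ a)) = (Δ a).right (b ⊗ₜ c) := by
  apply toMultiplier_injective h.nondegenerate₂
  rw [toMultiplier_right_apply h.nondegenerate₂, toMultiplier_left_apply h.nondegenerate₂,
    h.isT₂, ← mul_assoc, inr_mul_inl]

/-- Slicing `(c ⊗ 1)Δ(a)(b ⊗ 1)` by `ε` reduces the claim to the counit identity for `T₂`; then `c`
is cancelled. In this way a counit for `(A, Δ)` also serves the maps `T₃` and `T₄`. -/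
theorem sliceRight_T₃ (h : WeakMultiplierHopfAxioms Δ E T₁ T₂) (hT₃ : IsT₃ Δ T₃)
    (hε : ∀ a b, sliceRight ε (T₂ (a ⊗ₜ b)) = a * b) (a b : A) :
    sliceRight ε (T₃ (a ⊗ₜ b)) = a * b := by
  refine sub_eq_zero.1 (h.nondegenerate.2 _ fun c => ?_)
  rw [mul_sub, sub_eq_zero]
  have h1 : (inl c).left (T₃ (a ⊗ₜ b)) = (inl b).right (T₂ (c ⊗ₜ a)) := by
    apply toMultiplier_injective h.nondegenerate₂
    rw [toMultiplier_left_apply h.nondegenerate₂, toMultiplier_right_apply h.nondegenerate₂,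
      hT₃, h.isT₂, mul_assoc]
  have h2 := congrArg (sliceRight ε) h1
  rw [inl, inl, sliceRight_tensor_left, sliceRight_tensor_right] at h2
  refine h2.trans ((congrArg (· * b) (hε c a)).trans (mul_assoc _ _ _))

theorem sliceLeft_T₄ (h : WeakMultiplierHopfAxioms Δ E T₁ T₂) (hT₄ : IsT₄ Δ T₄)
    (hε : ∀ a b, sliceLeft ε (T₁ (a ⊗ₜ b)) = a * b) (a b : A) :
    sliceLeft ε (T₄ (b ⊗ₜ a)) = b * a := by
  refine sub_eq_zero.1 (h.nondegenerate.1 _ fun c => ?_)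
  rw [sub_mul, sub_eq_zero]
  have h1 : (inr c).right (T₄ (b ⊗ₜ a)) = (inr b).left (T₁ (a ⊗ₜ c)) := by
    apply toMultiplier_injective h.nondegenerate₂
    rw [toMultiplier_left_apply h.nondegenerate₂, toMultiplier_right_apply h.nondegenerate₂,
      hT₄, h.isT₁, mul_assoc]
  have h2 := congrArg (sliceLeft ε) h1
  rw [inr, inr, sliceLeft_tensor_left, sliceLeft_tensor_right] at h2
  refine h2.trans ((congrArg (b * ·) (hε a c)).trans (mul_assoc _ _ _).symm)

end WeakMultiplierHopfAxioms

namespace IsBasedHopf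

theorem sliceLeft_p (h : IsBasedHopf p q Δ E T₁ T₂)
    (hε : ∀ a b, sliceLeft ε (T₁ (a ⊗ₜ b)) = a * b) (s : I) (a b : A) :
    sliceLeft (ε ∘ₗ (p s).left) (T₁ (a ⊗ₜ b)) = (q s).left (a * b) := by
  have h1 : ((p s).tensor 1).left (T₁ (a ⊗ₜ b)) =
      (Multiplier.tensor 1 (q s)).left (T₁ (a ⊗ₜ b)) := by
    apply toMultiplier_injective h.hopf.nondegenerate₂
    rw [toMultiplier_left_apply h.hopf.nondegenerate₂,
      toMultiplier_left_apply h.hopf.nondegenerate₂, h.hopf.isT₁, ← mul_assoc, h.p_mul_delta,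
      mul_assoc]
  have h2 := congrArg (sliceLeft ε) h1
  rw [sliceLeft_tensor_left, sliceLeft_tensor_left] at h2
  exact h2.trans (congrArg (q s).left (hε a b))

theorem sliceRight_p (h : IsBasedHopf p q Δ E T₁ T₂)
    (hε : ∀ a b, sliceRight ε (T₂ (a ⊗ₜ b)) = a * b) (s : I) (a b : A) :
    sliceRight (ε ∘ₗ (p s).right) (T₂ (a ⊗ₜ b)) = a * (p s).right b := by
  have h1 : (Multiplier.tensor 1 (p s)).right (T₂ (a ⊗ₜ b)) = T₂ (a ⊗ₜ (p s).right b) := by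
    apply toMultiplier_injective h.hopf.nondegenerate₂
    rw [toMultiplier_right_apply h.hopf.nondegenerate₂, h.hopf.isT₂, h.hopf.isT₂,
      h.delta_p_right, mul_assoc]
  have h2 := congrArg (sliceRight ε) h1
  rw [sliceRight_tensor_right, hε] at h2
  exact h2

/-- Slicing `Δ(a)(1 ⊗ b)` by either functional gives `q_s a b`: for `p_s` because `(p_s ⊗ 1)Δ(a) =
(1 ⊗ q_s)Δ(a)`, for `q_s` because `(q_s ⊗ 1)Δ(a) = Δ(q_s a)`. -/
theorem counit_left (h : IsBasedHopf p q Δ E T₁ T₂)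
    (hε : ∀ a b, sliceLeft ε (T₁ (a ⊗ₜ b)) = a * b) (s : I) (a : A) :
    ε ((p s).left a) = ε ((q s).left a) := by
  suffices ε ∘ₗ (p s).left = ε ∘ₗ (q s).left from LinearMap.congr_fun this a
  refine h.hopf.functional_eq_of_T₁ fun a b => ?_
  rw [h.sliceLeft_p hε]
  have h1 : ((q s).tensor 1).left (T₁ (a ⊗ₜ b)) = T₁ ((q s).left a ⊗ₜ b) := by
    apply toMultiplier_injective h.hopf.nondegenerate₂
    rw [toMultiplier_left_apply h.hopf.nondegenerate₂, h.hopf.isT₁, h.hopf.isT₁,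
      h.delta_q_left, mul_assoc]
  have h2 := congrArg (sliceLeft ε) h1
  rw [sliceLeft_tensor_left, hε] at h2
  rw [Multiplier.left_mul_assoc h.hopf.nondegenerate]
  exact h2.symm

theorem counit_right (h : IsBasedHopf p q Δ E T₁ T₂)
    (hε : ∀ a b, sliceRight ε (T₂ (a ⊗ₜ b)) = a * b) (s : I) (a : A) :
    ε ((p s).right a) = ε ((q s).right a) := by
  suffices ε ∘ₗ (p s).right = ε ∘ₗ (q s).right from LinearMap.congr_fun this a
  refine h.hopf.functional_eq_of_T₂ fun a b => ?_
  rw [h.sliceRight_p hε]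
  have h1 : (Multiplier.tensor 1 (q s)).right (T₂ (a ⊗ₜ b)) =
      ((p s).tensor 1).right (T₂ (a ⊗ₜ b)) := by
    apply toMultiplier_injective h.hopf.nondegenerate₂
    rw [toMultiplier_right_apply h.hopf.nondegenerate₂,
      toMultiplier_right_apply h.hopf.nondegenerate₂, h.hopf.isT₂, mul_assoc, ← h.delta_mul_p,
      mul_assoc]
  have h2 := congrArg (sliceRight ε) h1
  rw [sliceRight_tensor_right, sliceRight_tensor_right] at h2
  rw [← Multiplier.right_mul_assoc h.hopf.nondegenerate]
  exact (h2.trans (congrArg (p s).right (hε a b))).symm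

/-- Compare the functionals `y ↦ ε(y x)` and `y ↦ ε(x) ε(y p_s)` on the left legs of `Δ(a)(1 ⊗ c)`.
Both slices equal `ε(x) a q_s c`. -/
theorem counit_mul (h : IsBasedHopf p q Δ E T₁ T₂)
    (hε : ∀ a b, sliceLeft ε (T₁ (a ⊗ₜ b)) = a * b) {s : I} (a : A) {x : A}
    (hx : (p s).left x = x) : ε (a * x) = ε ((p s).right a) * ε x := by
  suffices ε ∘ₗ (toMultiplier x).right = ε x • (ε ∘ₗ (p s).right) by
    have := LinearMap.congr_fun this a
    simpa [mul_comm] using this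
  refine h.hopf.functional_eq_of_T₁ fun a c => ?_
  -- Multiplicativity of `Δ` gives this only on the range of `T₁`. The identity `Δ(a) = Δ(a) E` is
  -- therefore used below to replace `x ⊗ c` by `E(x ⊗ c)`, which lies in that range.
  have key : ∀ z, sliceLeft ε ((Δ a).left (T₁ z)) = a * sliceLeft ε (T₁ z) := by
    intro z
    induction z using TensorProduct.induction_on with
    | zero => simp
    | add u v hu hv => simp only [map_add, mul_add, hu, hv]
    | tmul u v =>
      have : (Δ a).left (T₁ (u ⊗ₜ v)) = T₁ ((a * u) ⊗ₜ v) := by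
        apply toMultiplier_injective h.hopf.nondegenerate₂
        rw [toMultiplier_left_apply h.hopf.nondegenerate₂, h.hopf.isT₁, h.hopf.isT₁, map_mul,
          mul_assoc]
      rw [this, hε, hε, mul_assoc]
  have h1 := congrArg (sliceLeft ε) (h.hopf.inl_right_T₁ a x c)
  rw [inl, sliceLeft_tensor_right, Multiplier.one_right] at h1
  obtain ⟨z, hz⟩ : E.left (x ⊗ₜ c) ∈ LinearMap.range T₁ := h.hopf.range_T₁ ▸ ⟨_, rfl⟩
  rw [h1, ← h.hopf.delta_mul_E, Multiplier.mul_left, ← hz, key, hz, h.E_left_p hx,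
    sliceLeft_tmul]
  have h2 := congrArg (sliceLeft ε) (h.T₁_q s a c)
  rw [hε, sliceLeft_tensor_right, Multiplier.one_right] at h2
  have h3 : sliceLeft (ε x • (ε ∘ₗ (p s).right)) (T₁ (a ⊗ₜ c)) =
      ε x • sliceLeft (ε ∘ₗ (p s).right) (T₁ (a ⊗ₜ c)) := by
    simp [sliceLeft, LinearMap.rTensor_smul]
  rw [h3, ← h2, mul_smul_comm]

/-- If `ε` vanished on `p_s A`, then `sliceLeft_p` would give `q_s (x y) = 0` for all `x`, `y`,
contradicting `q_s ≠ 0`. -/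
theorem exists_counit_left_ne_zero (h : IsBasedHopf p q Δ E T₁ T₂)
    (hε : ∀ a b, sliceLeft ε (T₁ (a ⊗ₜ b)) = a * b) (s : I) : ∃ x, ε ((p s).left x) ≠ 0 := by
  by_contra! h0
  have h1 : ε ∘ₗ (p s).left = 0 := LinearMap.ext h0
  refine h.right_ne_zero s (Multiplier.ext_left h.hopf.nondegenerate fun x => ?_)
  refine h.hopf.nondegenerate.1 _ fun y => ?_
  rw [← Multiplier.left_mul_assoc h.hopf.nondegenerate, ← h.sliceLeft_p hε, h1]
  simp [sliceLeft]

theorem exists_counit_right_ne_zero (h : IsBasedHopf p q Δ E T₁ T₂)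
    (hε : ∀ a b, sliceRight ε (T₂ (a ⊗ₜ b)) = a * b) (s : I) : ∃ x, ε ((p s).right x) ≠ 0 := by
  by_contra! h0
  have h1 : ε ∘ₗ (p s).right = 0 := LinearMap.ext h0
  refine h.left_ne_zero s (Multiplier.ext_right h.hopf.nondegenerate fun x => ?_)
  refine h.hopf.nondegenerate.2 _ fun y => ?_
  rw [← h.sliceRight_p hε, h1]
  simp [sliceRight]

end IsBasedHopf

end Counit

/-! ### Coassociativity -/

section Coassociativity

variable {A : Type*} [NonUnitalRing A] [Module ℂ A] [IsScalarTower ℂ A A]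
  [SMulCommClass ℂ A A]
variable {E : Multiplier (A ⊗[ℂ] A)}
  {Δ : A →ₙₐ[ℂ] Multiplier (A ⊗[ℂ] A)} {T₁ T₂ T₃ T₄ : A ⊗[ℂ] A →ₗ[ℂ] A ⊗[ℂ] A}

theorem Multiplier.leftAt_add (x y : A) :
    leftAt (x + y) = leftAt x + leftAt y := LinearMap.ext fun m => map_add m.left x y

theorem Multiplier.leftAt_smul (c : ℂ) (x : A) :
    leftAt (c • x) = c • leftAt x := LinearMap.ext fun m => map_smul m.left c x

theorem Multiplier.rightAt_add (x y : A) :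
    rightAt (x + y) = rightAt x + rightAt y := LinearMap.ext fun m => map_add m.right x y

theorem Multiplier.rightAt_smul (c : ℂ) (x : A) :
    rightAt (c • x) = c • rightAt x := LinearMap.ext fun m => map_smul m.right c x

theorem assocMultiplier_surjective : Function.Surjective (assocMultiplier (A := A)) := by
  intro n
  refine ⟨Multiplier.congr (TensorProduct.assoc ℂ A A A).symm (fun x y => ?_) n, ?_⟩
  · rw [LinearEquiv.symm_apply_eq, assoc_mul, LinearEquiv.apply_symm_apply,
      LinearEquiv.apply_symm_apply]
  · refine Multiplier.ext (fun x => ?_) (fun x => ?_) <;> simp [assocMultiplier, Multiplier.congr]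

/-- `z ⊗ w ↦ (Δ ⊗ id)(Δ(a)(1 ⊗ w))(z ⊗ 1)`. -/
def deltaDeltaLeft (Δ : A →ₙₐ[ℂ] Multiplier (A ⊗[ℂ] A)) (T₁ : A ⊗[ℂ] A →ₗ[ℂ] A ⊗[ℂ] A) (a : A) :
    (A ⊗[ℂ] A) ⊗[ℂ] A →ₗ[ℂ] (A ⊗[ℂ] A) ⊗[ℂ] A :=
  TensorProduct.lift <| LinearMap.mk₂ ℂ
    (fun z w => LinearMap.rTensor A
      (Multiplier.leftAt z ∘ₗ (Δ : A →ₗ[ℂ] Multiplier (A ⊗[ℂ] A))) (T₁ (a ⊗ₜ w)))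
    (fun z z' w => by
      rw [Multiplier.leftAt_add, LinearMap.add_comp, LinearMap.rTensor_add, LinearMap.add_apply])
    (fun c z w => by
      rw [Multiplier.leftAt_smul, LinearMap.smul_comp, LinearMap.rTensor_smul,
        LinearMap.smul_apply])
    (fun z w w' => by rw [TensorProduct.tmul_add, map_add, map_add])
    (fun c z w => by rw [TensorProduct.tmul_smul, map_smul, map_smul])

/-- `z ⊗ w ↦ (z ⊗ 1)(Δ ⊗ id)((1 ⊗ w)Δ(a))`. -/
def deltaDeltaRight (Δ : A →ₙₐ[ℂ] Multiplier (A ⊗[ℂ] A)) (T₄ : A ⊗[ℂ] A →ₗ[ℂ] A ⊗[ℂ] A) (a : A) :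
    (A ⊗[ℂ] A) ⊗[ℂ] A →ₗ[ℂ] (A ⊗[ℂ] A) ⊗[ℂ] A :=
  TensorProduct.lift <| LinearMap.mk₂ ℂ
    (fun z w => LinearMap.rTensor A
      (Multiplier.rightAt z ∘ₗ (Δ : A →ₗ[ℂ] Multiplier (A ⊗[ℂ] A))) (T₄ (w ⊗ₜ a)))
    (fun z z' w => by
      rw [Multiplier.rightAt_add, LinearMap.add_comp, LinearMap.rTensor_add, LinearMap.add_apply])
    (fun c z w => by
      rw [Multiplier.rightAt_smul, LinearMap.smul_comp, LinearMap.rTensor_smul,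
        LinearMap.smul_apply])
    (fun z w w' => by rw [TensorProduct.add_tmul, map_add, map_add])
    (fun c z w => by rw [← TensorProduct.smul_tmul', map_smul, map_smul])

/-- On elementary tensors both sides come from `(1 ⊗ w)Δ(a)(1 ⊗ w')` by applying `u ↦ z Δ(u) z'` to
its first leg. -/
theorem deltaDelta_central (h : WeakMultiplierHopfAxioms Δ E T₁ T₂) (hT₄ : IsT₄ Δ T₄) (a : A)
    (x y : (A ⊗[ℂ] A) ⊗[ℂ] A) :
    x * deltaDeltaLeft Δ T₁ a y = deltaDeltaRight Δ T₄ a x * y := by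
  induction x using TensorProduct.induction_on with
  | zero => simp
  | add x₁ x₂ h₁ h₂ => simp only [add_mul, map_add, h₁, h₂]
  | tmul z w =>
    induction y using TensorProduct.induction_on with
    | zero => simp
    | add y₁ y₂ h₁ h₂ => simp only [mul_add, map_add, h₁, h₂]
    | tmul z' w' =>
      have h1 : (inr w).left (T₁ (a ⊗ₜ w')) = (inr w').right (T₄ (w ⊗ₜ a)) := by
        apply toMultiplier_injective h.nondegenerate₂
        rw [toMultiplier_left_apply h.nondegenerate₂, toMultiplier_right_apply h.nondegenerate₂,
          hT₄, h.isT₁, mul_assoc]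
      have h2 : ∀ X : A ⊗[ℂ] A, (z ⊗ₜ w) * LinearMap.rTensor A
          (Multiplier.leftAt z' ∘ₗ (Δ : A →ₗ[ℂ] Multiplier (A ⊗[ℂ] A))) X =
          LinearMap.rTensor A (LinearMap.mulLeft ℂ z ∘ₗ Multiplier.leftAt z' ∘ₗ
            (Δ : A →ₗ[ℂ] Multiplier (A ⊗[ℂ] A))) ((inr w).left X) := fun X => by
        induction X using TensorProduct.induction_on with
        | zero => simp
        | add x₁ x₂ h₁ h₂ => simp only [mul_add, map_add, h₁, h₂]
        | tmul u v => simp [inr]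
      have h3 : ∀ X : A ⊗[ℂ] A, LinearMap.rTensor A
          (Multiplier.rightAt z ∘ₗ (Δ : A →ₗ[ℂ] Multiplier (A ⊗[ℂ] A))) X * (z' ⊗ₜ w') =
          LinearMap.rTensor A (LinearMap.mulLeft ℂ z ∘ₗ Multiplier.leftAt z' ∘ₗ
            (Δ : A →ₗ[ℂ] Multiplier (A ⊗[ℂ] A))) ((inr w').right X) := fun X => by
        induction X using TensorProduct.induction_on with
        | zero => simp
        | add x₁ x₂ h₁ h₂ => simp only [add_mul, map_add, h₁, h₂]
        | tmul u v => simp [inr, Multiplier.central]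
      exact (h2 _).trans ((congrArg _ h1).trans (h3 _).symm)

namespace WeakMultiplierHopfAxioms

theorem eq_of_mul_third_leg (h : WeakMultiplierHopfAxioms Δ E T₁ T₂)
    {m n : Multiplier (A ⊗[ℂ] (A ⊗[ℂ] A))}
    (hmn : ∀ w : A, m * Multiplier.tensor 1 (inr w) = n * Multiplier.tensor 1 (inr w)) :
    m = n := by
  obtain ⟨m, rfl⟩ := assocMultiplier_surjective m
  obtain ⟨n, rfl⟩ := assocMultiplier_surjective n
  refine congrArg _ (Multiplier.eq_of_mul_right_leg h.idempotent h.nondegenerate₂ h.nondegenerate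
    fun w => assocMultiplier_injective ?_)
  have := hmn w
  rwa [inr, ← assocMultiplier_tensor, Multiplier.tensor_one_one, ← assocMultiplier_mul,
    ← assocMultiplier_mul] at this

/-- There is a multiplier `(Δ ⊗ id)(Δ(a))`, with
`(Δ ⊗ id)(Δ(a))(1 ⊗ 1 ⊗ w) = (Δ ⊗ id)(Δ(a)(1 ⊗ w))`. -/
theorem exists_deltaDelta (h : WeakMultiplierHopfAxioms Δ E T₁ T₂) (hT₄ : IsT₄ Δ T₄) (a : A) :
    ∃ M : Multiplier (A ⊗[ℂ] (A ⊗[ℂ] A)),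
      ∀ w, M * Multiplier.tensor 1 (inr w) = deltaTensorId Δ (T₁ (a ⊗ₜ w)) := by
  -- The left action uses `Δ(a)(1 ⊗ w) ∈ A ⊗ A`; the right action needs `(1 ⊗ w)Δ(a) ∈ A ⊗ A`, which
  -- is expressed by `T₄`.
  refine ⟨assocMultiplier (Multiplier.mk (deltaDeltaLeft Δ T₁ a) (deltaDeltaRight Δ T₄ a)
    (deltaDelta_central h hT₄ a)), fun w => ?_⟩
  rw [inr, ← assocMultiplier_tensor, Multiplier.tensor_one_one, ← assocMultiplier_mul]
  refine congrArg _ (Multiplier.ext_left (h.nondegenerate₂.tensor h.nondegenerate) fun X => ?_)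
  have h1 : ∀ x, T₁ (a ⊗ₜ (w * x)) = (inr x).right (T₁ (a ⊗ₜ w)) := fun x => by
    apply toMultiplier_injective h.nondegenerate₂
    rw [toMultiplier_right_apply h.nondegenerate₂, h.isT₁, h.isT₁, mul_assoc, ← inr_mul]
  have h2 : ∀ (z : A ⊗[ℂ] A) (x : A) (X : A ⊗[ℂ] A), LinearMap.rTensor A
      (Multiplier.leftAt z ∘ₗ (Δ : A →ₗ[ℂ] Multiplier (A ⊗[ℂ] A))) ((inr x).right X) =
      (multiplierTensor (TensorProduct.map (Δ : A →ₗ[ℂ] Multiplier (A ⊗[ℂ] A))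
        toMultiplier X)).left (z ⊗ₜ x) := fun z x X => by
    induction X using TensorProduct.induction_on with
    | zero => simp
    | add x₁ x₂ h₁ h₂ => simp only [map_add, h₁, h₂, Multiplier.add_left]
    | tmul u v => simp [inr]
  induction X using TensorProduct.induction_on with
  | zero => simp
  | add x₁ x₂ h₁ h₂ => simp only [map_add, h₁, h₂]
  | tmul z x =>
    refine Eq.trans ?_ (h2 z x (T₁ (a ⊗ₜ w)))
    rw [← h1]
    rfl

theorem leg12_E_mul (h : WeakMultiplierHopfAxioms Δ E T₁ T₂) (x : A ⊗[ℂ] A) :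
    leg12 E * deltaTensorId Δ x = deltaTensorId Δ x := by
  induction x using TensorProduct.induction_on with
  | zero => simp
  | add x₁ x₂ h₁ h₂ => simp only [map_add, mul_add, h₁, h₂]
  | tmul u v =>
    rw [deltaTensorId_tmul, leg12, ← assocMultiplier_mul, Multiplier.tensor_mul, h.E_mul_delta,
      one_mul]

theorem mul_leg12_E (h : WeakMultiplierHopfAxioms Δ E T₁ T₂) (x : A ⊗[ℂ] A) :
    deltaTensorId Δ x * leg12 E = deltaTensorId Δ x := by
  induction x using TensorProduct.induction_on with
  | zero => simp
  | add x₁ x₂ h₁ h₂ => simp only [map_add, add_mul, h₁, h₂]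
  | tmul u v =>
    rw [deltaTensorId_tmul, leg12, ← assocMultiplier_mul, Multiplier.tensor_mul, h.delta_mul_E,
      mul_one]

theorem leg23_E_mul (h : WeakMultiplierHopfAxioms Δ E T₁ T₂) (x : A ⊗[ℂ] A) :
    leg23 E * idTensorDelta Δ x = idTensorDelta Δ x := by
  induction x using TensorProduct.induction_on with
  | zero => simp
  | add x₁ x₂ h₁ h₂ => simp only [map_add, mul_add, h₁, h₂]
  | tmul u v => rw [idTensorDelta_tmul, leg23, Multiplier.tensor_mul, h.E_mul_delta, one_mul]

theorem mul_leg23_E (h : WeakMultiplierHopfAxioms Δ E T₁ T₂) (x : A ⊗[ℂ] A) :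
    idTensorDelta Δ x * leg23 E = idTensorDelta Δ x := by
  induction x using TensorProduct.induction_on with
  | zero => simp
  | add x₁ x₂ h₁ h₂ => simp only [map_add, add_mul, h₁, h₂]
  | tmul u v => rw [idTensorDelta_tmul, leg23, Multiplier.tensor_mul, h.delta_mul_E, mul_one]

theorem leg12_comm_third (m : Multiplier (A ⊗[ℂ] A)) (w : A) :
    leg12 m * Multiplier.tensor 1 (inr w) = Multiplier.tensor 1 (inr w) * leg12 m := by
  rw [inr, ← assocMultiplier_tensor, Multiplier.tensor_one_one, leg12, ← assocMultiplier_mul,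
    ← assocMultiplier_mul, Multiplier.tensor_mul, Multiplier.tensor_mul]
  simp

theorem leg23_comm_first (m : Multiplier (A ⊗[ℂ] A)) (c : A) :
    leg23 m * Multiplier.tensor (toMultiplier c) 1 =
      Multiplier.tensor (toMultiplier c) 1 * leg23 m := by
  rw [leg23, Multiplier.tensor_mul, Multiplier.tensor_mul]
  simp

/-- The multiplier `M` is built from `Δ ⊗ id`. The weak coassociativity axiom computes `(c ⊗ 1 ⊗ 1)
M` through `id ⊗ Δ`, so the same `M` extends both maps; each identity is checked after
multiplication on an outer leg. -/
theorem exists_coassoc (h : WeakMultiplierHopfAxioms Δ E T₁ T₂) (hT₄ : IsT₄ Δ T₄) (a : A) :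
    ∃ M, IsExtension (deltaTensorId Δ) (leg12 E) (Δ a) M ∧
      IsExtension (idTensorDelta Δ) (leg23 E) (Δ a) M := by
  obtain ⟨M, hM⟩ := h.exists_deltaDelta hT₄ a
  have hM' : ∀ c, Multiplier.tensor (toMultiplier c) 1 * M = idTensorDelta Δ (T₂ (c ⊗ₜ a)) :=
    fun c => h.eq_of_mul_third_leg fun w => by rw [mul_assoc, hM, h.coassoc]
  have cancel : ∀ {m n : Multiplier (A ⊗[ℂ] (A ⊗[ℂ] A))},
      (∀ c : A, Multiplier.tensor (toMultiplier c) 1 * m =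
        Multiplier.tensor (toMultiplier c) 1 * n) → m = n :=
    Multiplier.eq_of_left_leg_mul h.idempotent h.nondegenerate h.nondegenerate₂
  refine ⟨M, ⟨fun x => ?_, fun x => ?_, ?_, ?_⟩, ⟨fun x => ?_, fun x => ?_, ?_, ?_⟩⟩
  · induction x using TensorProduct.induction_on with
    | zero => simp
    | add x₁ x₂ h₁ h₂ => simp only [map_add, mul_add, h₁, h₂]
    | tmul b c =>
      have : deltaTensorId Δ (b ⊗ₜ c) = Multiplier.tensor 1 (inr c) * leg12 (Δ b) := by
        rw [inr, ← assocMultiplier_tensor, Multiplier.tensor_one_one, leg12,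
          ← assocMultiplier_mul, Multiplier.tensor_mul]
        simp
      -- `M (1 ⊗ 1 ⊗ c)(Δ(b) ⊗ 1) = (Δ ⊗ id)(Δ(a)(1 ⊗ c))(Δ(b) ⊗ 1) = (Δ ⊗ id)(Δ(a)(b ⊗ c))`.
      rw [this, ← mul_assoc, hM, ← deltaTensorId_left_leg, h.inl_right_T₁]
  · refine h.eq_of_mul_third_leg fun w => ?_
    rw [mul_assoc, hM, ← deltaTensorId_mul, ← deltaTensorId_right_leg]
    congr 1
    apply toMultiplier_injective h.nondegenerate₂
    rw [toMultiplier_mul, h.isT₁, toMultiplier_right_apply h.nondegenerate₂,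
      toMultiplier_right_apply h.nondegenerate₂, mul_assoc]
  · exact h.eq_of_mul_third_leg fun w => by rw [mul_assoc, hM, h.leg12_E_mul]
  · refine h.eq_of_mul_third_leg fun w => ?_
    rw [mul_assoc, leg12_comm_third, ← mul_assoc, hM, h.mul_leg12_E]
  · refine cancel fun c => ?_
    rw [← mul_assoc, hM', ← idTensorDelta_mul, ← idTensorDelta_left_leg]
    congr 1
    apply toMultiplier_injective h.nondegenerate₂
    rw [toMultiplier_mul, h.isT₂, toMultiplier_left_apply h.nondegenerate₂,
      toMultiplier_left_apply h.nondegenerate₂, mul_assoc]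
  · induction x using TensorProduct.induction_on with
    | zero => simp
    | add x₁ x₂ h₁ h₂ => simp only [map_add, add_mul, h₁, h₂]
    | tmul b d =>
      have : idTensorDelta Δ (b ⊗ₜ d) = leg23 (Δ d) * Multiplier.tensor (toMultiplier b) 1 := by
        rw [leg23, Multiplier.tensor_mul]
        simp
      rw [this, mul_assoc, hM', ← idTensorDelta_right_leg, h.inr_left_T₂]
  · refine cancel fun c => ?_
    rw [← mul_assoc, ← leg23_comm_first, mul_assoc, hM', h.leg23_E_mul]
  · exact cancel fun c => by rw [← mul_assoc, hM', h.mul_leg23_E]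

end WeakMultiplierHopfAxioms

end Coassociativity

/-! ### Base units, graded local units and the components of `A ⊗ᴵ A` -/

namespace PartialAlgebra

section Grading

variable {I J : Type*} {A : Type*} [NonUnitalRing A] [Module ℂ A]

theorem linearMap_ext (G : PartialAlgebra J A) {V : Type*} [AddCommMonoid V] [Module ℂ V]
    {f g : A →ₗ[ℂ] V} (h : ∀ r s, ∀ a ∈ G.comp r s, f a = g a) : f = g := by
  ext a
  induction a using G.induction with
  | zero => simp
  | add a b ha hb => rw [map_add, map_add, ha, hb]
  | mem r s a ha => exact h r s a ha

theorem tens_le_tensorComp (G : PartialAlgebra (I × I) A) (i j : I × I) (t u : I) :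
    tens (G.comp (i.1, t) (j.1, u)) (G.comp (t, i.2) (u, j.2)) ≤ G.tensorComp i j :=
  le_iSup₂ (f := fun t u => tens (G.comp (i.1, t) (j.1, u)) (G.comp (t, i.2) (u, j.2))) t u

end Grading

section GradedUnits

variable {J : Type*} {A : Type*} [NonUnitalRing A] [Module ℂ A] [IsScalarTower ℂ A A]
  [SMulCommClass ℂ A A]

open Classical in
theorem unit_left_of_mem (G : PartialAlgebra J A) (P : J → Prop) {r s : J} {a : A}
    (ha : a ∈ G.comp r s) : (G.unit P).left a = if P r then a else 0 :=
  G.proj_of_mem _ ha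

open Classical in
theorem unit_right_of_mem (G : PartialAlgebra J A) (P : J → Prop) {r s : J} {a : A}
    (ha : a ∈ G.comp r s) : (G.unit P).right a = if P s then a else 0 :=
  G.proj_of_mem _ ha

theorem unit_mul_unit (G : PartialAlgebra J A) (P Q : J → Prop) :
    G.unit P * G.unit Q = G.unit fun j => P j ∧ Q j := by
  classical
  refine Multiplier.ext (LinearMap.congr_fun (f := (G.unit P * G.unit Q).left)
    (G.linearMap_ext fun r s a ha => ?_)) (LinearMap.congr_fun (f := (G.unit P * G.unit Q).right)
    (G.linearMap_ext fun r s a ha => ?_))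
  · rw [Multiplier.mul_left, G.unit_left_of_mem _ ha, G.unit_left_of_mem _ ha]
    by_cases hP : P r <;> by_cases hQ : Q r <;> simp [hP, hQ, G.unit_left_of_mem _ ha]
  · rw [Multiplier.mul_right, G.unit_right_of_mem _ ha, G.unit_right_of_mem _ ha]
    by_cases hP : P s <;> by_cases hQ : Q s <;> simp [hP, hQ, G.unit_right_of_mem _ ha]

theorem unit_false (G : PartialAlgebra J A) {P : J → Prop} (hP : ∀ j, ¬ P j) : G.unit P = 0 := by
  classical
  refine Multiplier.ext (LinearMap.congr_fun (f := (G.unit P).left) (g := 0)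
    (G.linearMap_ext fun r s a ha => ?_)) (LinearMap.congr_fun (f := (G.unit P).right) (g := 0)
    (G.linearMap_ext fun r s a ha => ?_))
  · rw [G.unit_left_of_mem _ ha, if_neg (hP r), LinearMap.zero_apply]
  · rw [G.unit_right_of_mem _ ha, if_neg (hP s), LinearMap.zero_apply]

theorem range_unit_left (G : PartialAlgebra J A) (P : J → Prop) :
    LinearMap.range (G.unit P).left = ⨆ r, ⨆ _ : P r, G.row r := by
  classical
  apply le_antisymm
  · rintro _ ⟨a, rfl⟩
    induction a using G.induction with
    | zero => simp
    | add a b ha hb => rw [map_add]; exact Submodule.add_mem _ ha hb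
    | mem r s a ha =>
      rw [G.unit_left_of_mem _ ha]
      split_ifs with hP
      · exact Submodule.mem_iSup_of_mem r (Submodule.mem_iSup_of_mem hP
          (Submodule.mem_iSup_of_mem s ha))
      · exact Submodule.zero_mem _
  · exact iSup_le fun r => iSup_le fun hP => iSup_le fun s a ha =>
      ⟨a, by rw [G.unit_left_of_mem _ ha, if_pos hP]⟩

theorem range_unit_right (G : PartialAlgebra J A) (P : J → Prop) :
    LinearMap.range (G.unit P).right = ⨆ s, ⨆ _ : P s, G.col s := by
  classical
  apply le_antisymm
  · rintro _ ⟨a, rfl⟩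
    induction a using G.induction with
    | zero => simp
    | add a b ha hb => rw [map_add]; exact Submodule.add_mem _ ha hb
    | mem r s a ha =>
      rw [G.unit_right_of_mem _ ha]
      split_ifs with hP
      · exact Submodule.mem_iSup_of_mem s (Submodule.mem_iSup_of_mem hP
          (Submodule.mem_iSup_of_mem r ha))
      · exact Submodule.zero_mem _
  · exact iSup_le fun s => iSup_le fun hP => iSup_le fun r a ha =>
      ⟨a, by rw [G.unit_right_of_mem _ ha, if_pos hP]⟩

theorem row_eq_range (G : PartialAlgebra J A) (j : J) :
    G.row j = LinearMap.range (G.unit (· = j)).left := by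
  rw [range_unit_left, iSup_iSup_eq_left]

theorem col_eq_range (G : PartialAlgebra J A) (j : J) :
    G.col j = LinearMap.range (G.unit (· = j)).right := by
  rw [range_unit_right, iSup_iSup_eq_left]

/-- The base units are grouped along the fibres of `f`. The two projections of `I × I` give the
families of lower and upper units. -/
theorem isOrthogonalDecomposition {I : Type*} (G : PartialAlgebra J A) (f : J → I) :
    IsOrthogonalDecomposition fun i => G.unit fun j => f j = i where
  idem i := by rw [unit_mul_unit]; simp only [and_self]
  orth i i' hi := by
    rw [unit_mul_unit]
    exact G.unit_false fun j hj => hi (hj.1.symm.trans hj.2)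
  iSup_left := by
    classical
    rw [eq_top_iff]
    rintro a -
    induction a using G.induction with
    | zero => simp
    | add a b ha hb => exact Submodule.add_mem _ ha hb
    | mem r s a ha =>
      exact Submodule.mem_iSup_of_mem (f r) ⟨a, by rw [G.unit_left_of_mem _ ha, if_pos rfl]⟩
  iSup_right := by
    classical
    rw [eq_top_iff]
    rintro a -
    induction a using G.induction with
    | zero => simp
    | add a b ha hb => exact Submodule.add_mem _ ha hb
    | mem r s a ha =>
      exact Submodule.mem_iSup_of_mem (f s) ⟨a, by rw [G.unit_right_of_mem _ ha, if_pos rfl]⟩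

end GradedUnits

section SquareUnits

variable {I : Type*} {A : Type*} [NonUnitalRing A] [Module ℂ A] [IsScalarTower ℂ A A]
  [SMulCommClass ℂ A A] (G : PartialAlgebra (I × I) A)

theorem iSup_snd_eq {α : Type*} [CompleteLattice α] (f : I × I → α) (t : I) :
    ⨆ j, ⨆ _ : j.2 = t, f j = ⨆ r, f (r, t) :=
  le_antisymm (iSup_le fun j => iSup_le fun hj => hj ▸ le_iSup (fun r => f (r, j.2)) j.1)
    (iSup_le fun r => le_iSup₂ (f := fun j (_ : j.2 = t) => f j) (r, t) rfl)

theorem iSup_fst_eq {α : Type*} [CompleteLattice α] (f : I × I → α) (r : I) :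
    ⨆ j, ⨆ _ : j.1 = r, f j = ⨆ t, f (r, t) :=
  le_antisymm (iSup_le fun j => iSup_le fun hj => hj ▸ le_iSup (fun t => f (j.1, t)) j.2)
    (iSup_le fun t => le_iSup₂ (f := fun j (_ : j.1 = r) => f j) (r, t) rfl)

theorem lowerCol_eq_range (t : I) : G.lowerCol t = LinearMap.range (G.lowerUnit t).right := by
  rw [lowerUnit, range_unit_right, iSup_snd_eq, lowerCol]

theorem lowerRow_eq_range (t : I) : G.lowerRow t = LinearMap.range (G.lowerUnit t).left := by
  rw [lowerUnit, range_unit_left, iSup_snd_eq, lowerRow]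

theorem upperCol_eq_range (r : I) : G.upperCol r = LinearMap.range (G.upperUnit r).right := by
  rw [upperUnit, range_unit_right, iSup_fst_eq, upperCol]

theorem upperRow_eq_range (r : I) : G.upperRow r = LinearMap.range (G.upperUnit r).left := by
  rw [upperUnit, range_unit_left, iSup_fst_eq, upperRow]

theorem upper_mul_lower (j : I × I) :
    G.upperUnit j.1 * G.lowerUnit j.2 = G.unit (· = j) := by
  rw [upperUnit, lowerUnit, unit_mul_unit]
  congr 1
  funext i
  exact propext Prod.ext_iff.symm

theorem lower_mul_upper (j : I × I) :
    G.lowerUnit j.2 * G.upperUnit j.1 = G.unit (· = j) := by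
  rw [upperUnit, lowerUnit, unit_mul_unit]
  congr 1
  funext i
  exact propext (and_comm.trans Prod.ext_iff.symm)

theorem upperUnit_idem (r : I) : G.upperUnit r * G.upperUnit r = G.upperUnit r :=
  (G.isOrthogonalDecomposition Prod.fst).idem r

theorem lowerUnit_idem (t : I) : G.lowerUnit t * G.lowerUnit t = G.lowerUnit t :=
  (G.isOrthogonalDecomposition Prod.snd).idem t

theorem upper_mul_unit (j : I × I) :
    G.upperUnit j.1 * G.unit (· = j) = G.unit (· = j) := by
  rw [← upper_mul_lower, ← mul_assoc, upperUnit_idem]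

theorem lower_mul_unit (j : I × I) :
    G.lowerUnit j.2 * G.unit (· = j) = G.unit (· = j) := by
  rw [← lower_mul_upper, ← mul_assoc, lowerUnit_idem]

theorem unit_mul_upper (j : I × I) :
    G.unit (· = j) * G.upperUnit j.1 = G.unit (· = j) := by
  rw [← lower_mul_upper, mul_assoc, upperUnit_idem]

theorem unit_mul_lower (j : I × I) :
    G.unit (· = j) * G.lowerUnit j.2 = G.unit (· = j) := by
  rw [← upper_mul_lower, mul_assoc, lowerUnit_idem]

variable {G}

theorem upper_right_of_mem_col {j : I × I} {a : A} (ha : a ∈ G.col j) :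
    (G.upperUnit j.1).right a = a := by
  rw [col_eq_range] at ha
  obtain ⟨b, rfl⟩ := ha
  rw [← Multiplier.mul_right, unit_mul_upper]

theorem lower_right_of_mem_col {j : I × I} {a : A} (ha : a ∈ G.col j) :
    (G.lowerUnit j.2).right a = a := by
  rw [col_eq_range] at ha
  obtain ⟨b, rfl⟩ := ha
  rw [← Multiplier.mul_right, unit_mul_lower]

theorem upper_left_of_mem_row {j : I × I} {a : A} (ha : a ∈ G.row j) :
    (G.upperUnit j.1).left a = a := by
  rw [row_eq_range] at ha
  obtain ⟨b, rfl⟩ := ha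
  rw [← Multiplier.mul_left, upper_mul_unit]

theorem lower_left_of_mem_row {j : I × I} {a : A} (ha : a ∈ G.row j) :
    (G.lowerUnit j.2).left a = a := by
  rw [row_eq_range] at ha
  obtain ⟨b, rfl⟩ := ha
  rw [← Multiplier.mul_left, lower_mul_unit]

theorem unit_right_of_mem_col {j : I × I} {a : A} (ha : a ∈ G.col j) :
    (G.unit (· = j)).right a = a := by
  rw [← upper_mul_lower, Multiplier.mul_right, upper_right_of_mem_col ha,
    lower_right_of_mem_col ha]

theorem unit_left_of_mem_row {j : I × I} {a : A} (ha : a ∈ G.row j) :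
    (G.unit (· = j)).left a = a := by
  rw [← upper_mul_lower, Multiplier.mul_left, lower_left_of_mem_row ha,
    upper_left_of_mem_row ha]

variable {Δ : A →ₙₐ[ℂ] Multiplier (A ⊗[ℂ] A)} {E : Multiplier (A ⊗[ℂ] A)}
  {T₁ T₂ T₃ T₄ : A ⊗[ℂ] A →ₗ[ℂ] A ⊗[ℂ] A}

/-- Since `a 𝟏(j) = a`, a local unit `e` may be replaced by `e 𝟏(j)`. -/
theorem exists_unit_mem_col (h : IsBasedHopf G.lowerUnit G.upperUnit Δ E T₁ T₂) {j : I × I}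
    {a : A} (ha : a ∈ G.col j) : ∃ e ∈ G.col j, a * e = a := by
  obtain ⟨e, he⟩ := h.exists_right_unit (upper_right_of_mem_col ha)
  refine ⟨(G.unit (· = j)).right e, G.col_eq_range j ▸ ⟨e, rfl⟩, ?_⟩
  rw [← Multiplier.right_mul_assoc h.hopf.nondegenerate, he, unit_right_of_mem_col ha]

theorem exists_unit_mem_row (h : IsBasedHopf G.lowerUnit G.upperUnit Δ E T₁ T₂) {j : I × I}
    {a : A} (ha : a ∈ G.row j) : ∃ e ∈ G.row j, e * a = a := by
  obtain ⟨e, he⟩ := h.exists_left_unit (lower_left_of_mem_row ha)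
  refine ⟨(G.unit (· = j)).left e, G.row_eq_range j ▸ ⟨e, rfl⟩, ?_⟩
  rw [← Multiplier.left_mul_assoc h.hopf.nondegenerate, he, unit_left_of_mem_row ha]

theorem isNondegenerate_of_hopf (h : IsBasedHopf G.lowerUnit G.upperUnit Δ E T₁ T₂) :
    G.IsNondegenerate := by
  refine ⟨fun j a ha h0 => ?_, fun j a ha h0 => ?_⟩
  · obtain ⟨e, he, hae⟩ := exists_unit_mem_col h ha
    rw [← hae, h0 e he]
  · obtain ⟨e, he, hae⟩ := exists_unit_mem_row h ha
    rw [← hae, h0 e he]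

theorem isIdempotent_of_hopf (h : IsBasedHopf G.lowerUnit G.upperUnit Δ E T₁ T₂) :
    G.IsIdempotent := by
  refine ⟨fun j => le_antisymm (Submodule.map₂_le.2 fun a _ b hb => ?_) fun a ha => ?_,
    fun j => le_antisymm (Submodule.map₂_le.2 fun a ha b _ => ?_) fun a ha => ?_⟩
  · rw [col_eq_range]
    exact ⟨a * b, by rw [Multiplier.right_mul_assoc h.hopf.nondegenerate,
      unit_right_of_mem_col hb]; rfl⟩
  · obtain ⟨e, he, hae⟩ := exists_unit_mem_col h ha
    rw [← hae]
    exact Submodule.apply_mem_map₂ _ ha he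
  · rw [row_eq_range]
    exact ⟨a * b, by rw [Multiplier.left_mul_assoc h.hopf.nondegenerate,
      unit_left_of_mem_row ha]; rfl⟩
  · obtain ⟨e, he, hae⟩ := exists_unit_mem_row h ha
    rw [← hae]
    exact Submodule.apply_mem_map₂ _ he ha

/-! ### The partial algebra `A ⊗ᴵ A` -/

theorem tensorComp_le (h : IsBasedHopf G.lowerUnit G.upperUnit Δ E T₁ T₂) (i j : I × I)
    {y : A ⊗[ℂ] A} (hy : y ∈ G.tensorComp i j) :
    E.left y = y ∧ E.right y = y ∧
      ((G.upperUnit i.1).tensor (G.lowerUnit i.2)).left y = y ∧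
      ((G.upperUnit j.1).tensor (G.lowerUnit j.2)).right y = y := by
  classical
  suffices H : G.tensorComp i j ≤ LinearMap.eqLocus E.left LinearMap.id ⊓
      (LinearMap.eqLocus E.right LinearMap.id ⊓
      (LinearMap.eqLocus ((G.upperUnit i.1).tensor (G.lowerUnit i.2)).left LinearMap.id ⊓
      LinearMap.eqLocus ((G.upperUnit j.1).tensor (G.lowerUnit j.2)).right LinearMap.id)) from H hy
  refine iSup_le fun t => iSup_le fun u => Submodule.map₂_le.2 fun a ha b hb => ?_
  refine ⟨?_, ?_, ?_, ?_⟩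
  · change E.left (a ⊗ₜ b) = a ⊗ₜ b
    rw [h.E_left_p (t := t) (by rw [lowerUnit, G.unit_left_of_mem _ ha, if_pos rfl]), upperUnit,
      G.unit_left_of_mem _ hb, if_pos rfl]
  · change E.right (a ⊗ₜ b) = a ⊗ₜ b
    rw [h.E_right_p (t := u) (by rw [lowerUnit, G.unit_right_of_mem _ ha, if_pos rfl]), upperUnit,
      G.unit_right_of_mem _ hb, if_pos rfl]
  · change ((G.upperUnit i.1).tensor (G.lowerUnit i.2)).left (a ⊗ₜ b) = a ⊗ₜ b
    rw [Multiplier.tensor_left_tmul, upperUnit, lowerUnit, G.unit_left_of_mem _ ha,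
      G.unit_left_of_mem _ hb, if_pos rfl, if_pos rfl]
  · change ((G.upperUnit j.1).tensor (G.lowerUnit j.2)).right (a ⊗ₜ b) = a ⊗ₜ b
    rw [Multiplier.tensor_right_tmul, upperUnit, lowerUnit, G.unit_right_of_mem _ ha,
      G.unit_right_of_mem _ hb, if_pos rfl, if_pos rfl]

/-- The corner `E (A ⊗ A) E` is the sum of the components of `A ⊗ᴵ A`. -/
theorem corner_induction (h : IsBasedHopf G.lowerUnit G.upperUnit Δ E T₁ T₂)
    {S : Submodule ℂ (A ⊗[ℂ] A)} {φ : A ⊗[ℂ] A →ₗ[ℂ] A ⊗[ℂ] A}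
    (hS : ∀ i j, ∀ y ∈ G.tensorComp i j, φ y ∈ S) (y : A ⊗[ℂ] A) :
    φ (E.left (E.right y)) ∈ S := by
  classical
  induction y using TensorProduct.induction_on with
  | zero => simp
  | add x y hx hy => simp only [map_add]; exact S.add_mem hx hy
  | tmul a b =>
    induction a using G.induction with
    | zero => simp
    | add x y hx hy => simp only [map_add, TensorProduct.add_tmul]; exact S.add_mem hx hy
    | mem r s a ha =>
      induction b using G.induction with
      | zero => simp
      | add x y hx hy => simp only [map_add, TensorProduct.tmul_add]; exact S.add_mem hx hy
      | mem r' s' b hb =>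
        -- For homogeneous `a`, `b`, the element `E(a ⊗ b)E` is `a ⊗ b` if `s.2 = s'.1` and `r.2 =
        -- r'.1`, that is, if `a ⊗ b` lies in a component of `A ⊗ᴵ A`; otherwise it is `0`.
        rw [h.E_right_p (t := s.2) (by rw [lowerUnit, G.unit_right_of_mem _ ha, if_pos rfl]),
          upperUnit, G.unit_right_of_mem _ hb]
        split_ifs with hs
        · rw [h.E_left_p (t := r.2) (by rw [lowerUnit, G.unit_left_of_mem _ ha, if_pos rfl]),
            upperUnit, G.unit_left_of_mem _ hb]
          split_ifs with hr
          · refine hS (r.1, r'.2) (s.1, s'.2) _ (tens_le_tensorComp G _ _ r.2 s.2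
              (Submodule.apply_mem_map₂ _ ha ?_))
            rw [← hr, ← hs]
            exact hb
          · simp
        · simp

/-- Replaces the supremum of components by fixed-point equations for multipliers: orthogonality of
the units kills every component with a column index other than `j`. -/
theorem mem_tensorCol_iff (h : IsBasedHopf G.lowerUnit G.upperUnit Δ E T₁ T₂) (j : I × I)
    (y : A ⊗[ℂ] A) : y ∈ G.tensorCol j ↔ E.left y = y ∧ E.right y = y ∧
      ((G.upperUnit j.1).tensor (G.lowerUnit j.2)).right y = y := by
  constructor
  · intro hy
    suffices H : G.tensorCol j ≤ LinearMap.eqLocus E.left LinearMap.id ⊓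
        (LinearMap.eqLocus E.right LinearMap.id ⊓
        LinearMap.eqLocus ((G.upperUnit j.1).tensor (G.lowerUnit j.2)).right LinearMap.id) from H hy
    refine iSup_le fun i x hx => ?_
    have := tensorComp_le h i j hx
    exact ⟨this.1, this.2.1, this.2.2.2⟩
  · rintro ⟨h1, h2, h3⟩
    rw [← h3, ← h1, ← h2]
    refine corner_induction h (fun i k x hx => ?_) y
    have hx' := (tensorComp_le h i k hx).2.2.2
    by_cases hk : k = j
    · subst hk
      rw [hx']
      exact Submodule.mem_iSup_of_mem i hx
    · have h0 : (G.upperUnit k.1).tensor (G.lowerUnit k.2) *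
          (G.upperUnit j.1).tensor (G.lowerUnit j.2) = 0 := by
        rw [Multiplier.tensor_mul]
        by_cases h1 : k.1 = j.1
        · rw [h.left.orth k.2 j.2 fun h2 => hk (Prod.ext h1 h2), Multiplier.tensor_zero]
        · rw [h.right.orth k.1 j.1 h1, Multiplier.zero_tensor]
      rw [← hx', ← Multiplier.mul_right, h0, Multiplier.zero_right]
      exact Submodule.zero_mem _

theorem mem_tensorRow_iff (h : IsBasedHopf G.lowerUnit G.upperUnit Δ E T₁ T₂) (i : I × I)
    (y : A ⊗[ℂ] A) : y ∈ G.tensorRow i ↔ E.left y = y ∧ E.right y = y ∧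
      ((G.upperUnit i.1).tensor (G.lowerUnit i.2)).left y = y := by
  constructor
  · intro hy
    suffices H : G.tensorRow i ≤ LinearMap.eqLocus E.left LinearMap.id ⊓
        (LinearMap.eqLocus E.right LinearMap.id ⊓
        LinearMap.eqLocus ((G.upperUnit i.1).tensor (G.lowerUnit i.2)).left LinearMap.id) from H hy
    refine iSup_le fun j x hx => ?_
    have := tensorComp_le h i j hx
    exact ⟨this.1, this.2.1, this.2.2.1⟩
  · rintro ⟨h1, h2, h3⟩
    rw [← h3, ← h1, ← h2]
    refine corner_induction h (fun k j x hx => ?_) y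
    have hx' := (tensorComp_le h k j hx).2.2.1
    by_cases hk : i = k
    · subst hk
      rw [hx']
      exact Submodule.mem_iSup_of_mem j hx
    · have h0 : (G.upperUnit i.1).tensor (G.lowerUnit i.2) *
          (G.upperUnit k.1).tensor (G.lowerUnit k.2) = 0 := by
        rw [Multiplier.tensor_mul]
        by_cases h1 : i.1 = k.1
        · rw [h.left.orth i.2 k.2 fun h2 => hk (Prod.ext h1 h2), Multiplier.tensor_zero]
        · rw [h.right.orth i.1 k.1 h1, Multiplier.zero_tensor]
      rw [← hx', ← Multiplier.mul_left, h0, Multiplier.zero_left]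
      exact Submodule.zero_mem _

/-- `Δ` carries right multiplication by `𝟏ʳ` to that by `𝟏ʳ ⊗ 1`, and by `𝟏ₜ` to that by `1 ⊗ 𝟏ₜ`;
for `j = (r, t)` these combine. -/
theorem delta_right_unit (h : IsBasedHopf G.lowerUnit G.upperUnit Δ E T₁ T₂) (j : I × I) (a : A) :
    Δ a * (G.upperUnit j.1).tensor (G.lowerUnit j.2) = Δ ((G.unit (· = j)).right a) := by
  rw [← G.upper_mul_lower, Multiplier.mul_right, h.delta_p_right, h.delta_q_right, mul_assoc,
    Multiplier.tensor_mul, one_mul, mul_one]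

theorem delta_left_unit (h : IsBasedHopf G.lowerUnit G.upperUnit Δ E T₁ T₂) (j : I × I) (a : A) :
    (G.upperUnit j.1).tensor (G.lowerUnit j.2) * Δ a = Δ ((G.unit (· = j)).left a) := by
  rw [← G.upper_mul_lower, Multiplier.mul_left, h.delta_q_left, h.delta_p_left, ← mul_assoc,
    Multiplier.tensor_mul, one_mul, mul_one]

/-- An element `y = y E` is a sum of terms `(u ⊗ 1)Δ(v)`, and the column condition allows `v ∈ A_j`.
A local unit `v = v e` with `e ∈ A_j` then splits off the factor `Δ(e)`. -/
theorem span_tensorCol (h : IsBasedHopf G.lowerUnit G.upperUnit Δ E T₁ T₂) (j : I × I) :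
    Submodule.span ℂ {z | ∃ y ∈ G.tensorCol j, ∃ a ∈ G.col j, z = (Δ a).right y} =
      G.tensorCol j := by
  have hB := h.hopf.nondegenerate₂
  apply le_antisymm
  · rw [Submodule.span_le]
    rintro _ ⟨y, hy, a, ha, rfl⟩
    have hy' := (mem_tensorCol_iff h j y).1 hy
    refine (mem_tensorCol_iff h j _).2 ⟨?_, ?_, ?_⟩
    · rw [Multiplier.left_right_comm hB, hy'.1]
    · rw [← Multiplier.mul_right, h.hopf.delta_mul_E]
    · rw [← Multiplier.mul_right, delta_right_unit h, unit_right_of_mem_col ha]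
  · intro y hy
    obtain ⟨h1, h2, h3⟩ := (mem_tensorCol_iff h j y).1 hy
    obtain ⟨w, rfl⟩ : y ∈ LinearMap.range T₂ := h.hopf.range_T₂ ▸ ⟨y, h2⟩
    rw [← h1, ← h3]
    clear h1 h2 h3 hy
    induction w using TensorProduct.induction_on with
    | zero => simp
    | add x y hx hy => simp only [map_add]; exact Submodule.add_mem _ hx hy
    | tmul u v =>
      have key : ∀ v, ((G.upperUnit j.1).tensor (G.lowerUnit j.2)).right (T₂ (u ⊗ₜ v)) =
          T₂ (u ⊗ₜ (G.unit (· = j)).right v) := fun v => by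
        apply toMultiplier_injective hB
        rw [toMultiplier_right_apply hB, h.hopf.isT₂, h.hopf.isT₂, mul_assoc, delta_right_unit h]
      rw [key]
      have hv : (G.unit (· = j)).right v ∈ G.col j := G.col_eq_range j ▸ ⟨v, rfl⟩
      generalize (G.unit (· = j)).right v = v at hv ⊢
      obtain ⟨e, he, hve⟩ := exists_unit_mem_col h hv
      have h4 : T₂ (u ⊗ₜ (v * e)) = (Δ e).right (T₂ (u ⊗ₜ v)) := by
        apply toMultiplier_injective hB
        rw [toMultiplier_right_apply hB, h.hopf.isT₂, h.hopf.isT₂, mul_assoc, map_mul]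
      -- The factor `E` on the left moves `T₂(u ⊗ v)` into the corner; it commutes with right
      -- multiplication by `Δ(e)`.
      refine Submodule.subset_span ⟨E.left (T₂ (u ⊗ₜ v)), (mem_tensorCol_iff h j _).2 ⟨?_, ?_, ?_⟩,
        e, he, ?_⟩
      · rw [← Multiplier.mul_left, h.hopf.idem]
      · rw [← Multiplier.left_right_comm hB, h.hopf.T₂_E]
      · rw [← Multiplier.left_right_comm hB, key, unit_right_of_mem_col hv]
      · rw [← Multiplier.left_right_comm hB, ← h4, hve]

theorem span_tensorRow (h : IsBasedHopf G.lowerUnit G.upperUnit Δ E T₁ T₂) (i : I × I) :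
    Submodule.span ℂ {z | ∃ a ∈ G.row i, ∃ y ∈ G.tensorRow i, z = (Δ a).left y} =
      G.tensorRow i := by
  have hB := h.hopf.nondegenerate₂
  apply le_antisymm
  · rw [Submodule.span_le]
    rintro _ ⟨a, ha, y, hy, rfl⟩
    have hy' := (mem_tensorRow_iff h i y).1 hy
    refine (mem_tensorRow_iff h i _).2 ⟨?_, ?_, ?_⟩
    · rw [← Multiplier.mul_left, h.hopf.E_mul_delta]
    · rw [← Multiplier.left_right_comm hB, hy'.2.1]
    · rw [← Multiplier.mul_left, delta_left_unit h, unit_left_of_mem_row ha]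
  · intro y hy
    obtain ⟨h1, h2, h3⟩ := (mem_tensorRow_iff h i y).1 hy
    obtain ⟨w, rfl⟩ : y ∈ LinearMap.range T₁ := h.hopf.range_T₁ ▸ ⟨y, h1⟩
    rw [← h2, ← h3]
    clear h1 h2 h3 hy
    induction w using TensorProduct.induction_on with
    | zero => simp
    | add x y hx hy => simp only [map_add]; exact Submodule.add_mem _ hx hy
    | tmul v u =>
      have key : ∀ v, ((G.upperUnit i.1).tensor (G.lowerUnit i.2)).left (T₁ (v ⊗ₜ u)) =
          T₁ ((G.unit (· = i)).left v ⊗ₜ u) := fun v => by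
        apply toMultiplier_injective hB
        rw [toMultiplier_left_apply hB, h.hopf.isT₁, h.hopf.isT₁, ← mul_assoc, delta_left_unit h]
      rw [key]
      have hv : (G.unit (· = i)).left v ∈ G.row i := G.row_eq_range i ▸ ⟨v, rfl⟩
      generalize (G.unit (· = i)).left v = v at hv ⊢
      obtain ⟨e, he, hve⟩ := exists_unit_mem_row h hv
      have h4 : T₁ ((e * v) ⊗ₜ u) = (Δ e).left (T₁ (v ⊗ₜ u)) := by
        apply toMultiplier_injective hB
        rw [toMultiplier_left_apply hB, h.hopf.isT₁, h.hopf.isT₁, ← mul_assoc, map_mul]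
      refine Submodule.subset_span ⟨e, he, E.right (T₁ (v ⊗ₜ u)),
        (mem_tensorRow_iff h i _).2 ⟨?_, ?_, ?_⟩, ?_⟩
      · rw [Multiplier.left_right_comm hB, h.hopf.E_T₁]
      · rw [← Multiplier.mul_right, h.hopf.idem]
      · rw [Multiplier.left_right_comm hB, key, unit_left_of_mem_row hv]
      · rw [Multiplier.left_right_comm hB, ← h4, hve]

theorem isCounit_of_hopf (h : IsBasedHopf G.lowerUnit G.upperUnit Δ E T₁ T₂)
    (hT₃ : IsT₃ Δ T₃) (hT₄ : IsT₄ Δ T₄) {ε : A →ₗ[ℂ] ℂ}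
    (hl : ∀ a b, sliceLeft ε (T₁ (a ⊗ₜ b)) = a * b)
    (hr : ∀ a b, sliceRight ε (T₂ (a ⊗ₜ b)) = a * b) : G.IsCounit T₁ T₂ T₃ T₄ ε where
  eq_zero r s t u hne a ha := by
    classical
    rcases hne with hne | hne
    -- On the left, `𝟏ₜ` fixes `a` while `𝟏ᵗ` kills it if `r ≠ t`; the counit does not distinguish
    -- the two.
    · have := h.counit_left hl t a
      rwa [lowerUnit, upperUnit, G.unit_left_of_mem _ ha, G.unit_left_of_mem _ ha, if_pos rfl,
        if_neg hne, map_zero] at this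
    · have := h.counit_right hr u a
      rwa [lowerUnit, upperUnit, G.unit_right_of_mem _ ha, G.unit_right_of_mem _ ha, if_pos rfl,
        if_neg hne, map_zero] at this
  ne_zero r := by
    obtain ⟨x, hx⟩ := h.exists_counit_right_ne_zero hr r
    obtain ⟨y, hy⟩ := h.exists_counit_left_ne_zero hl r
    exact ⟨⟨_, G.lowerCol_eq_range r ▸ ⟨x, rfl⟩, hx⟩, ⟨_, G.lowerRow_eq_range r ▸ ⟨y, rfl⟩, hy⟩⟩
  map_mul s t a ha b hb := by
    rw [h.counit_mul hl (s := t) a (lower_left_of_mem_row hb), lower_right_of_mem_col ha]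
  slice_right a b := ⟨h.hopf.sliceRight_T₃ hT₃ hr a b, hr b a⟩
  slice_left a b := ⟨hl a b, h.hopf.sliceLeft_T₄ hT₄ hl a b⟩

end SquareUnits

end PartialAlgebra

/-! ### Passage to the opposite comultiplication -/

section Opposite

variable {I : Type*} {A : Type*} [NonUnitalRing A] [Module ℂ A] [IsScalarTower ℂ A A]
  [SMulCommClass ℂ A A]
variable {Δ : A →ₙₐ[ℂ] Multiplier (A ⊗[ℂ] A)} {E : Multiplier (A ⊗[ℂ] A)}
  {T : A ⊗[ℂ] A →ₗ[ℂ] A ⊗[ℂ] A}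

theorem IsT₁.of_coop (h : IsT₁ (coop Δ) T) :
    IsT₃ Δ ((TensorProduct.comm ℂ A A).toLinearMap ∘ₗ T) := fun a b => by
  refine (flipMultiplier_toMultiplier _).symm.trans ((congrArg flipMultiplier (h a b)).trans ?_)
  rw [flip_mul, flipMultiplier_inr]
  exact congrArg (· * inl b) (flipMultiplier_flip (Δ a))

theorem IsT₂.of_coop (h : IsT₂ (coop Δ) T) :
    IsT₄ Δ ((TensorProduct.comm ℂ A A).toLinearMap ∘ₗ T) := fun a b => by
  refine (flipMultiplier_toMultiplier _).symm.trans ((congrArg flipMultiplier (h a b)).trans ?_)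
  rw [flip_mul, flipMultiplier_inl]
  exact congrArg (inr a * ·) (flipMultiplier_flip (Δ b))

theorem IsStrictSum.flip {p q : I → Multiplier A}
    (h : IsStrictSum (fun s => (p s).tensor (q s)) E) :
    IsStrictSum (fun s => (q s).tensor (p s)) (flipMultiplier E) := by
  intro x
  have key : ∀ S : Finset I, ∑ s ∈ S, (q s).tensor (p s) =
      flipMultiplier (∑ s ∈ S, (p s).tensor (q s)) := fun S => by
    rw [map_sum]
    exact Finset.sum_congr rfl fun s _ => (flipMultiplier_tensor _ _).symm
  filter_upwards [h ((TensorProduct.comm ℂ A A).symm x)] with S hS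
  rw [key]
  exact ⟨congrArg (TensorProduct.comm ℂ A A) hS.1, congrArg (TensorProduct.comm ℂ A A) hS.2⟩

end Opposite

end PartialQG
end

/-! ### Assembly of the theorem -/

theorem mainTheorem7 {I : Type*} {A : Type*} [NonUnitalRing A] [Module ℂ A]
    [IsScalarTower ℂ A A] [SMulCommClass ℂ A A]
    (G : PartialQG.PartialAlgebra (I × I) A)
    (hnd : PartialQG.IsNondegenerateAlgebra A) (hid : PartialQG.IsIdempotentAlgebra A)
    (hunits : ∀ k : I, G.lowerUnit k ≠ 0 ∧ G.upperUnit k ≠ 0)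
    (Δ : A →ₙₐ[ℂ] PartialQG.Multiplier (TensorProduct ℂ A A))
    (E : PartialQG.Multiplier (TensorProduct ℂ A A))
    (hΔ : PartialQG.IsRegularWeakMultiplierHopf Δ E)
    (hE : PartialQG.IsStrictSum
      (fun s : I => (G.lowerUnit s).tensor (G.upperUnit s)) E) :
    G.IsNondegenerate ∧ G.IsIdempotent ∧ G.IsRegularPartialMultiplierHopf Δ := by
  obtain ⟨⟨T₁, T₂, h⟩, T₃, T₄, h'⟩ := hΔ
  have hb : PartialQG.IsBasedHopf G.lowerUnit G.upperUnit Δ E T₁ T₂ :=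
    ⟨G.isOrthogonalDecomposition Prod.snd, G.isOrthogonalDecomposition Prod.fst,
      fun k => (hunits k).1, fun k => (hunits k).2, hE, h⟩
  -- The flip of `E` is `∑ 𝟏ˢ ⊗ 𝟏ₛ`, so the two families exchange their roles.
  have hb' : PartialQG.IsBasedHopf G.upperUnit G.lowerUnit (PartialQG.coop Δ)
      (PartialQG.flipMultiplier E) T₃ T₄ :=
    ⟨hb.right, hb.left, hb.right_ne_zero, hb.left_ne_zero, hE.flip, h'⟩
  have hnd' := PartialQG.PartialAlgebra.isNondegenerate_of_hopf hb
  have hid' := PartialQG.PartialAlgebra.isIdempotent_of_hopf hb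
  have hT₃ := h'.isT₁.of_coop
  have hT₄ := h'.isT₂.of_coop
  obtain ⟨ε, hl, hr⟩ := h.exists_counit
  refine ⟨hnd', hid', hnd', hid', E, T₁, T₂, _, _, ε, hE,
    ⟨fun a => ⟨h.E_mul_delta a, h.delta_mul_E a⟩,
      PartialQG.PartialAlgebra.span_tensorCol hb, PartialQG.PartialAlgebra.span_tensorRow hb,
      h.isT₁, h.isT₂, hT₃, hT₄, h.exists_coassoc hT₄⟩,
    PartialQG.PartialAlgebra.isCounit_of_hopf hb hT₃ hT₄ hl hr, ?_⟩
  -- The witnesses for `Δ(a)(b ⊗ 1)` and `(1 ⊗ a)Δ(b)` are flips of the canonical maps of `Δᵒᵖ`; the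
  -- flip in the definition undoes this.
  simp only [G.lowerCol_eq_range, G.lowerRow_eq_range, G.upperCol_eq_range, G.upperRow_eq_range,
    LinearMap.comp_apply, LinearEquiv.coe_coe, TensorProduct.comm_comm]
  exact ⟨hb.bijOn_T₁, hb.bijOn_T₂, hb'.bijOn_T₁, hb'.bijOn_T₂⟩
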